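/- Let $n\ge 1$, $\mu>0$, and let $\mathbb{C}\mathrm{H}(n)$ be the complex hyperbolic space of negative complex lines of $\mathbb{C}^{n+1}$ with respect to $\hat h(X,Y)=\sum_{i<n}X_i\overline{Y_i}+X_n\overline{Y_{n+1}}+X_{n+1}\overline{Y_n}$, with its Kähler structure $(g,J)$ of holomorphic sectional curvature $-4/\mu$, Levi-Civita connection $\nabla$ and curvature $R$. A homogeneous Kähler structure is a smooth $(1,2)$-tensor field $S$ such that $\tilde\nabla=\nabla-S$ satisfies $\tilde\nabla g=0$, $\tilde\nabla J=0$, $\tilde\nabla R=0$, $\tilde\nabla S=0$; put $S_{XYZ}=g(S_XY,Z)$. Let $\mathfrak{su}(n,1)=\mathfrak k+\mathfrak a+\mathfrak n$ be the Iwasawa decomposition, $\mathfrak a=\mathbb{R}A_0$, $A_0=\mathrm{diag}(0,\dots,0,1,-1)$, and let $\mathfrak s(\mathfrak u(n-1)+\mathfrak u(1))$ be the centralizer of $\mathfrak a$ in $\mathfrak k$. Let $o$ be the class of $(0,\dots,0,1,-1)$. A non-symmetric reductive description consists of a Lie subalgebra $\mathfrak f_r\subset \mathfrak s(\mathfrak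 u(n-1)+\mathfrak u(1))+\mathfrak a$ with non-trivial projection to $\mathfrak a$, so that $\mathfrak g=\mathfrak f_r+\mathfrak n$ is the Lie algebra of a connected group $G=F_rN$ of isometries transitive on $\mathbb{C}\mathrm{H}(n)=G/H$, with isotropy algebra $\mathfrak h=\mathfrak f_r\cap\mathfrak s(\mathfrak u(n-1)+\mathfrak u(1))$, together with a vector space decomposition $\mathfrak g=\mathfrak h\oplus\mathfrak m$ with $[\mathfrak h,\mathfrak m]\subset\mathfrak m$. For $D\in\mathfrak m$ let $\alpha_D\in\mathbb{R}$ be the coefficient of $A_0$ in the decomposition of $D$ in $\mathfrak s(\mathfrak u(n-1)+\mathfrak u(1))\oplus\mathfrak a\oplus\mathfrak n$. Given a point $p$ and $x\in \mathrm{SU}(n,1)$ with $x\cdot o=p$, identify $\mathfrak m$ with $V=T_p\mathbb{C}\mathrm{H}(n)$ by $D\mapsto D^*_p$, where $D^*$ is the infinitesimal generator of $xDx^{-1}$. The description, transported by $x$, is said to realize $S$ at $p$ if $\tilde\nabla=\nabla-S$ is its canonical connection, i.e. $(\tilde\nabla_{B^*}C^*)_p=-([B,C]_{\mathfrak m})^*_p$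 for $B,C\in\mathfrak m$. On $V$ let $\mathcal K(V)=\{T\in\otimes^3V^*: T_{XYZ}=-T_{XZY},\ T_{X\,JY\,JZ}=T_{XYZ}\}$ and $\mathrm c_{12}(T)(Z)=\sum_{i=1}^{2n}T_{e_ie_iZ}$ for any orthonormal basis $(e_i)$; $\ker(\mathrm c_{12})$ and its orthogonal complement are taken in $\mathcal K(V)$ with the inner product $\sum_{i,j,l}T_{e_ie_je_l}T'_{e_ie_je_l}$. For $\epsilon=-1$ (resp. $\epsilon=+1$) let $\mathcal K_2(V)$ (resp. $\mathcal K_4(V)$) be the set of tensors $T_{XYZ}=g(X,Y)\theta(Z)-g(X,Z)\theta(Y)+g(X,JY)\theta(JZ)-g(X,JZ)\theta(JY)+2\epsilon\, g(JY,Z)\theta(JX)$ with $\theta\in V^*$, and $\mathcal K_{2+4}(V)=\mathcal K_2(V)+\mathcal K_4(V)$. **Corollary.** Let $S$ be a homogeneous Kähler structure on $\mathbb{C}\mathrm{H}(n)$ that is not identically zero, and let $p\in\mathbb{C}\mathrm{H}(n)$. Then $S$ is realized at $p$ by some non-symmetric reductive description, and for every non-symmetric reductive description that realizes $S$ at $p$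 (by means of any $x$ as above), $$\mathrm c_{12}(S_p)(D^*_p)=2n\,\alpha_D\qquad\text{for all } D\in\mathfrak m .$$ In particular, $S_p$ has a nonzero component in $\ker(\mathrm c_{12})^{\perp}$, and $\ker(\mathrm c_{12})^\perp\subset\mathcal K_{2+4}(V)$. -/

import Mathlib

open scoped Matrix ContDiff ComplexConjugate

set_option maxSynthPendingDepth 3

attribute [local instance 100] LieRing.ofAssociativeRing

noncomputable section

namespace CHn

/-! Throughout `n = k + 1 ≥ 1`. Vectors of `ℂ^{n+1}` are indexed by `Fin k ⊕ Fin 2`: first the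
`n - 1` coordinates of `ℂ^{n-1}`, then the coordinates number `n` and `n + 1`. -/

/-- Index set of the coordinates of `ℂ^{n+1}`. -/
abbrev Idx (k : ℕ) := Fin k ⊕ Fin 2

/-- Complex matrices of size `n + 1`. -/
abbrev Mat (k : ℕ) := Matrix (Idx k) (Idx k) ℂ

/-- `ℂⁿ = ℂ^{n-1} × ℂ`, the space of the global affine chart of `CH(n)`; it is also every tangent
space in that chart. -/
abbrev E (k : ℕ) := (Fin k → ℂ) × ℂ

/-! ### The complex hyperbolic space -/

/-- The hermitian product `∑_{i<n} X_i conj Y_i + X_n conj Y_{n+1} + X_{n+1} conj Y_n`. -/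
def herm {k : ℕ} (X Y : Idx k → ℂ) : ℂ :=
  (∑ i : Fin k, X (Sum.inl i) * conj (Y (Sum.inl i))) +
    X (Sum.inr 0) * conj (Y (Sum.inr 1)) + X (Sum.inr 1) * conj (Y (Sum.inr 0))

/-- The representative with last homogeneous coordinate `1` of a point of the affine chart. -/
def lift {k : ℕ} (p : E k) : Idx k → ℂ := Sum.elim p.1 ![p.2, 1]

/-- The derivative of `lift` in the direction `X`. -/
def tlift {k : ℕ} (X : E k) : Idx k → ℂ := Sum.elim X.1 ![X.2, 0]

/-- `CH(n)`, the set of negative complex lines of `ℂ^{n+1}`. A negative vector has nonzero last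
coordinate, so `CH(n)` lies in one affine chart, where it is this (Siegel) domain. -/
def CH (k : ℕ) : Set (E k) := {p | (herm (lift p) (lift p)).re < 0}

/-- The horizontal part, i.e. the part orthogonal to the complex line of `lift p`,
of the tangent vector `X`. -/
def hor {k : ℕ} (p : E k) (X : E k) : Idx k → ℂ :=
  tlift X - (herm (tlift X) (lift p) / herm (lift p) (lift p)) • lift p

theorem tlift_add {k : ℕ} (X Y : E k) : tlift (X + Y) = tlift X + tlift Y := by
  funext i
  rcases i with i | i
  · simp [tlift]
  · fin_cases i <;> simp [tlift]

theorem tlift_csmul {k : ℕ} (c : ℂ) (X : E k) : tlift (c • X) = c • tlift X := by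
  funext i
  rcases i with i | i
  · simp [tlift]
  · fin_cases i <;> simp [tlift]

theorem herm_add_left {k : ℕ} (X Y Z : Idx k → ℂ) :
    herm (X + Y) Z = herm X Z + herm Y Z := by
  simp only [herm, Pi.add_apply, add_mul, Finset.sum_add_distrib]; ring

theorem herm_smul_left {k : ℕ} (c : ℂ) (X Z : Idx k → ℂ) :
    herm (c • X) Z = c * herm X Z := by
  simp only [herm, Pi.smul_apply, smul_eq_mul, mul_assoc, mul_add, Finset.mul_sum]

theorem herm_conj {k : ℕ} (X Y : Idx k → ℂ) : conj (herm X Y) = herm Y X := by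
  simp only [herm, map_add, map_sum, map_mul, Complex.conj_conj]
  rw [Finset.sum_congr rfl fun i _ => mul_comm (conj (X (Sum.inl i))) (Y (Sum.inl i))]
  ring

theorem herm_add_right {k : ℕ} (X Y Z : Idx k → ℂ) :
    herm X (Y + Z) = herm X Y + herm X Z := by
  rw [← herm_conj, herm_add_left, map_add, herm_conj, herm_conj]

theorem herm_smul_right {k : ℕ} (c : ℂ) (X Z : Idx k → ℂ) :
    herm X (c • Z) = conj c * herm X Z := by
  rw [← herm_conj, herm_smul_left, map_mul, herm_conj]

theorem hor_add {k : ℕ} (p X Y : E k) : hor p (X + Y) = hor p X + hor p Y := by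
  simp only [hor, tlift_add, herm_add_left, add_div, add_smul]; abel

theorem hor_csmul {k : ℕ} (p : E k) (c : ℂ) (X : E k) : hor p (c • X) = c • hor p X := by
  simp only [hor, tlift_csmul, herm_smul_left, smul_sub, smul_smul, mul_div_assoc]

theorem hor_smul {k : ℕ} (p : E k) (c : ℝ) (X : E k) : hor p (c • X) = (c : ℂ) • hor p X := by
  rw [← hor_csmul]; congr 1

/-- The Riemannian metric of `CH(n)` with parameter `μ > 0` (holomorphic sectional curvature
`-4/μ`) at the point `p`. The factor `μ / (-herm (lift p) (lift p))` is the square of the factor by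
which `lift p` is rescaled to a vector `z` with `herm z z = -μ`; the tangent vectors are lifted
horizontally to `z` and multiplied by `Re herm`. -/
def metric {k : ℕ} (μ : ℝ) (p : E k) : E k →ₗ[ℝ] E k →ₗ[ℝ] ℝ :=
  LinearMap.mk₂ ℝ
    (fun X Y => μ / (-(herm (lift p) (lift p)).re) * (herm (hor p X) (hor p Y)).re)
    (by intro X Y Z; simp only [hor_add, herm_add_left, Complex.add_re]; ring)
    (by
      intro c X Y
      simp only [hor_smul, herm_smul_left, Complex.re_ofReal_mul, smul_eq_mul]; ring)
    (by intro X Y Z; simp only [hor_add, herm_add_right, Complex.add_re]; ring)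
    (by
      intro c X Y
      simp only [hor_smul, herm_smul_right, Complex.conj_ofReal, Complex.re_ofReal_mul,
        smul_eq_mul]
      ring)

/-- The complex structure. -/
def J {k : ℕ} (X : E k) : E k := Complex.I • X

/-- The coefficients (Christoffel symbols) of the Levi-Civita connection in the affine chart:
`∇_X Y = D_X Y + christoffel p X Y`. They are characterized by `christoffel_symm` and
`christoffel_metric` below. -/
def christoffel {k : ℕ} (p X Y : E k) : E k :=
  -((herm (tlift X) (lift p) / herm (lift p) (lift p)) • Y) -
    (herm (tlift Y) (lift p) / herm (lift p) (lift p)) • X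

/-- The Levi-Civita connection has no torsion. -/
theorem christoffel_symm {k : ℕ} (p X Y : E k) : christoffel p X Y = christoffel p Y X := by
  simp only [christoffel]; abel

theorem lift_add_smul {k : ℕ} (p V : E k) (t : ℝ) :
    lift (p + t • V) = lift p + (t : ℂ) • tlift V := by
  funext i
  rcases i with i | i
  · simp [lift, tlift]
  · fin_cases i <;> simp [lift, tlift]

theorem metric_apply {k : ℕ} (μ : ℝ) (p X Y : E k) (hp : p ∈ CH k) :
    metric μ p X Y = ((μ : ℂ) * (-(herm (tlift X) (tlift Y)) / herm (lift p) (lift p) +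
      herm (tlift X) (lift p) * herm (lift p) (tlift Y) / herm (lift p) (lift p) ^ 2)).re := by
  have hr : ((herm (lift p) (lift p)).re : ℂ) = herm (lift p) (lift p) :=
    Complex.conj_eq_iff_re.1 (herm_conj _ _)
  have h0 : herm (lift p) (lift p) ≠ 0 := by
    intro h
    have hp' : (herm (lift p) (lift p)).re < 0 := hp
    rw [h] at hp'
    simp at hp'
  have hh : herm (hor p X) (hor p Y) = herm (tlift X) (tlift Y) -
      herm (tlift X) (lift p) * herm (lift p) (tlift Y) / herm (lift p) (lift p) := by
    simp only [hor, sub_eq_add_neg, ← neg_smul, herm_add_left, herm_add_right, herm_smul_left,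
      herm_smul_right, map_neg, map_div₀, herm_conj]
    field_simp
    ring
  have : metric μ p X Y = μ / (-(herm (lift p) (lift p)).re) * (herm (hor p X) (hor p Y)).re := rfl
  rw [this, ← Complex.re_ofReal_mul, hh]
  congr 1
  push_cast
  rw [hr]
  field_simp
  ring

theorem isOpen_CH (k : ℕ) : IsOpen (CH k) := by
  have h : Continuous fun p : E k => (herm (lift p) (lift p)).re := by
    simp only [herm, lift, Sum.elim_inl, Sum.elim_inr, Matrix.cons_val_zero, Matrix.cons_val_one]
    fun_prop
  exact isOpen_lt h continuous_const

/-- The Levi-Civita connection is metric. -/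
theorem christoffel_metric {k : ℕ} (μ : ℝ) (p : E k) (hp : p ∈ CH k) (V X Y : E k) :
    fderiv ℝ (fun q => metric μ q X Y) p V =
      metric μ p (christoffel p V X) Y + metric μ p X (christoffel p V Y) := by
  have h0 : herm (lift p) (lift p) ≠ 0 := by
    intro h
    have hp' : (herm (lift p) (lift p)).re < 0 := hp
    rw [h] at hp'
    simp at hp'
  have hev : (fun q => metric μ q X Y) =ᶠ[nhds p] fun q =>
      ((μ : ℂ) * (-(herm (tlift X) (tlift Y)) / herm (lift q) (lift q) +
      herm (tlift X) (lift q) * herm (lift q) (tlift Y) / herm (lift q) (lift q) ^ 2)).re := by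
    filter_upwards [(isOpen_CH k).mem_nhds hp] with q hq using metric_apply μ q X Y hq
  have d1 : DifferentiableAt ℝ (fun q : E k => herm (lift q) (lift q)) p := by
    simp only [herm, lift, Sum.elim_inl, Sum.elim_inr, Matrix.cons_val_zero, Matrix.cons_val_one]
    fun_prop
  have d2 : DifferentiableAt ℝ (fun q : E k => herm (tlift X) (lift q)) p := by
    simp only [herm, lift, Sum.elim_inl, Sum.elim_inr, Matrix.cons_val_zero, Matrix.cons_val_one]
    fun_prop
  have d3 : DifferentiableAt ℝ (fun q : E k => herm (lift q) (tlift Y)) p := by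
    simp only [herm, lift, Sum.elim_inl, Sum.elim_inr, Matrix.cons_val_zero, Matrix.cons_val_one]
    fun_prop
  have hd : DifferentiableAt ℝ (fun q : E k =>
      ((μ : ℂ) * (-(herm (tlift X) (tlift Y)) / herm (lift q) (lift q) +
      herm (tlift X) (lift q) * herm (lift q) (tlift Y) / herm (lift q) (lift q) ^ 2)).re) p := by
    have h2 : herm (lift p) (lift p) ^ 2 ≠ 0 := pow_ne_zero 2 h0
    have c1 : DifferentiableAt ℝ (fun _ : E k => -(herm (tlift X) (tlift Y))) p :=
      differentiableAt_const _
    have d4 : DifferentiableAt ℝ (fun q : E k => herm (lift q) (lift q) ^ 2) p := d1.pow 2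
    have q1 : DifferentiableAt ℝ (fun q : E k =>
        -(herm (tlift X) (tlift Y)) / herm (lift q) (lift q)) p := by
      simp only [div_eq_mul_inv]
      exact c1.fun_mul (d1.fun_inv h0)
    have q2 : DifferentiableAt ℝ (fun q : E k => herm (tlift X) (lift q) *
        herm (lift q) (tlift Y) / herm (lift q) (lift q) ^ 2) p := by
      simp only [div_eq_mul_inv]
      exact (d2.fun_mul d3).fun_mul (d4.fun_inv h2)
    have := (q1.fun_add q2).const_mul (μ : ℂ)
    exact Complex.reCLM.differentiableAt.comp p this
  rw [hev.fderiv_eq, ← hd.lineDeriv_eq_fderiv, lineDeriv]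
  have e1 : HasDerivAt (fun t : ℝ => herm (lift (p + t • V)) (lift (p + t • V)))
      (herm (tlift V) (lift p) + herm (lift p) (tlift V)) 0 := by
    simp only [lift_add_smul, herm_add_left, herm_add_right, herm_smul_left, herm_smul_right,
      Complex.conj_ofReal]
    have ht : HasDerivAt (fun t : ℝ => (t : ℂ)) 1 0 := Complex.ofRealCLM.hasDerivAt
    have := (((ht.mul_const (herm (lift p) (tlift V))).const_add (herm (lift p) (lift p))).add
      (ht.mul ((ht.mul_const (herm (tlift V) (tlift V))).const_add (herm (tlift V) (lift p)))))
    refine (this.congr_deriv ?_).congr_of_eventuallyEq (Filter.Eventually.of_forall fun t => ?_)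
    · simp; ring
    · simp; ring
  have e2 : HasDerivAt (fun t : ℝ => herm (tlift X) (lift (p + t • V)))
      (herm (tlift X) (tlift V)) 0 := by
    simp only [lift_add_smul, herm_add_right, herm_smul_right, Complex.conj_ofReal]
    have ht : HasDerivAt (fun t : ℝ => (t : ℂ)) 1 0 := Complex.ofRealCLM.hasDerivAt
    simpa using (ht.mul_const (herm (tlift X) (tlift V))).const_add (herm (tlift X) (lift p))
  have e3 : HasDerivAt (fun t : ℝ => herm (lift (p + t • V)) (tlift Y))
      (herm (tlift V) (tlift Y)) 0 := by
    simp only [lift_add_smul, herm_add_left, herm_smul_left]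
    have ht : HasDerivAt (fun t : ℝ => (t : ℂ)) 1 0 := Complex.ofRealCLM.hasDerivAt
    simpa using (ht.mul_const (herm (tlift V) (tlift Y))).const_add (herm (lift p) (tlift Y))
  have z : p + (0 : ℝ) • V = p := by simp
  have h0' : herm (lift (p + (0 : ℝ) • V)) (lift (p + (0 : ℝ) • V)) ≠ 0 := by rwa [z]
  have e4 := (((hasDerivAt_const (0 : ℝ) (-(herm (tlift X) (tlift Y)))).div e1 h0').add
      ((e2.mul e3).div (e1.pow 2) (pow_ne_zero 2 h0'))).const_mul (μ : ℂ)
  have e5 := (Complex.reCLM.hasFDerivAt.comp_hasDerivAt (0 : ℝ) e4).deriv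
  refine e5.trans ?_
  have t1 : ∀ A B : E k, tlift (christoffel p A B) =
      (-(herm (tlift A) (lift p) / herm (lift p) (lift p))) • tlift B +
      (-(herm (tlift B) (lift p) / herm (lift p) (lift p))) • tlift A := by
    intro A B
    rw [christoffel, sub_eq_add_neg, ← neg_smul, ← neg_smul, tlift_add, tlift_csmul, tlift_csmul]
  rw [metric_apply μ p _ _ hp, metric_apply μ p _ _ hp, t1, t1, ← Complex.add_re,
    Complex.reCLM_apply]
  congr 1
  simp only [z, Pi.pow_apply, Pi.mul_apply, herm_add_left, herm_add_right, herm_smul_left,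
    herm_smul_right, map_neg, map_div₀, herm_conj]
  field_simp
  ring

/-- The curvature tensor `R(X, Y) Z` of the Levi-Civita connection. -/
def curvature {k : ℕ} (p X Y Z : E k) : E k :=
  fderiv ℝ (fun q => christoffel q Y Z) p X - fderiv ℝ (fun q => christoffel q X Z) p Y +
    christoffel p X (christoffel p Y Z) - christoffel p Y (christoffel p X Z)

/-! ### Homogeneous Kähler structures -/

/-- A field of `(1,2)`-tensors in the affine chart, `S p X Y = (S_X Y)_p`. -/
abbrev TensorField12 (k : ℕ) := E k → E k →L[ℝ] E k →L[ℝ] E k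

/-- The coefficients of the connection `∇ - S`. -/
def tildeConn {k : ℕ} (S : TensorField12 k) (p X Y : E k) : E k := christoffel p X Y - S p X Y

/-- `S` is a homogeneous Kähler structure on `CH(n)`: a smooth `(1,2)`-tensor field such that the
metric, the complex structure, the curvature tensor and `S` itself are parallel for `∇ - S`.
The covariant derivatives are evaluated on constant vector fields of the chart. -/
structure IsHomogeneousKahlerStructure {k : ℕ} (μ : ℝ) (S : TensorField12 k) : Prop where
  smooth : ContDiffOn ℝ ∞ S (CH k)
  parallel_metric : ∀ p ∈ CH k, ∀ V X Y : E k,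
    fderiv ℝ (fun q => metric μ q X Y) p V - metric μ p (tildeConn S p V X) Y -
      metric μ p X (tildeConn S p V Y) = 0
  parallel_J : ∀ p ∈ CH k, ∀ V X : E k,
    tildeConn S p V (J X) - J (tildeConn S p V X) = 0
  parallel_curvature : ∀ p ∈ CH k, ∀ V X Y Z : E k,
    fderiv ℝ (fun q => curvature q X Y Z) p V + tildeConn S p V (curvature p X Y Z) -
      curvature p (tildeConn S p V X) Y Z - curvature p X (tildeConn S p V Y) Z -
      curvature p X Y (tildeConn S p V Z) = 0
  parallel_S : ∀ p ∈ CH k, ∀ V X Y : E k,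
    fderiv ℝ (fun q => S q X Y) p V + tildeConn S p V (S p X Y) -
      S p (tildeConn S p V X) Y - S p X (tildeConn S p V Y) = 0

/-! ### The non-symmetric homogeneous descriptions `CH(n) = G/H`, `G = F_r N` -/

/-- The group `SU(n,1)`. -/
def IsSU {k : ℕ} (x : Mat k) : Prop :=
  (∀ X Y : Idx k → ℂ, herm (x *ᵥ X) (x *ᵥ Y) = herm X Y) ∧ x.det = 1

/-- The generator `A₀ = diag(0, …, 0, 1, -1)` of `𝔞`. -/
def A0 (k : ℕ) : Mat k := Matrix.fromBlocks 0 0 0 !![1, 0; 0, -1]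

/-- The matrix `diag(U, ic, ic)`. -/
def compactMat {k : ℕ} (U : Matrix (Fin k) (Fin k) ℂ) (c : ℝ) : Mat k :=
  Matrix.fromBlocks U 0 0 !![Complex.I * c, 0; 0, Complex.I * c]

/-- The Lie algebra `𝔰(𝔲(n-1) + 𝔲(1))`: the matrices `diag(U, ic, ic)` of trace zero with `U`
skew-hermitian. -/
def compactPart (k : ℕ) : Submodule ℝ (Mat k) where
  carrier := {A | ∃ (U : Matrix (Fin k) (Fin k) ℂ) (c : ℝ),
    Uᴴ = -U ∧ U.trace + 2 * Complex.I * c = 0 ∧ A = compactMat U c}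
  zero_mem' := by
    refine ⟨0, 0, by simp, by simp, ?_⟩
    ext i j
    rcases i with i | i <;> rcases j with j | j <;> simp [compactMat]
    fin_cases i <;> fin_cases j <;> simp
  add_mem' := by
    rintro _ _ ⟨U, c, hU, ht, rfl⟩ ⟨U', c', hU', ht', rfl⟩
    refine ⟨U + U', c + c', ?_, ?_, ?_⟩
    · rw [Matrix.conjTranspose_add, hU, hU']; abel
    · rw [Matrix.trace_add]; push_cast; linear_combination ht + ht'
    · ext i j
      rcases i with i | i <;> rcases j with j | j <;> simp [compactMat]
      fin_cases i <;> fin_cases j <;> simp [mul_add]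
  smul_mem' := by
    rintro a _ ⟨U, c, hU, ht, rfl⟩
    refine ⟨a • U, a * c, ?_, ?_, ?_⟩
    · rw [Matrix.conjTranspose_smul, hU]; simp
    · rw [Matrix.trace_smul, Complex.real_smul]; push_cast; linear_combination (a : ℂ) * ht
    · ext i j
      rcases i with i | i <;> rcases j with j | j <;> simp [compactMat]
      fin_cases i <;> fin_cases j <;> simp <;> ring

/-- The element of `𝔫 = 𝔫₁ + 𝔫₂` with parameters `v ∈ ℂ^{n-1}` and `b ∈ ℝ`. -/
def nilMat {k : ℕ} (v : Fin k → ℂ) (b : ℝ) : Mat k :=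
  Matrix.fromBlocks 0 (Matrix.of fun i j => if j = 1 then v i else 0)
    (Matrix.of fun i j => if i = 0 then -conj (v j) else 0) !![0, Complex.I * b; 0, 0]

/-- The nilpotent part `𝔫` of the Iwasawa decomposition `𝔰𝔲(n,1) = 𝔨 + 𝔞 + 𝔫`. -/
def nilPart (k : ℕ) : Submodule ℝ (Mat k) where
  carrier := {A | ∃ (v : Fin k → ℂ) (b : ℝ), A = nilMat v b}
  zero_mem' := by
    refine ⟨0, 0, ?_⟩
    ext i j
    rcases i with i | i <;> rcases j with j | j <;> simp [nilMat]
    fin_cases i <;> fin_cases j <;> simp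
  add_mem' := by
    rintro _ _ ⟨v, b, rfl⟩ ⟨v', b', rfl⟩
    refine ⟨v + v', b + b', ?_⟩
    ext i j
    rcases i with i | i <;> rcases j with j | j <;> simp [nilMat]
    · split_ifs <;> simp
    · split_ifs <;> simp [add_comm]
    · fin_cases i <;> fin_cases j <;> simp [mul_add]
  smul_mem' := by
    rintro a _ ⟨v, b, rfl⟩
    refine ⟨a • v, a * b, ?_⟩
    ext i j
    rcases i with i | i <;> rcases j with j | j <;> simp [nilMat]
    fin_cases i <;> fin_cases j <;> simp
    ring

/-- A reductive decomposition `𝔤 = 𝔥 + 𝔪` of a non-symmetric homogeneous description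
`CH(n) = G/H`, `G = F_r N`, given by Lie algebras. `f` is the Lie algebra of the connected group
`F_r`; the isotropy group is connected, so that its Lie algebra `𝔥` carries the invariance of `𝔪`. -/
structure ReductiveDescription (k : ℕ) where
  /-- the Lie algebra `𝔣_r` -/
  f : LieSubalgebra ℝ (Mat k)
  f_le : f.toSubmodule ≤ compactPart k ⊔ Submodule.span ℝ {A0 k}
  /-- the projection of `𝔣_r` to `𝔞` is not trivial -/
  f_proj : ¬ f.toSubmodule ≤ compactPart k
  /-- the reductive complement `𝔪` -/
  m : Submodule ℝ (Mat k)
  disjoint : Disjoint (f.toSubmodule ⊓ compactPart k) m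
  sup_eq : (f.toSubmodule ⊓ compactPart k) ⊔ m = f.toSubmodule ⊔ nilPart k
  invariant : ∀ U ∈ f.toSubmodule ⊓ compactPart k, ∀ B ∈ m, ⁅U, B⁆ ∈ m

/-- The infinitesimal generator on `CH(n)`, in the affine chart, of the matrix `A`: the derivative
at `t = 0` of the class of `exp(tA) (lift p)`. -/
def generator {k : ℕ} (A : Mat k) (p : E k) : E k :=
  (fun i => (A *ᵥ lift p) (Sum.inl i) - (A *ᵥ lift p) (Sum.inr 1) * p.1 i,
    (A *ᵥ lift p) (Sum.inr 0) - (A *ᵥ lift p) (Sum.inr 1) * p.2)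

/-- The base point `o`, the class of `(0, …, 0, 1, -1)`. -/
def basePoint (k : ℕ) : E k := (0, -1)

/-- `x` is an element of `SU(n,1)` that maps the base point `o` to `p`. -/
def MovesBaseTo {k : ℕ} (x : Mat k) (p : E k) : Prop :=
  IsSU x ∧ ∃ c : ℂ, x *ᵥ lift (basePoint k) = c • lift p

/-- The identification of `𝔪` with the tangent space at `p = x · o`, i.e. the infinitesimal
generator of `D` at `o` followed by the differential of the isometry `x`. -/
def toTangent {k : ℕ} (x : Mat k) (p : E k) (D : Mat k) : E k := generator (x * D * x⁻¹) p

/-- `∇ - S` is the canonical connection of the description `d` transported by the isometry `x` with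
`x · o = p`: for `B, C` in `𝔪`, the derivative of the infinitesimal generator of `C` in the
direction of `B` at `p` is minus the value at `p` of (the `𝔪`-part of) `[B, C]`; the `𝔥`-part of
`[B, C]` vanishes at `p`. (A homogeneous Kähler structure is determined by its value at `p`.) -/
def IsCanonicalFor {k : ℕ} (S : TensorField12 k) (d : ReductiveDescription k) (x : Mat k)
    (p : E k) : Prop :=
  ∀ B ∈ d.m, ∀ C ∈ d.m,
    fderiv ℝ (generator (x * C * x⁻¹)) p (toTangent x p B) +
      tildeConn S p (toTangent x p B) (toTangent x p C) = -toTangent x p ⁅B, C⁆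

/-- The coefficient `α_D` of `A₀` in `D = U + α_D A₀ + N` with `U` in `𝔰(𝔲(n-1) + 𝔲(1))` and
`N ∈ 𝔫`, see `alpha_eq`. For `D ∈ 𝔪` it is the coefficient of the element `Ã₀ = A₀ + (compact part)`
of `𝔪` in the decomposition of `𝔪` into `ℝ Ã₀`, `ℝ Ñ₂` and the lift of `𝔫₁`. -/
def alpha {k : ℕ} (D : Mat k) : ℝ := (D (Sum.inr 0) (Sum.inr 0)).re

theorem alpha_eq {k : ℕ} {U N : Mat k} (hU : U ∈ compactPart k) (hN : N ∈ nilPart k) (a : ℝ) :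
    alpha (U + a • A0 k + N) = a := by
  obtain ⟨U, c, -, -, rfl⟩ := hU
  obtain ⟨v, b, rfl⟩ := hN
  simp [alpha, compactMat, nilMat, A0]

/-! ### The algebraic classes of Kähler tensors on a tangent space -/

/-- `(0,3)`-tensors on a tangent space. -/
abbrev Tensor3 (k : ℕ) := E k →ₗ[ℝ] E k →ₗ[ℝ] E k →ₗ[ℝ] ℝ

/-- The `(0,3)`-tensor `S_{XYZ} = g(S_X Y, Z)` at `p`. -/
def lower {k : ℕ} (μ : ℝ) (S : TensorField12 k) (p : E k) : Tensor3 k :=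
  LinearMap.mk₂ ℝ (fun X Y => metric μ p (S p X Y))
    (by intros; simp) (by intros; simp) (by intros; simp) (by intros; simp)

/-- The space `𝒦(V)`. -/
def KTensor (k : ℕ) : Set (Tensor3 k) :=
  {T | ∀ X Y Z, T X Y Z = -T X Z Y ∧ T X (J Y) (J Z) = T X Y Z}

/-- `e` is an orthonormal basis for the inner product `b` on the real vector space `V` of
dimension `2n = 2 * (k + 1)`. -/
def IsOrthonormalBasis {k : ℕ} (b : E k →ₗ[ℝ] E k →ₗ[ℝ] ℝ) (e : Fin (2 * (k + 1)) → E k) : Prop :=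
  ∀ i j, b (e i) (e j) = if i = j then 1 else 0

/-- `c₁₂(T)(Z) = ∑ T_{e_i e_i Z}`, computed in the basis `e`. -/
def c12 {k : ℕ} (e : Fin (2 * (k + 1)) → E k) (T : Tensor3 k) (Z : E k) : ℝ :=
  ∑ i, T (e i) (e i) Z

/-- The inner product of `(0,3)`-tensors, computed in the basis `e`. -/
def tensorInner {k : ℕ} (e : Fin (2 * (k + 1)) → E k) (T T' : Tensor3 k) : ℝ :=
  ∑ i, ∑ j, ∑ l, T (e i) (e j) (e l) * T' (e i) (e j) (e l)

/-- The kernel of `c₁₂` in `𝒦(V)`. -/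
def kerC12 {k : ℕ} (b : E k →ₗ[ℝ] E k →ₗ[ℝ] ℝ) : Set (Tensor3 k) :=
  {T | T ∈ KTensor k ∧ ∀ e, IsOrthonormalBasis b e → ∀ Z, c12 e T Z = 0}

/-- The orthogonal complement of the kernel of `c₁₂` in `𝒦(V)`. -/
def kerC12Perp {k : ℕ} (b : E k →ₗ[ℝ] E k →ₗ[ℝ] ℝ) : Set (Tensor3 k) :=
  {T | T ∈ KTensor k ∧ ∀ T' ∈ kerC12 b, ∀ e, IsOrthonormalBasis b e → tensorInner e T T' = 0}

/-- The class `𝒦₂(V)`. -/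
def K2 {k : ℕ} (b : E k →ₗ[ℝ] E k →ₗ[ℝ] ℝ) : Set (Tensor3 k) :=
  {T | T ∈ KTensor k ∧ ∃ θ : E k →ₗ[ℝ] ℝ, ∀ X Y Z, T X Y Z =
    b X Y * θ Z - b X Z * θ Y + b X (J Y) * θ (J Z) - b X (J Z) * θ (J Y) -
      2 * b (J Y) Z * θ (J X)}

/-- The class `𝒦₄(V)`. -/
def K4 {k : ℕ} (b : E k →ₗ[ℝ] E k →ₗ[ℝ] ℝ) : Set (Tensor3 k) :=
  {T | T ∈ KTensor k ∧ ∃ θ : E k →ₗ[ℝ] ℝ, ∀ X Y Z, T X Y Z =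
    b X Y * θ Z - b X Z * θ Y + b X (J Y) * θ (J Z) - b X (J Z) * θ (J Y) +
      2 * b (J Y) Z * θ (J X)}

/-- The class `𝒦₂₊₄(V) = 𝒦₂(V) + 𝒦₄(V)`. -/
def K24 {k : ℕ} (b : E k →ₗ[ℝ] E k →ₗ[ℝ] ℝ) : Set (Tensor3 k) :=
  {T | ∃ T₂ ∈ K2 b, ∃ T₄ ∈ K4 b, T = T₂ + T₄}

end CHn

end

noncomputable section

namespace CHn

/-! ### The Lie algebra `𝔰𝔲(n,1)` -/

/-! For `A` in `𝔰𝔲(n,1)` let `A*` be its infinitesimal generator. By `exists_mem_su` and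
`eq_zero_of_generator_rho`, the pair of `A*` and `∇A*` at `p` determines `A` and takes every value
in `V × 𝔲(V)`; `rho p A` is the second entry.

Existence of a description. Parallelism makes `S` a solution of a first-order system, so a structure
with one zero in the convex domain `CH k` vanishes throughout (`eq_zero_of_eq_zero`); hence `S p ≠
0`. The `A` for which `∇A* - S_{A*}` acts trivially on `S p` form `symmetryAlgebra S p`. It is
closed under brackets, because the bracket formulas involve only commutators and the curvature of `∇
- S`, which kills `S` by the Ricci identity (`kills_curvature`, `lie_mem_symmetryAlgebra`). It
contains the transvections, those with `∇A* = S_{A*}`, and is therefore transitive.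

A transitive subalgebra `𝔤` is classified by its mean curvature element `ξ`, the hermitian matrix
that represents the functional `A ↦ tr(ad A | 𝔤)` (`exists_mean_curvature`). If `ξ = 0`, every
hermitian element of `𝔰𝔲(n,1)` normalizes `𝔤` and then lies in it. If `ξ ≠ 0`, then `ξ` normalizes
`𝔤`; as the real rank is one, `ξ` can be rotated to a multiple of `A₀`, so `𝔤` is graded by the
eigenvalues of `ad A₀`, and orthogonality of `ξ` to brackets leaves only one sign of roots. Up to
conjugation `𝔫 ⊂ 𝔤 ⊂ 𝔰(𝔲(n-1) + 𝔲(1)) + 𝔞 + 𝔫` (`IsTransitiveSubalgebra.classification`). The first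
alternative would make all `S_X` and the curvature act trivially on `S p`, which forces `S p = 0`
(`eq_zero_of_kills`). In the second, the transvections are the complement `𝔪`
(`exists_description`).

The trace formula. For any description that realizes `S`, put `w = D*`. Torsion-freeness of `∇`
gives `S_X w = S_w X - [D, X]`, the bracket being read on `𝔤/𝔥 ≅ V`. By skewness `c₁₂(S)(w) = -tr(X
↦ S_X w) = tr(ad D | 𝔤/𝔥) - tr S_w`, and `tr S_w = 0`. The compact part of `D` contributes no trace,
so what remains is `α_D` times the sum of the roots with multiplicity, `2(n-1) + 2 = 2n`
(`trace_lie_lift_m`, `c12_eq`).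

The complement of the kernel. The tensors `vectorTensor b θ` are orthogonal to `ker c₁₂`, and `c₁₂`
sends them to `2n θ`; hence they exhaust the complement, and each is the sum of a `𝒦₂`- and a
`𝒦₄`-tensor with form `θ/2`. Since some `D` in `𝔪` has `α_D ≠ 0`, the component of `S p` in the
complement is not zero. -/

/-- The Gram matrix of the hermitian product `herm`. -/
def hermMatrix (k : ℕ) : Mat k := Matrix.fromBlocks 1 0 0 !![0, 1; 1, 0]

theorem hermMatrix_mul_self (k : ℕ) : hermMatrix k * hermMatrix k = 1 := by
  rw [hermMatrix, Matrix.fromBlocks_multiply, ← Matrix.fromBlocks_one]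
  congr 1
  · simp
  · simp
  · simp
  · ext i j
    fin_cases i <;> fin_cases j <;> simp

theorem hermMatrix_conjTranspose (k : ℕ) : (hermMatrix k)ᴴ = hermMatrix k := by
  rw [hermMatrix, Matrix.fromBlocks_conjTranspose]
  congr 1
  · simp
  · simp
  · simp
  · ext i j
    fin_cases i <;> fin_cases j <;> simp

theorem hermMatrix_mulVec {k : ℕ} (X : Idx k → ℂ) :
    hermMatrix k *ᵥ X = Sum.elim (X ∘ Sum.inl) ![X (Sum.inr 1), X (Sum.inr 0)] := by
  funext i
  rcases i with i | i
  · simp [hermMatrix, Matrix.mulVec, dotProduct, Matrix.one_apply]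
  · fin_cases i <;> simp [hermMatrix, Matrix.mulVec, dotProduct]

theorem herm_eq_dotProduct {k : ℕ} (X Y : Idx k → ℂ) :
    herm X Y = star Y ⬝ᵥ (hermMatrix k *ᵥ X) := by
  simp only [hermMatrix_mulVec, dotProduct, herm, Fintype.sum_sum_type, Fin.sum_univ_two]
  simp [mul_comm, add_assoc]
  ring

theorem herm_mulVec_left {k : ℕ} (A : Mat k) (X Y : Idx k → ℂ) :
    herm (A *ᵥ X) Y = star Y ⬝ᵥ ((hermMatrix k * A) *ᵥ X) := by
  rw [herm_eq_dotProduct, Matrix.mulVec_mulVec]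

theorem herm_mulVec_right {k : ℕ} (A : Mat k) (X Y : Idx k → ℂ) :
    herm X (A *ᵥ Y) = star Y ⬝ᵥ ((Aᴴ * hermMatrix k) *ᵥ X) := by
  rw [herm_eq_dotProduct, Matrix.star_mulVec, ← Matrix.dotProduct_mulVec, Matrix.mulVec_mulVec]

theorem matrix_ext_dotProduct {k : ℕ} {A B : Mat k}
    (h : ∀ X Y : Idx k → ℂ, star Y ⬝ᵥ (A *ᵥ X) = star Y ⬝ᵥ (B *ᵥ X)) : A = B := by
  ext i j
  simpa [Pi.star_single] using h (Pi.single j 1) (Pi.single i 1)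

/-- The Lie algebra `𝔰𝔲(n,1)` of the hermitian product `herm`. -/
def su (k : ℕ) : Submodule ℝ (Mat k) where
  carrier := {A | Aᴴ * hermMatrix k + hermMatrix k * A = 0 ∧ A.trace = 0}
  zero_mem' := by simp
  add_mem' := by
    rintro A B ⟨hA, hA'⟩ ⟨hB, hB'⟩
    refine ⟨?_, by rw [Matrix.trace_add, hA', hB', add_zero]⟩
    rw [Matrix.conjTranspose_add, add_mul, mul_add, add_add_add_comm, hA, hB, add_zero]
  smul_mem' := by
    rintro c A ⟨hA, hA'⟩
    refine ⟨?_, by rw [Matrix.trace_smul, hA', smul_zero]⟩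
    rw [Matrix.conjTranspose_smul, smul_mul_assoc, mul_smul_comm, star_trivial, ← smul_add, hA,
      smul_zero]

theorem herm_of_mem_su {k : ℕ} {A : Mat k} (hA : A ∈ su k) (X Y : Idx k → ℂ) :
    herm (A *ᵥ X) Y = -herm X (A *ᵥ Y) := by
  rw [herm_mulVec_left, herm_mulVec_right, eq_neg_iff_add_eq_zero, ← dotProduct_add,
    ← Matrix.add_mulVec, add_comm, hA.1]
  simp

theorem mem_su_of_herm {k : ℕ} {A : Mat k}
    (h : ∀ X Y : Idx k → ℂ, herm (A *ᵥ X) Y = -herm X (A *ᵥ Y)) (ht : A.trace = 0) :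
    A ∈ su k := by
  refine ⟨?_, ht⟩
  apply matrix_ext_dotProduct
  intro X Y
  rw [Matrix.add_mulVec, dotProduct_add, ← herm_mulVec_left, ← herm_mulVec_right, h]
  simp

theorem hermMatrix_mul_of_mem_su {k : ℕ} {A : Mat k} (hA : A ∈ su k) :
    hermMatrix k * A = -(Aᴴ * hermMatrix k) := by
  rw [eq_neg_iff_add_eq_zero, add_comm]; exact hA.1

theorem lie_mem_su {k : ℕ} {A B : Mat k} (hA : A ∈ su k) (hB : B ∈ su k) : ⁅A, B⁆ ∈ su k := by
  apply mem_su_of_herm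
  · intro X Y
    have h : ∀ X Y : Idx k → ℂ, herm (X - Y) = herm X - herm Y := by
      intro X Y; funext Z
      have := herm_add_left (X - Y) Y Z
      rw [sub_add_cancel] at this
      rw [Pi.sub_apply, this, add_sub_cancel_right]
    have h' : ∀ X Y Z : Idx k → ℂ, herm X (Y - Z) = herm X Y - herm X Z := by
      intro X Y Z
      have := herm_add_right X (Y - Z) Z
      rw [sub_add_cancel] at this
      rw [this, add_sub_cancel_right]
    rw [Ring.lie_def, Matrix.sub_mulVec, Matrix.sub_mulVec, h, h', Pi.sub_apply,
      ← Matrix.mulVec_mulVec, ← Matrix.mulVec_mulVec, ← Matrix.mulVec_mulVec,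
      ← Matrix.mulVec_mulVec, herm_of_mem_su hA, herm_of_mem_su hB, herm_of_mem_su hB,
      herm_of_mem_su hA]
    ring
  · rw [Ring.lie_def, Matrix.trace_sub, Matrix.trace_mul_comm, sub_self]

theorem conjTranspose_mem_su {k : ℕ} {A : Mat k} (hA : A ∈ su k) : Aᴴ ∈ su k := by
  refine ⟨?_, by rw [Matrix.trace_conjTranspose, hA.2, star_zero]⟩
  have h := hermMatrix_mul_of_mem_su hA
  have h1 : hermMatrix k * (hermMatrix k * A) * hermMatrix k =
      -(hermMatrix k * Aᴴ) := by
    rw [h, mul_neg, neg_mul, mul_assoc, mul_assoc Aᴴ, hermMatrix_mul_self, mul_one]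
  rw [← mul_assoc, hermMatrix_mul_self, one_mul] at h1
  rw [Matrix.conjTranspose_conjTranspose, h1, neg_add_cancel]

/-- Conjugation by the Gram matrix is the Cartan involution of `𝔰𝔲(n,1)`; it is used later to
exchange `𝔫` with the opposite nilpotent algebra. -/
theorem conj_hermMatrix_of_mem_su {k : ℕ} {A : Mat k} (hA : A ∈ su k) :
    hermMatrix k * A * hermMatrix k = -Aᴴ := by
  rw [hermMatrix_mul_of_mem_su hA, neg_mul, mul_assoc, hermMatrix_mul_self, mul_one]

/-! ### Matrices that preserve `herm`, and conjugation by them. -/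

/-- `x` preserves the hermitian product. -/
def IsUnitaryHerm {k : ℕ} (x : Mat k) : Prop := xᴴ * hermMatrix k * x = hermMatrix k

theorem isUnitaryHerm_iff {k : ℕ} {x : Mat k} :
    IsUnitaryHerm x ↔ ∀ X Y : Idx k → ℂ, herm (x *ᵥ X) (x *ᵥ Y) = herm X Y := by
  have key : ∀ X Y : Idx k → ℂ, herm (x *ᵥ X) (x *ᵥ Y) =
      star Y ⬝ᵥ ((xᴴ * hermMatrix k * x) *ᵥ X) := by
    intro X Y
    rw [herm_mulVec_right, Matrix.mulVec_mulVec]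
  constructor
  · intro h X Y
    rw [key, h, herm_eq_dotProduct]
  · intro h
    apply matrix_ext_dotProduct
    intro X Y
    rw [← key, h, herm_eq_dotProduct]

theorem IsUnitaryHerm.mul_inv {k : ℕ} {x : Mat k} (h : IsUnitaryHerm x) : x * x⁻¹ = 1 := by
  have : (hermMatrix k * xᴴ * hermMatrix k) * x = 1 := by
    rw [mul_assoc, mul_assoc, ← mul_assoc xᴴ, h, hermMatrix_mul_self]
  rw [Matrix.inv_eq_left_inv this]
  exact mul_eq_one_comm.1 this

theorem IsUnitaryHerm.inv_mul {k : ℕ} {x : Mat k} (h : IsUnitaryHerm x) : x⁻¹ * x = 1 :=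
  mul_eq_one_comm.1 h.mul_inv

theorem IsUnitaryHerm.herm_apply {k : ℕ} {x : Mat k} (h : IsUnitaryHerm x)
    (X Y : Idx k → ℂ) : herm (x *ᵥ X) (x *ᵥ Y) = herm X Y := isUnitaryHerm_iff.1 h X Y

theorem IsUnitaryHerm.mul {k : ℕ} {x y : Mat k} (hx : IsUnitaryHerm x) (hy : IsUnitaryHerm y) :
    IsUnitaryHerm (x * y) := by
  rw [isUnitaryHerm_iff]
  intro X Y
  rw [← Matrix.mulVec_mulVec, ← Matrix.mulVec_mulVec, hx.herm_apply, hy.herm_apply]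

theorem isUnitaryHerm_smul {k : ℕ} {x : Mat k} (hx : IsUnitaryHerm x) {c : ℂ}
    (hc : conj c * c = 1) : IsUnitaryHerm (c • x) := by
  rw [IsUnitaryHerm, Matrix.conjTranspose_smul, smul_mul_assoc, smul_mul_assoc, mul_smul_comm,
    smul_smul, hx]
  rw [Complex.star_def, hc, one_smul]

theorem IsUnitaryHerm.conj_mem_su {k : ℕ} {x : Mat k} (hx : IsUnitaryHerm x) {A : Mat k}
    (hA : A ∈ su k) : x * A * x⁻¹ ∈ su k := by
  apply mem_su_of_herm
  · intro X Y
    obtain ⟨X', rfl⟩ : ∃ X', x *ᵥ X' = X := ⟨x⁻¹ *ᵥ X, by simp [hx.mul_inv]⟩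
    obtain ⟨Y', rfl⟩ : ∃ X', x *ᵥ X' = Y := ⟨x⁻¹ *ᵥ Y, by simp [hx.mul_inv]⟩
    have : ∀ Z, (x * A * x⁻¹) *ᵥ (x *ᵥ Z) = x *ᵥ (A *ᵥ Z) := by
      intro Z; simp [Matrix.mulVec_mulVec, mul_assoc, hx.inv_mul]
    rw [this, this, hx.herm_apply, hx.herm_apply, herm_of_mem_su hA]
  · rw [Matrix.trace_mul_comm, ← mul_assoc, hx.inv_mul, one_mul, hA.2]

theorem IsUnitaryHerm.conj_mem_su_iff {k : ℕ} {x : Mat k} (hx : IsUnitaryHerm x) {A : Mat k} :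
    x * A * x⁻¹ ∈ su k ↔ A ∈ su k := by
  refine ⟨fun h => ?_, hx.conj_mem_su⟩
  have hx' : IsUnitaryHerm x⁻¹ := by
    rw [isUnitaryHerm_iff]
    intro X Y
    rw [← hx.herm_apply]
    simp [hx.mul_inv]
  have hi : x⁻¹⁻¹ = x := Matrix.inv_eq_left_inv hx.mul_inv
  have := hx'.conj_mem_su h
  rwa [hi, ← mul_assoc, ← mul_assoc, hx.inv_mul, one_mul, mul_assoc,
    hx.inv_mul, mul_one] at this

/-! ### Tangent vectors as classes modulo the line -/

theorem herm_neg_left {k : ℕ} (X Y : Idx k → ℂ) : herm (-X) Y = -herm X Y := by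
  rw [← neg_one_smul ℂ X, herm_smul_left]; ring

theorem herm_neg_right {k : ℕ} (X Y : Idx k → ℂ) : herm X (-Y) = -herm X Y := by
  rw [← neg_one_smul ℂ Y, herm_smul_right]; simp

theorem herm_sub_left {k : ℕ} (X Y Z : Idx k → ℂ) : herm (X - Y) Z = herm X Z - herm Y Z := by
  rw [sub_eq_add_neg, herm_add_left, herm_neg_left, ← sub_eq_add_neg]

theorem herm_sub_right {k : ℕ} (X Y Z : Idx k → ℂ) : herm X (Y - Z) = herm X Y - herm X Z := by
  rw [sub_eq_add_neg, herm_add_right, herm_neg_right, ← sub_eq_add_neg]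

theorem herm_lift_ne_zero {k : ℕ} {p : E k} (hp : p ∈ CH k) : herm (lift p) (lift p) ≠ 0 := by
  intro h
  have hp' : (herm (lift p) (lift p)).re < 0 := hp
  rw [h] at hp'
  simp at hp'

theorem conj_herm_self {k : ℕ} (X : Idx k → ℂ) : conj (herm X X) = herm X X := herm_conj X X

/-- The tangent vector at the class of `lift p` given by a vector of `ℂ^{n+1}`. -/
def dehom {k : ℕ} (p : E k) : (Idx k → ℂ) →ₗ[ℂ] E k where
  toFun u := (fun i => u (Sum.inl i) - u (Sum.inr 1) * p.1 i, u (Sum.inr 0) - u (Sum.inr 1) * p.2)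
  map_add' u w := by
    refine Prod.ext (funext fun i => ?_) ?_ <;> simp <;> ring
  map_smul' c u := by
    refine Prod.ext (funext fun i => ?_) ?_ <;> simp <;> ring

theorem generator_eq_dehom {k : ℕ} (A : Mat k) (p : E k) :
    generator A p = dehom p (A *ᵥ lift p) := rfl

theorem dehom_lift {k : ℕ} (p : E k) : dehom p (lift p) = 0 := by
  refine Prod.ext (funext fun i => ?_) ?_ <;> simp [dehom, lift]

theorem dehom_tlift {k : ℕ} (p X : E k) : dehom p (tlift X) = X := by
  refine Prod.ext (funext fun i => ?_) ?_ <;> simp [dehom, tlift]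

theorem tlift_dehom {k : ℕ} (p : E k) (u : Idx k → ℂ) :
    tlift (dehom p u) = u - u (Sum.inr 1) • lift p := by
  funext i
  rcases i with i | i
  · simp [dehom, tlift, lift]
  · fin_cases i <;> simp [dehom, tlift, lift]

theorem dehom_hor {k : ℕ} (p X : E k) : dehom p (hor p X) = X := by
  rw [hor, map_sub, map_smul, dehom_lift, dehom_tlift, smul_zero, sub_zero]

theorem hor_dehom {k : ℕ} {p : E k} (h0 : herm (lift p) (lift p) ≠ 0) (u : Idx k → ℂ) :
    hor p (dehom p u) = u - (herm u (lift p) / herm (lift p) (lift p)) • lift p := by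
  rw [hor, tlift_dehom, herm_sub_left, herm_smul_left, sub_div, mul_div_assoc, div_self h0, mul_one,
    sub_smul]
  abel

theorem herm_hor_lift {k : ℕ} {p : E k} (h0 : herm (lift p) (lift p) ≠ 0) (X : E k) :
    herm (hor p X) (lift p) = 0 := by
  rw [hor, herm_sub_left, herm_smul_left, div_mul_cancel₀ _ h0, sub_self]

theorem herm_lift_hor {k : ℕ} {p : E k} (h0 : herm (lift p) (lift p) ≠ 0) (X : E k) :
    herm (lift p) (hor p X) = 0 := by
  rw [← herm_conj, herm_hor_lift h0, map_zero]

/-- `hor p` as a complex linear map. -/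
def horL {k : ℕ} (p : E k) : E k →ₗ[ℂ] (Idx k → ℂ) where
  toFun := hor p
  map_add' := hor_add p
  map_smul' := hor_csmul p

theorem horL_apply {k : ℕ} (p X : E k) : horL p X = hor p X := rfl

/-- The hermitian form on the tangent space, divided by the square of the norm of `lift p`. -/
def eta {k : ℕ} (p X Y : E k) : ℂ := herm (hor p X) (hor p Y) / herm (lift p) (lift p)

/-- The covariant derivative at `p` of the infinitesimal generator of `A`. -/
def rho {k : ℕ} (p : E k) (A : Mat k) (V : E k) : E k :=
  dehom p (A *ᵥ hor p V) - (herm (A *ᵥ lift p) (lift p) / herm (lift p) (lift p)) • V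

/-- Both `lift` and `dehom` are affine in the base point, so a generator is a quadratic polynomial
along lines; its linear coefficient is the derivative needed in `fderiv_generator`. -/
theorem generator_line {k : ℕ} (A : Mat k) (p V : E k) (t : ℝ) :
    generator A (p + t • V) = generator A p +
      t • (dehom p (A *ᵥ tlift V) - (A *ᵥ lift p) (Sum.inr 1) • V) +
      (t ^ 2) • (-((A *ᵥ tlift V) (Sum.inr 1) • V)) := by
  have h : ∀ u, dehom (p + t • V) u = dehom p u - t • (u (Sum.inr 1) • V) := by
    intro u
    refine Prod.ext (funext fun i => ?_) ?_ <;> simp [dehom] <;> ring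
  rw [generator_eq_dehom, generator_eq_dehom, h, lift_add_smul, Matrix.mulVec_add,
    Matrix.mulVec_smul, map_add, map_smul, Pi.add_apply, Pi.smul_apply]
  refine Prod.ext (funext fun i => ?_) ?_ <;> simp <;> ring

theorem contDiff_lift (k : ℕ) : ContDiff ℝ ∞ (lift : E k → Idx k → ℂ) := by
  rw [contDiff_pi]
  intro i
  rcases i with i | i
  · simp only [lift, Sum.elim_inl]; fun_prop
  · fin_cases i
    · simp only [lift]; exact contDiff_snd
    · simp only [lift]; exact contDiff_const

theorem contDiff_herm_lift {k : ℕ} (u : Idx k → ℂ) :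
    ContDiff ℝ ∞ (fun q : E k => herm u (lift q)) := by
  have h : ∀ i, ContDiff ℝ ∞ (fun q : E k => conj (lift q i)) := fun i =>
    Complex.conjCLE.contDiff.comp ((contDiff_pi.1 (contDiff_lift k)) i)
  unfold herm
  refine ((ContDiff.sum fun i _ => ?_).add ?_).add ?_ <;> exact contDiff_const.mul (h _)

theorem contDiff_herm_lift_lift (k : ℕ) :
    ContDiff ℝ ∞ (fun q : E k => herm (lift q) (lift q)) := by
  have h' := contDiff_pi.1 (contDiff_lift k)
  have h : ∀ i, ContDiff ℝ ∞ (fun q : E k => conj (lift q i)) := fun i =>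
    Complex.conjCLE.contDiff.comp (h' i)
  unfold herm
  refine ((ContDiff.sum fun i _ => ?_).add ?_).add ?_ <;> exact (h' _).mul (h _)

theorem contDiff_generator {k : ℕ} (A : Mat k) : ContDiff ℝ ∞ (generator A) := by
  have h' := contDiff_pi.1 (contDiff_lift k)
  have h : ∀ i, ContDiff ℝ ∞ (fun q : E k => (A *ᵥ lift q) i) := by
    intro i
    simp only [Matrix.mulVec, dotProduct]
    exact ContDiff.sum fun j _ => contDiff_const.mul (h' j)
  unfold generator
  refine ContDiff.prodMk (contDiff_pi.2 fun i => ?_) ?_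
  · exact (h _).sub ((h _).mul ((contDiff_pi.1 contDiff_fst) i))
  · exact (h _).sub ((h _).mul contDiff_snd)

theorem fderiv_generator {k : ℕ} (A : Mat k) (p V : E k) :
    fderiv ℝ (generator A) p V =
      dehom p (A *ᵥ tlift V) - (A *ᵥ lift p) (Sum.inr 1) • V := by
  have hd : DifferentiableAt ℝ (generator A) p :=
    (contDiff_generator A).contDiffAt.differentiableAt (by simp)
  rw [← hd.lineDeriv_eq_fderiv, lineDeriv]
  simp only [generator_line]
  have h1 := ((hasDerivAt_id (0 : ℝ)).smul_const
    (dehom p (A *ᵥ tlift V) - (A *ᵥ lift p) (Sum.inr 1) • V)).const_add (generator A p)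
  have h2 := ((hasDerivAt_id (0 : ℝ)).pow 2).smul_const (-((A *ᵥ tlift V) (Sum.inr 1) • V))
  have := (h1.add h2).deriv
  simp only [id, one_smul] at this
  refine Eq.trans ?_ (this.trans ?_)
  · rfl
  · simp

/-- The terms in the last coordinate of `A *ᵥ lift p`, an artefact of the chart, cancel against the
Christoffel symbols. This identifies `rho p A` with `∇A*`. -/
theorem fderiv_generator_add_christoffel {k : ℕ} {p : E k} (h0 : herm (lift p) (lift p) ≠ 0)
    (A : Mat k) (V : E k) :
    fderiv ℝ (generator A) p V + christoffel p V (generator A p) = rho p A V := by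
  rw [fderiv_generator, christoffel, rho, generator_eq_dehom, tlift_dehom, herm_sub_left,
    herm_smul_left, sub_div, mul_div_assoc, div_self h0, mul_one, hor, Matrix.mulVec_sub, map_sub,
    Matrix.mulVec_smul, map_smul, sub_smul]
  abel

/-- Torsion-freeness of `∇`; the sign reflects that `A ↦ A*` is an anti-homomorphism into vector
fields. -/
theorem generator_lie {k : ℕ} {p : E k} (h0 : herm (lift p) (lift p) ≠ 0) (A B : Mat k) :
    generator ⁅A, B⁆ p = rho p A (generator B p) - rho p B (generator A p) := by
  simp only [rho, generator_eq_dehom, hor_dehom h0, Ring.lie_def, Matrix.sub_mulVec,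
    Matrix.mulVec_sub, Matrix.mulVec_smul, map_sub, map_smul, Matrix.mulVec_mulVec]
  abel

/-- Kostant's formula for Killing fields: the subtracted bracket is the curvature `R(A*, B*) V`, in
the form given by `curvature_eq`. -/
theorem rho_lie {k : ℕ} {p : E k} (h0 : herm (lift p) (lift p) ≠ 0) {A B : Mat k}
    (hA : A ∈ su k) (hB : B ∈ su k) (V : E k) :
    rho p ⁅A, B⁆ V = rho p A (rho p B V) - rho p B (rho p A V) -
      (eta p V (generator B p) • generator A p - eta p V (generator A p) • generator B p +
        (eta p (generator A p) (generator B p) - eta p (generator B p) (generator A p)) • V) := by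
  have horself : ∀ A : Mat k, A *ᵥ lift p = hor p (generator A p) +
      (herm (A *ᵥ lift p) (lift p) / herm (lift p) (lift p)) • lift p := by
    intro A
    rw [generator_eq_dehom, hor_dehom h0]; abel
  have e1 : ∀ A ∈ su k, ∀ V, herm (A *ᵥ hor p V) (lift p) / herm (lift p) (lift p) =
      -eta p V (generator A p) := by
    intro A hA V
    rw [herm_of_mem_su hA, horself A, herm_add_right, herm_smul_right, herm_hor_lift h0, mul_zero,
      add_zero, eta, neg_div]
  have e2 : ∀ A ∈ su k, conj (herm (A *ᵥ lift p) (lift p) / herm (lift p) (lift p)) =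
      -(herm (A *ᵥ lift p) (lift p) / herm (lift p) (lift p)) := by
    intro A hA
    rw [map_div₀, conj_herm_self, herm_conj, herm_of_mem_su hA, neg_div, neg_neg]
  have e3 : ∀ A ∈ su k, ∀ B ∈ su k, herm (A *ᵥ (B *ᵥ lift p)) (lift p) / herm (lift p) (lift p) =
      -eta p (generator B p) (generator A p) +
      (herm (A *ᵥ lift p) (lift p) / herm (lift p) (lift p)) *
      (herm (B *ᵥ lift p) (lift p) / herm (lift p) (lift p)) := by
    intro A hA B hB
    conv_lhs => rw [horself B]
    rw [Matrix.mulVec_add, herm_add_left, Matrix.mulVec_smul, herm_smul_left, add_div, e1 A hA]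
    ring
  have e4 : ∀ A B : Mat k, ∀ V, rho p A (rho p B V) = dehom p (A *ᵥ (B *ᵥ hor p V)) -
      (herm (B *ᵥ hor p V) (lift p) / herm (lift p) (lift p)) • generator A p -
      (herm (B *ᵥ lift p) (lift p) / herm (lift p) (lift p)) • dehom p (A *ᵥ hor p V) -
      (herm (A *ᵥ lift p) (lift p) / herm (lift p) (lift p)) • dehom p (B *ᵥ hor p V) +
      ((herm (A *ᵥ lift p) (lift p) / herm (lift p) (lift p)) *
      (herm (B *ᵥ lift p) (lift p) / herm (lift p) (lift p))) • V := by
    intro A B V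
    have : hor p (rho p B V) = B *ᵥ hor p V - (herm (B *ᵥ hor p V) (lift p) /
        herm (lift p) (lift p)) • lift p - (herm (B *ᵥ lift p) (lift p) /
        herm (lift p) (lift p)) • hor p V := by
      rw [rho, ← horL_apply, map_sub, map_smul, horL_apply, horL_apply, hor_dehom h0]
    rw [rho, this, rho, generator_eq_dehom]
    simp only [Matrix.mulVec_sub, Matrix.mulVec_smul, map_sub, map_smul, smul_sub, smul_smul]
    abel
  rw [e4, e4, e1 A hA, e1 B hB, rho, Ring.lie_def, Matrix.sub_mulVec, Matrix.sub_mulVec,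
    herm_sub_left, sub_div, ← Matrix.mulVec_mulVec, ← Matrix.mulVec_mulVec,
    ← Matrix.mulVec_mulVec, ← Matrix.mulVec_mulVec, e3 A hA B hB, e3 B hB A hA, map_sub]
  module

/-! ### The curvature tensor -/

/-- This quotient is the only non-constant ingredient of `christoffel`; the term `eta` in its
derivative is the source of the curvature. -/
theorem hasDerivAt_herm_div {k : ℕ} {p : E k} (h0 : herm (lift p) (lift p) ≠ 0) (X Y : E k) :
    HasDerivAt (fun t : ℝ => herm (tlift Y) (lift (p + t • X)) /
        herm (lift (p + t • X)) (lift (p + t • X)))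
      (eta p Y X - herm (tlift Y) (lift p) / herm (lift p) (lift p) *
        (herm (tlift X) (lift p) / herm (lift p) (lift p))) 0 := by
  have ht : HasDerivAt (fun t : ℝ => (t : ℂ)) 1 0 := Complex.ofRealCLM.hasDerivAt
  have e1 : HasDerivAt (fun t : ℝ => herm (lift (p + t • X)) (lift (p + t • X)))
      (herm (tlift X) (lift p) + herm (lift p) (tlift X)) 0 := by
    simp only [lift_add_smul, herm_add_left, herm_add_right, herm_smul_left, herm_smul_right,
      Complex.conj_ofReal]
    have := (((ht.mul_const (herm (lift p) (tlift X))).const_add (herm (lift p) (lift p))).add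
      (ht.mul ((ht.mul_const (herm (tlift X) (tlift X))).const_add (herm (tlift X) (lift p)))))
    refine (this.congr_deriv ?_).congr_of_eventuallyEq (Filter.Eventually.of_forall fun t => ?_)
    · simp; ring
    · simp; ring
  have e2 : HasDerivAt (fun t : ℝ => herm (tlift Y) (lift (p + t • X)))
      (herm (tlift Y) (tlift X)) 0 := by
    simp only [lift_add_smul, herm_add_right, herm_smul_right, Complex.conj_ofReal]
    simpa using (ht.mul_const (herm (tlift Y) (tlift X))).const_add (herm (tlift Y) (lift p))
  have z : p + (0 : ℝ) • X = p := by simp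
  have h0' : herm (lift (p + (0 : ℝ) • X)) (lift (p + (0 : ℝ) • X)) ≠ 0 := by rwa [z]
  refine (e2.div e1 h0').congr_deriv ?_
  rw [z, eta]
  have hh : herm (hor p Y) (hor p X) = herm (tlift Y) (tlift X) -
      herm (tlift Y) (lift p) * herm (lift p) (tlift X) / herm (lift p) (lift p) := by
    simp only [hor, sub_eq_add_neg, ← neg_smul, herm_add_left, herm_add_right, herm_smul_left,
      herm_smul_right, map_neg, map_div₀, herm_conj]
    field_simp
    ring
  rw [hh]
  field_simp
  ring

theorem contDiffOn_herm_div {k : ℕ} (Y : E k) :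
    ContDiffOn ℝ ∞ (fun q : E k => herm (tlift Y) (lift q) / herm (lift q) (lift q)) (CH k) := by
  simp only [div_eq_mul_inv]
  exact (contDiff_herm_lift _).contDiffOn.mul
    ((contDiff_herm_lift_lift k).contDiffOn.inv fun q hq => herm_lift_ne_zero hq)

theorem contDiffOn_christoffel {k : ℕ} (Y Z : E k) :
    ContDiffOn ℝ ∞ (fun q : E k => christoffel q Y Z) (CH k) := by
  unfold christoffel
  exact ((contDiffOn_herm_div Y).smul contDiffOn_const).neg.sub
    ((contDiffOn_herm_div Z).smul contDiffOn_const)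

theorem fderiv_christoffel {k : ℕ} {p : E k} (hp : p ∈ CH k) (X Y Z : E k) :
    fderiv ℝ (fun q => christoffel q Y Z) p X =
      -((eta p Y X - herm (tlift Y) (lift p) / herm (lift p) (lift p) *
        (herm (tlift X) (lift p) / herm (lift p) (lift p))) • Z) -
      (eta p Z X - herm (tlift Z) (lift p) / herm (lift p) (lift p) *
        (herm (tlift X) (lift p) / herm (lift p) (lift p))) • Y := by
  have hd : DifferentiableAt ℝ (fun q => christoffel q Y Z) p :=
    ((contDiffOn_christoffel Y Z).contDiffAt ((isOpen_CH k).mem_nhds hp)).differentiableAt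
      (by simp)
  have h0 := herm_lift_ne_zero hp
  rw [← hd.lineDeriv_eq_fderiv, lineDeriv]
  exact (((hasDerivAt_herm_div h0 X Y).smul_const Z).neg.sub
    ((hasDerivAt_herm_div h0 X Z).smul_const Y)).deriv

/-- The terms quadratic in the coefficients of `christoffel`, from the derivatives and from the
compositions, cancel; only `eta` survives. -/
theorem curvature_eq {k : ℕ} {p : E k} (hp : p ∈ CH k) (X Y Z : E k) :
    curvature p X Y Z = eta p Z Y • X - eta p Z X • Y + (eta p X Y - eta p Y X) • Z := by
  rw [curvature, fderiv_christoffel hp, fderiv_christoffel hp]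
  have h1 : ∀ X Y : E k, tlift (X - Y) = tlift X - tlift Y := by
    intro X Y
    rw [eq_sub_iff_add_eq, ← tlift_add, sub_add_cancel]
  have h2 : ∀ X : E k, tlift (-X) = -tlift X := by
    intro X
    rw [← neg_one_smul ℂ X, tlift_csmul, neg_one_smul]
  simp only [christoffel, h1, h2, tlift_csmul, herm_sub_left, herm_neg_left, herm_smul_left]
  simp only [sub_div, neg_div, mul_div_assoc]
  module

/-! ### First consequences of the parallelism of `S` -/

/-- The endomorphism `A` acts trivially, as a derivation, on the `(1,2)`-tensor `s`. -/
def Kills {k : ℕ} (s : E k →L[ℝ] E k →L[ℝ] E k) (A : E k → E k) : Prop :=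
  ∀ X Y, A (s X Y) = s (A X) Y + s X (A Y)

theorem tlift_smul {k : ℕ} (c : ℝ) (X : E k) : tlift (c • X) = (c : ℂ) • tlift X := by
  rw [← tlift_csmul]; congr 1

theorem christoffel_add_left {k : ℕ} (p X X' Y : E k) :
    christoffel p (X + X') Y = christoffel p X Y + christoffel p X' Y := by
  simp only [christoffel, tlift_add, herm_add_left, add_div]; module

theorem christoffel_smul_left {k : ℕ} (p : E k) (c : ℝ) (X Y : E k) :
    christoffel p (c • X) Y = c • christoffel p X Y := by
  have : c • X = (c : ℂ) • X := rfl
  simp only [christoffel, tlift_smul, herm_smul_left, mul_div_assoc]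
  rw [this, ← Complex.coe_smul c (_ - _)]
  module

/-- The Christoffel symbols as a continuous bilinear map. -/
def christoffelL {k : ℕ} (p : E k) : E k →L[ℝ] E k →L[ℝ] E k :=
  (LinearMap.mk₂ ℝ (christoffel p) (christoffel_add_left p) (christoffel_smul_left p)
    (fun X Y Z => by
      rw [christoffel_symm, christoffel_add_left, christoffel_symm, christoffel_symm p Z])
    (fun c X Y => by
      rw [christoffel_symm, christoffel_smul_left,
        christoffel_symm])).toContinuousBilinearMap

theorem contDiffOn_christoffelL (k : ℕ) : ContDiffOn ℝ ∞ (christoffelL (k := k)) (CH k) := by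
  rw [contDiffOn_clm_apply]
  intro X
  rw [contDiffOn_clm_apply]
  intro Y
  exact contDiffOn_christoffel X Y

/-- The connection coefficients of `∇ - S` as a continuous bilinear map. -/
def tildeL {k : ℕ} (S : TensorField12 k) (p : E k) : E k →L[ℝ] E k →L[ℝ] E k :=
  christoffelL p - S p

theorem christoffelL_apply {k : ℕ} (p X Y : E k) : christoffelL p X Y = christoffel p X Y := rfl

theorem tildeL_apply {k : ℕ} (S : TensorField12 k) (p X Y : E k) :
    tildeL S p X Y = tildeConn S p X Y := rfl

namespace IsHomogeneousKahlerStructure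

variable {k : ℕ} {μ : ℝ} {S : TensorField12 k}

theorem contDiffAt (hS : IsHomogeneousKahlerStructure μ S) {p : E k} (hp : p ∈ CH k) :
    ContDiffAt ℝ ∞ S p := hS.smooth.contDiffAt ((isOpen_CH k).mem_nhds hp)

/-- Parallelism of `S` solved for the derivative. With `tildeL S` regarded as given, the system is
linear in `S`; it serves for the uniqueness argument and, differentiated once more, for the Ricci
identity. -/
theorem fderiv_apply (hS : IsHomogeneousKahlerStructure μ S) {p : E k} (hp : p ∈ CH k)
    (V X Y : E k) : fderiv ℝ S p V X Y =
      -tildeL S p V (S p X Y) + S p (tildeL S p V X) Y + S p X (tildeL S p V Y) := by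
  have hd : HasFDerivAt S (fderiv ℝ S p) p :=
    ((hS.contDiffAt hp).differentiableAt (by simp)).hasFDerivAt
  have h1 := (hd.clm_apply (hasFDerivAt_const X p)).clm_apply (hasFDerivAt_const Y p)
  have h2 := hS.parallel_S p hp V X Y
  rw [h1.fderiv] at h2
  simp only [tildeL_apply]
  have h3 : ((S p X).comp (0 : E k →L[ℝ] E k) + ContinuousLinearMap.flip
      ((S p).comp (0 : E k →L[ℝ] E k) + ContinuousLinearMap.flip (fderiv ℝ S p) X) Y) V =
      fderiv ℝ S p V X Y := by
    simp
  rw [h3] at h2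
  linear_combination h2

theorem fderiv_fderiv_apply (hS : IsHomogeneousKahlerStructure μ S) {p : E k} (hp : p ∈ CH k)
    (U V X Y : E k) : fderiv ℝ (fderiv ℝ S) p U V X Y =
      -(fderiv ℝ (tildeL S) p U V (S p X Y)) - tildeL S p V (fderiv ℝ S p U X Y)
      + fderiv ℝ S p U (tildeL S p V X) Y + S p (fderiv ℝ (tildeL S) p U V X) Y
      + fderiv ℝ S p U X (tildeL S p V Y) + S p X (fderiv ℝ (tildeL S) p U V Y) := by
  have hd : HasFDerivAt S (fderiv ℝ S p) p :=
    ((hS.contDiffAt hp).differentiableAt (by simp)).hasFDerivAt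
  have hd2 : HasFDerivAt (fderiv ℝ S) (fderiv ℝ (fderiv ℝ S) p) p :=
    (((hS.contDiffAt hp).fderiv_right (m := 1) (WithTop.coe_le_coe.2 le_top)).differentiableAt
      (by simp)).hasFDerivAt
  have hT : HasFDerivAt (tildeL S) (fderiv ℝ (tildeL S) p) p :=
    ((((contDiffOn_christoffelL k).contDiffAt ((isOpen_CH k).mem_nhds hp)).sub
      (hS.contDiffAt hp)).differentiableAt (by simp)).hasFDerivAt
  have c := fun Z : E k => hasFDerivAt_const (𝕜 := ℝ) Z p
  have h1 := ((hd2.clm_apply (c V)).clm_apply (c X)).clm_apply (c Y)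
  have e1 := ((hd.clm_apply (c X)).clm_apply (c Y))
  have e2 := ((hT.clm_apply (c V)).clm_apply e1).neg
  have e3 := (hd.clm_apply ((hT.clm_apply (c V)).clm_apply (c X))).clm_apply (c Y)
  have e4 := (hd.clm_apply (c X)).clm_apply ((hT.clm_apply (c V)).clm_apply (c Y))
  have h2 := (e2.add e3).add e4
  have hev : (fun q => fderiv ℝ S q V X Y) =ᶠ[nhds p] fun q =>
      -tildeL S q V (S q X Y) + S q (tildeL S q V X) Y + S q X (tildeL S q V Y) := by
    filter_upwards [(isOpen_CH k).mem_nhds hp] with q hq using hS.fderiv_apply hq V X Y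
  have h3 := congrArg (fun F : E k →L[ℝ] E k => F U)
    ((h1.congr_of_eventuallyEq hev.symm).unique h2)
  simp only [ContinuousLinearMap.comp_zero, zero_add, _root_.add_apply,
    ContinuousLinearMap.flip_apply, ContinuousLinearMap.comp_apply,
    _root_.neg_apply] at h3
  rw [h3]
  abel

/-- The curvature of the connection `∇ - S` acts trivially on `S`. -/
theorem kills_curvature (hS : IsHomogeneousKahlerStructure μ S) {p : E k} (hp : p ∈ CH k)
    (U V : E k) :
    Kills (S p) (fun Z => curvature p U V Z - (S p U (S p V Z) - S p V (S p U Z)) +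
      S p (S p U V - S p V U) Z) := by
  intro X Y
  have hT : ∀ U V Z : E k, fderiv ℝ (tildeL S) p U V Z =
      fderiv ℝ (fun q => christoffel q V Z) p U - fderiv ℝ S p U V Z := by
    intro U V Z
    have hΓ : HasFDerivAt (christoffelL (k := k)) (fderiv ℝ christoffelL p) p :=
      (((contDiffOn_christoffelL k).contDiffAt ((isOpen_CH k).mem_nhds hp)).differentiableAt
        (by simp)).hasFDerivAt
    have hd : HasFDerivAt S (fderiv ℝ S p) p :=
      ((hS.contDiffAt hp).differentiableAt (by simp)).hasFDerivAt
    have h1 : fderiv ℝ (tildeL S) p = fderiv ℝ christoffelL p - fderiv ℝ S p :=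
      (hΓ.sub hd).fderiv
    have h2 : fderiv ℝ (fun q => christoffel q V Z) p U = fderiv ℝ christoffelL p U V Z := by
      have := (hΓ.clm_apply (hasFDerivAt_const V p)).clm_apply (hasFDerivAt_const Z p)
      have := congrArg (fun F : E k →L[ℝ] E k => F U) this.fderiv
      simpa [christoffelL_apply] using this
    rw [h1, h2]
    rfl
  -- The Ricci identity: symmetry of the second derivative of `S`, both sides expanded by
  -- parallelism, says that the curvature of `∇ - S` kills `S`. The first derivatives of `S` inside
  -- that curvature are eliminated by parallelism too, which leaves the algebraic expression of the
  -- statement.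
  have hsym : fderiv ℝ (fderiv ℝ S) p U V = fderiv ℝ (fderiv ℝ S) p V U :=
    ((hS.contDiffAt hp).isSymmSndFDerivAt (by
      rw [minSmoothness_of_isRCLikeNormedField]; exact WithTop.coe_le_coe.2 le_top)).eq U V
  have h := congrArg (fun F : E k →L[ℝ] E k →L[ℝ] E k => F X Y) hsym
  simp only [hS.fderiv_fderiv_apply hp, hT, hS.fderiv_apply hp, tildeL,
    _root_.sub_apply, christoffelL_apply] at h
  simp only [curvature, ← christoffelL_apply] at h ⊢
  simp only [map_add, map_sub, map_neg, _root_.add_apply,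
    _root_.sub_apply, _root_.neg_apply] at h ⊢
  have hs : ∀ U V, christoffelL p U V = christoffelL p V U := fun U V => christoffel_symm p U V
  rw [hs V U] at h
  rw [← sub_eq_zero] at h ⊢
  rw [← neg_eq_zero, ← h]
  abel

theorem metric_skew (hS : IsHomogeneousKahlerStructure μ S) {p : E k} (hp : p ∈ CH k)
    (V X Y : E k) : metric μ p (S p V X) Y = -metric μ p X (S p V Y) := by
  have h1 := hS.parallel_metric p hp V X Y
  rw [christoffel_metric μ p hp] at h1
  simp only [tildeConn, map_sub, LinearMap.sub_apply] at h1
  linarith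

theorem apply_J (hS : IsHomogeneousKahlerStructure μ S) {p : E k} (hp : p ∈ CH k)
    (V X : E k) : S p V (J X) = J (S p V X) := by
  have h1 := hS.parallel_J p hp V X
  have h2 : christoffel p V (J X) = J (christoffel p V X) := by
    simp only [christoffel, J, tlift_csmul, herm_smul_left, mul_div_assoc]
    module
  have h3 : ∀ A B : E k, J (A - B) = J A - J B := fun A B => smul_sub _ _ _
  rw [tildeConn, tildeConn, h2, h3] at h1
  rw [← sub_eq_zero]
  rw [← neg_eq_zero, ← h1]
  abel

end IsHomogeneousKahlerStructure

/-- In this chart the domain is a sublevel set of the convex function `|v|² + 2 Re z`. -/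
theorem convex_CH (k : ℕ) : Convex ℝ (CH k) := by
  have key : ∀ q : E k, (herm (lift q) (lift q)).re =
      ∑ i, ((q.1 i).re ^ 2 + (q.1 i).im ^ 2) + 2 * q.2.re := by
    intro q
    simp [herm, lift, sq]
    ring
  intro p hp q hq a b ha hb hab
  have hp' : (herm (lift p) (lift p)).re < 0 := hp
  have hq' : (herm (lift q) (lift q)).re < 0 := hq
  change (herm (lift _) (lift _)).re < 0
  rw [key] at hp' hq' ⊢
  have h1 : ∑ i, (((a • p + b • q).1 i).re ^ 2 + ((a • p + b • q).1 i).im ^ 2) ≤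
      a * ∑ i, ((p.1 i).re ^ 2 + (p.1 i).im ^ 2) + b * ∑ i, ((q.1 i).re ^ 2 + (q.1 i).im ^ 2) := by
    rw [Finset.mul_sum, Finset.mul_sum, ← Finset.sum_add_distrib]
    refine Finset.sum_le_sum fun i _ => ?_
    have hb' : b = 1 - a := by linarith
    subst hb'
    have h2 : 0 ≤ a * (1 - a) := mul_nonneg ha hb
    simp
    nlinarith [mul_nonneg h2 (sq_nonneg ((p.1 i).re - (q.1 i).re)),
      mul_nonneg h2 (sq_nonneg ((p.1 i).im - (q.1 i).im))]
  have h3 : (a • p + b • q).2.re = a * p.2.re + b * q.2.re := by simp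
  rw [h3]
  rcases ha.eq_or_lt with rfl | ha'
  · have : b = 1 := by linarith
    subst this
    linarith
  · nlinarith [mul_nonneg hb (neg_nonneg.2 hq'.le), mul_pos ha' (neg_pos.2 hp')]

/-- On the segment from `p` to `q` the structure solves a linear ordinary differential equation with
bounded coefficients, so Gronwall's inequality propagates the zero. -/
theorem IsHomogeneousKahlerStructure.eq_zero_of_eq_zero {k : ℕ} {μ : ℝ} {S : TensorField12 k}
    (hS : IsHomogeneousKahlerStructure μ S) {p q : E k} (hp : p ∈ CH k) (hq : q ∈ CH k)
    (h : S p = 0) : S q = 0 := by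
  set γ : ℝ → E k := fun t => p + t • (q - p) with hγ
  have hmem : ∀ t ∈ Set.Icc (0 : ℝ) 1, γ t ∈ CH k := fun t ht =>
    (convex_CH k).add_smul_sub_mem hp hq ht
  have hγc : Continuous γ := by fun_prop
  have hγd : ∀ t, HasDerivAt γ (q - p) t := by
    intro t
    have := ((hasDerivAt_id t).smul_const (q - p)).const_add p
    rwa [one_smul] at this
  have hTc : ContinuousOn (fun t => tildeL S (γ t) (q - p)) (Set.Icc 0 1) := by
    have : ContinuousOn (tildeL S) (CH k) :=
      ((contDiffOn_christoffelL k).sub hS.smooth).continuousOn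
    exact (this.comp hγc.continuousOn hmem).clm_apply continuousOn_const
  obtain ⟨C, hC⟩ := isCompact_Icc.exists_bound_of_continuousOn hTc
  -- One factor `C` for each of the three terms of `fderiv_apply`.
  have hbound : ∀ t ∈ Set.Ico (0 : ℝ) 1,
      ‖fderiv ℝ S (γ t) (q - p)‖ ≤ (3 * C) * ‖S (γ t)‖ + 0 := by
    intro t ht
    have ht' := Set.Ico_subset_Icc_self ht
    have hC0 : 0 ≤ C := (norm_nonneg _).trans (hC t ht')
    rw [add_zero]
    refine ContinuousLinearMap.opNorm_le_bound₂ _ (by positivity) fun X Y => ?_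
    rw [hS.fderiv_apply (hmem t ht')]
    set T := tildeL S (γ t) (q - p)
    set s := S (γ t)
    have hT : ∀ Z, ‖T Z‖ ≤ C * ‖Z‖ := fun Z => T.le_of_opNorm_le (hC t ht') Z
    have hs := s.le_opNorm₂
    have b1 : ‖T (s X Y)‖ ≤ C * (‖s‖ * ‖X‖ * ‖Y‖) :=
      (hT _).trans (mul_le_mul_of_nonneg_left (hs X Y) hC0)
    have b2 : ‖s (T X) Y‖ ≤ ‖s‖ * (C * ‖X‖) * ‖Y‖ := by
      refine (hs _ _).trans ?_
      gcongr
      exact hT X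
    have b3 : ‖s X (T Y)‖ ≤ ‖s‖ * ‖X‖ * (C * ‖Y‖) := by
      refine (hs _ _).trans ?_
      gcongr
      exact hT Y
    have := norm_add₃_le (a := -(T (s X Y))) (b := s (T X) Y) (c := s X (T Y))
    rw [norm_neg] at this
    linarith
  have hcont : ContinuousOn (fun t => S (γ t)) (Set.Icc 0 1) :=
    hS.smooth.continuousOn.comp hγc.continuousOn hmem
  have hder : ∀ t ∈ Set.Ico (0 : ℝ) 1,
      HasDerivWithinAt (fun t => S (γ t)) (fderiv ℝ S (γ t) (q - p)) (Set.Ici t) t := by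
    intro t ht
    have hd : HasFDerivAt S (fderiv ℝ S (γ t)) (γ t) :=
      ((hS.contDiffAt (hmem t (Set.Ico_subset_Icc_self ht))).differentiableAt
        (by simp)).hasFDerivAt
    exact (hd.comp_hasDerivAt t (hγd t)).hasDerivWithinAt
  have h0 : ‖S (γ 0)‖ ≤ 0 := by simp [hγ, h]
  have := norm_le_gronwallBound_of_norm_deriv_right_le hcont hder h0 hbound 1 (by simp)
  rw [gronwallBound_ε0_δ0] at this
  simpa [hγ] using this

/-! ### Orthonormal bases -/

theorem exists_orthonormalBasis_of_posDef {V : Type*} [AddCommGroup V] [Module ℝ V]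
    [FiniteDimensional ℝ V] (B : V →ₗ[ℝ] V →ₗ[ℝ] ℝ) (hsymm : ∀ x y, B x y = B y x)
    (hpos : ∀ x, x ≠ 0 → 0 < B x x) :
    ∃ b : Module.Basis (Fin (Module.finrank ℝ V)) ℝ V,
      ∀ i j, B (b i) (b j) = if i = j then 1 else 0 := by
  let c : InnerProductSpace.Core ℝ V :=
    { inner := fun x y => B x y
      conj_inner_symm := fun x y => by simpa using hsymm y x
      re_inner_nonneg := fun x => by
        by_cases hx : x = 0
        · simp [hx]
        · simpa using (hpos x hx).le
      add_left := fun x y z => by simp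
      smul_left := fun x y r => by simp
      definite := fun x h => by
        by_contra hx
        exact (hpos x hx).ne' h }
  let _ : NormedAddCommGroup V := c.toNormedAddCommGroup
  let _ : InnerProductSpace ℝ V := InnerProductSpace.ofCore c.toCore
  let b := stdOrthonormalBasis ℝ V
  refine ⟨b.toBasis, fun i j => ?_⟩
  have h := orthonormal_iff_ite.1 b.orthonormal i j
  rw [OrthonormalBasis.coe_toBasis]
  exact h

theorem eq_sum_of_orthonormal {V ι : Type*} [AddCommGroup V] [Module ℝ V] [Fintype ι]
    [DecidableEq ι] (B : V →ₗ[ℝ] V →ₗ[ℝ] ℝ) (b : Module.Basis ι ℝ V)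
    (hb : ∀ i j, B (b i) (b j) = if i = j then 1 else 0) (x : V) :
    x = ∑ i, B x (b i) • b i := by
  have h : ∀ i, B x (b i) = b.repr x i := by
    intro i
    conv_lhs => rw [← b.sum_repr x]
    simp only [map_sum, map_smul, LinearMap.sum_apply, LinearMap.smul_apply, smul_eq_mul, hb]
    simp
  simp only [h, b.sum_repr]

theorem trace_eq_sum_of_orthonormal {V ι : Type*} [AddCommGroup V] [Module ℝ V] [Fintype ι]
    [DecidableEq ι] (B : V →ₗ[ℝ] V →ₗ[ℝ] ℝ) (b : Module.Basis ι ℝ V)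
    (hb : ∀ i j, B (b i) (b j) = if i = j then 1 else 0) (T : V →ₗ[ℝ] V) :
    LinearMap.trace ℝ V T = ∑ i, B (T (b i)) (b i) := by
  have h : ∀ x i, B x (b i) = b.repr x i := by
    intro x i
    conv_lhs => rw [← b.sum_repr x]
    simp only [map_sum, map_smul, LinearMap.sum_apply, LinearMap.smul_apply, smul_eq_mul, hb]
    simp
  rw [LinearMap.trace_eq_matrix_trace ℝ b, Matrix.trace]
  simp [LinearMap.toMatrix_apply, h]

theorem trace_eq_zero_of_skew {V : Type*} [AddCommGroup V] [Module ℝ V]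
    [FiniteDimensional ℝ V] (B : V →ₗ[ℝ] V →ₗ[ℝ] ℝ) (hsymm : ∀ x y, B x y = B y x)
    (hpos : ∀ x, x ≠ 0 → 0 < B x x) (T : V →ₗ[ℝ] V) (hT : ∀ x, B (T x) x = 0) :
    LinearMap.trace ℝ V T = 0 := by
  obtain ⟨b, hb⟩ := exists_orthonormalBasis_of_posDef B hsymm hpos
  rw [trace_eq_sum_of_orthonormal B b hb]
  simp [hT]

/-! ### The trace form -/

/-- The euclidean inner product `Re tr (A Bᴴ)` of matrices. -/
def ip {k : ℕ} : Mat k →ₗ[ℝ] Mat k →ₗ[ℝ] ℝ :=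
  LinearMap.mk₂ ℝ (fun A B => (A * Bᴴ).trace.re)
    (by intros; simp [add_mul]) (by intros; simp)
    (by intros; simp [mul_add]) (by intros; simp)

theorem ip_apply {k : ℕ} (A B : Mat k) : ip A B = (A * Bᴴ).trace.re := rfl

theorem ip_comm {k : ℕ} (A B : Mat k) : ip A B = ip B A := by
  rw [ip_apply, ip_apply, ← Complex.conj_re, ← Complex.star_def, ← Matrix.trace_conjTranspose,
    Matrix.conjTranspose_mul, Matrix.conjTranspose_conjTranspose]

theorem ip_self {k : ℕ} (A : Mat k) : ip A A = ∑ i, ∑ j, Complex.normSq (A i j) := by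
  simp [ip_apply, Matrix.trace, Matrix.mul_apply, Complex.mul_conj]

theorem ip_self_nonneg {k : ℕ} (A : Mat k) : 0 ≤ ip A A := by
  rw [ip_self]
  exact Finset.sum_nonneg fun i _ => Finset.sum_nonneg fun j _ => Complex.normSq_nonneg _

theorem eq_zero_of_ip_self {k : ℕ} {A : Mat k} (h : ip A A = 0) : A = 0 := by
  rw [ip_self] at h
  ext i j
  have h1 := (Finset.sum_eq_zero_iff_of_nonneg fun i _ => Finset.sum_nonneg
    fun j _ => Complex.normSq_nonneg (A i j)).1 h i (Finset.mem_univ i)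
  have h2 := (Finset.sum_eq_zero_iff_of_nonneg fun j _ => Complex.normSq_nonneg (A i j)).1 h1 j
    (Finset.mem_univ j)
  exact Complex.normSq_eq_zero.1 h2

theorem ip_self_pos {k : ℕ} {A : Mat k} (h : A ≠ 0) : 0 < ip A A :=
  lt_of_le_of_ne (ip_self_nonneg A) fun h' => h (eq_zero_of_ip_self h'.symm)

theorem ip_lie {k : ℕ} (A B C : Mat k) : ip ⁅A, B⁆ C = ip B ⁅Aᴴ, C⁆ := by
  simp only [ip_apply, Ring.lie_def, Matrix.conjTranspose_sub, Matrix.conjTranspose_mul,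
    Matrix.conjTranspose_conjTranspose, sub_mul, mul_sub, Matrix.trace_sub, Complex.sub_re]
  rw [mul_assoc A, Matrix.trace_mul_comm A, mul_assoc, mul_assoc]

/-- The restriction of `ip` to a subspace. -/
def ipOn {k : ℕ} (g : Submodule ℝ (Mat k)) : g →ₗ[ℝ] g →ₗ[ℝ] ℝ :=
  (ip.comp g.subtype).compl₂ g.subtype

theorem ipOn_apply {k : ℕ} (g : Submodule ℝ (Mat k)) (x y : g) :
    ipOn g x y = ip (x : Mat k) y := rfl

/-- The mean curvature element of a subalgebra. -/
theorem exists_mean_curvature {k : ℕ} (g : Submodule ℝ (Mat k))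
    (hlie : ∀ A ∈ g, ∀ B ∈ g, ⁅A, B⁆ ∈ g) :
    ∃ ξ : Mat k, ξᴴ = ξ ∧ (g ≤ su k → ξ ∈ su k) ∧
      (∀ A ∈ g, ∀ B ∈ g, ip ⁅A, B⁆ ξ = 0) ∧
      ∀ D ∈ g, ip ⁅D, D + Dᴴ⁆ ξ = 0 → ∀ A ∈ g, ⁅D + Dᴴ, A⁆ ∈ g := by
  obtain ⟨b₀, hb₀⟩ := exists_orthonormalBasis_of_posDef (ipOn g) (fun x y => ip_comm _ _)
    (fun x hx => ip_self_pos (by simpa using hx))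
  set b : Fin (Module.finrank ℝ g) → Mat k := fun i => (b₀ i : Mat k) with hbdef
  have hbg : ∀ i, b i ∈ g := fun i => (b₀ i).2
  have hb : ∀ i j, ip (b i) (b j) = if i = j then 1 else 0 := hb₀
  have hexp : ∀ A ∈ g, A = ∑ i, ip A (b i) • b i := by
    intro A hA
    have := congrArg (fun x : g => (x : Mat k)) (eq_sum_of_orthonormal (ipOn g) b₀ hb₀ ⟨A, hA⟩)
    simpa [ipOn_apply] using this
  have hip : ∀ A ∈ g, ∀ B, ip B A = ∑ j, ip A (b j) * ip B (b j) := by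
    intro A hA B
    conv_lhs => rw [hexp A hA]
    simp
  -- Chosen so that pairing with `ξ` is the trace of `ad` compressed to `g`, as `hξip` shows.
  set ξ : Mat k := ∑ i, ⁅b i, (b i)ᴴ⁆ with hξ
  have hξip : ∀ Y, ∑ i, ip ⁅Y, b i⁆ (b i) = ip Y ξ := by
    intro Y
    rw [hξ, map_sum]
    refine Finset.sum_congr rfl fun i _ => ?_
    simp only [ip_apply, Ring.lie_def, Matrix.conjTranspose_sub, Matrix.conjTranspose_mul,
      Matrix.conjTranspose_conjTranspose, sub_mul, mul_sub, Matrix.trace_sub, Complex.sub_re]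
    rw [mul_assoc, mul_assoc (b i), Matrix.trace_mul_comm (b i), mul_assoc]
  -- On `g` the endomorphism `ad ⁅A, B⁆` is a commutator, hence has trace zero; here this is
  -- computed in the basis `b`.
  have hskew : ∀ A ∈ g, ∀ B ∈ g, ip ⁅A, B⁆ ξ = 0 := by
    intro A hA B hB
    rw [← hξip]
    have h1 : ∀ i, ip ⁅⁅A, B⁆, b i⁆ (b i) =
        ∑ j, ip ⁅B, b i⁆ (b j) * ip ⁅A, b j⁆ (b i) -
        ∑ j, ip ⁅A, b i⁆ (b j) * ip ⁅B, b j⁆ (b i) := by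
      intro i
      have h2 : ∀ A ∈ g, ∀ B ∈ g, ip ⁅A, ⁅B, b i⁆⁆ (b i) =
          ∑ j, ip ⁅B, b i⁆ (b j) * ip ⁅A, b j⁆ (b i) := by
        intro A hA B hB
        conv_lhs => rw [hexp _ (hlie B hB _ (hbg i))]
        simp [lie_sum]
      rw [lie_lie, map_sub, LinearMap.sub_apply, h2 A hA B hB, h2 B hB A hA]
    simp only [h1, Finset.sum_sub_distrib]
    rw [sub_eq_zero, Finset.sum_comm]
    refine Finset.sum_congr rfl fun i _ => Finset.sum_congr rfl fun j _ => mul_comm _ _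
  refine ⟨ξ, ?_, ?_, hskew, ?_⟩
  · rw [hξ, Matrix.conjTranspose_sum]
    refine Finset.sum_congr rfl fun i _ => ?_
    simp [Ring.lie_def, Matrix.conjTranspose_mul]
  · intro hg
    exact Submodule.sum_mem _ fun i _ => lie_mem_su (hg (hbg i)) (conjTranspose_mem_su (hg (hbg i)))
  · intro D hD h0
    set Y := D + Dᴴ with hY
    have hYY : Yᴴ = Y := by simp [hY, add_comm]
    set y : Fin (Module.finrank ℝ g) → Fin (Module.finrank ℝ g) → ℝ :=
      fun i j => ip ⁅Y, b i⁆ (b j) with hy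
    set c : Fin (Module.finrank ℝ g) → Fin (Module.finrank ℝ g) → ℝ :=
      fun i j => ip ⁅D, b i⁆ (b j) with hc
    have hyc : ∀ i j, y i j = c i j + c j i := by
      intro i j
      simp only [hy, hc]
      rw [hY, add_lie, map_add, LinearMap.add_apply, ip_lie Dᴴ, Matrix.conjTranspose_conjTranspose,
        ip_comm (b i)]
    -- `r i` is the component of `⁅Y, b i⁆` orthogonal to `g`. Since `y` is `c` plus its transpose,
    -- `∑ y i j ^ 2 = 2 ∑ y i j * c i j`, and the pairing of `⁅D, Y⁆` with `ξ` becomes the sum of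
    -- squares `∑ ip (r i) (r i)`. Its vanishing means that `Y` normalizes `g`.
    set r : Fin (Module.finrank ℝ g) → Mat k := fun i => ⁅Y, b i⁆ - ∑ j, y i j • b j with hr
    have hrr : ∀ i, ip (r i) (r i) = ip ⁅Y, b i⁆ ⁅Y, b i⁆ - ∑ j, y i j * y i j := by
      intro i
      have h1 : ∀ j, ip (b j) ⁅Y, b i⁆ = y i j := fun j => ip_comm _ _
      have h2 : ∀ j, ip ⁅Y, b i⁆ (b j) = y i j := fun j => rfl
      simp only [hr, map_sub, LinearMap.sub_apply, map_sum, map_smul, LinearMap.sum_apply,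
        LinearMap.smul_apply, smul_eq_mul, h1, h2, hb]
      simp
    have hsum : ip ⁅D, Y⁆ ξ = ∑ i, ip (r i) (r i) := by
      rw [← hξip]
      have h1 : ∀ i, ip ⁅⁅D, Y⁆, b i⁆ (b i) =
          ip ⁅Y, b i⁆ ⁅Y, b i⁆ - 2 * ∑ j, y i j * c i j := by
        intro i
        have h2 : ip ⁅Y, b i⁆ ⁅D, b i⁆ = ∑ j, y i j * c i j := by
          rw [hip _ (hlie D hD _ (hbg i))]
          exact Finset.sum_congr rfl fun j _ => mul_comm _ _
        have h3 : Dᴴ = Y - D := by rw [hY]; abel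
        rw [lie_lie, map_sub, LinearMap.sub_apply, ip_lie D, ip_lie Y ⁅D, b i⁆, hYY, h3, sub_lie, map_sub,
          h2, ip_comm ⁅D, b i⁆, h2]
        ring
      simp only [h1, hrr, Finset.sum_sub_distrib]
      congr 1
      rw [← Finset.mul_sum]
      have h4 : ∑ i, ∑ j, y i j * y i j = ∑ i, ∑ j, y i j * c i j + ∑ i, ∑ j, y i j * c j i := by
        rw [← Finset.sum_add_distrib]
        refine Finset.sum_congr rfl fun i _ => ?_
        rw [← Finset.sum_add_distrib]
        refine Finset.sum_congr rfl fun j _ => ?_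
        rw [← mul_add, ← hyc]
      have h5 : ∑ i, ∑ j, y i j * c j i = ∑ i, ∑ j, y i j * c i j := by
        rw [Finset.sum_comm]
        refine Finset.sum_congr rfl fun i _ => Finset.sum_congr rfl fun j _ => ?_
        rw [hyc, hyc, add_comm]
      rw [h4, h5]
      ring
    rw [h0] at hsum
    have hr0 : ∀ i, r i = 0 := by
      intro i
      have := (Finset.sum_eq_zero_iff_of_nonneg fun i _ => ip_self_nonneg (r i)).1 hsum.symm i
        (Finset.mem_univ i)
      exact eq_zero_of_ip_self this
    have hmem : ∀ i, ⁅Y, b i⁆ ∈ g := by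
      intro i
      rw [sub_eq_zero.1 (hr0 i)]
      exact Submodule.sum_mem _ fun j _ => g.smul_mem _ (hbg j)
    intro A hA
    rw [hexp A hA, lie_sum]
    refine Submodule.sum_mem _ fun i _ => ?_
    rw [lie_smul]
    exact g.smul_mem _ (hmem i)

/-! ### The root space decomposition -/

theorem hermMatrix_conj_apply {k : ℕ} (A : Mat k) (i j : Idx k) :
    (hermMatrix k * A * hermMatrix k) i j =
      A (Sum.map id (Equiv.swap 0 1) i) (Sum.map id (Equiv.swap 0 1) j) := by
  rcases i with i | i <;> rcases j with j | j <;>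
    [skip; fin_cases j; fin_cases i; (fin_cases i <;> fin_cases j)] <;>
    simp [hermMatrix, Matrix.mul_apply, Matrix.one_apply]

/-- The Gram matrix permutes the last two coordinates, so the Cartan involution becomes a relation
between single entries. -/
theorem swap_apply_of_mem_su {k : ℕ} {A : Mat k} (hA : A ∈ su k) (i j : Idx k) :
    A (Sum.map id (Equiv.swap 0 1) i) (Sum.map id (Equiv.swap 0 1) j) = -conj (A j i) := by
  refine (hermMatrix_conj_apply A i j).symm.trans ?_
  rw [conj_hermMatrix_of_mem_su hA]
  rfl

/-- The restricted root decomposition: the summands belong to the eigenvalues `0, 0, 1, 2, -1, -2`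
of `ad (A0 k)`, and the negative root spaces are the conjugate transposes of the positive ones. -/
theorem exists_decomposition_of_mem_su {k : ℕ} {A : Mat k} (hA : A ∈ su k) :
    ∃ (U : Matrix (Fin k) (Fin k) ℂ) (c t : ℝ) (v : Fin k → ℂ) (b : ℝ) (w : Fin k → ℂ) (d : ℝ),
      Uᴴ = -U ∧ U.trace + 2 * Complex.I * c = 0 ∧
      A = compactMat U c + t • A0 k + nilMat v 0 + nilMat 0 b + (nilMat w 0)ᴴ +
        (nilMat 0 d)ᴴ := by
  have h := swap_apply_of_mem_su hA
  refine ⟨A.toBlocks₁₁, (A (Sum.inr 0) (Sum.inr 0)).im, (A (Sum.inr 0) (Sum.inr 0)).re,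
    fun i => A (Sum.inl i) (Sum.inr 1), (A (Sum.inr 0) (Sum.inr 1)).im,
    fun i => -A (Sum.inl i) (Sum.inr 0), -(A (Sum.inr 1) (Sum.inr 0)).im, ?_, ?_, ?_⟩
  · ext i j
    have := h (Sum.inl j) (Sum.inl i)
    simp only [Sum.map_inl, id] at this
    simp [Matrix.toBlocks₁₁, this]
  · have ht := hA.2
    have h00 := h (Sum.inr 0) (Sum.inr 0)
    simp only [Sum.map_inr, Equiv.swap_apply_left] at h00
    rw [Matrix.trace, Fintype.sum_sum_type, Fin.sum_univ_two] at ht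
    simp only [Matrix.diag_apply, h00] at ht
    rw [Matrix.trace, ← ht]
    simp only [Matrix.diag_apply, Matrix.toBlocks₁₁, Matrix.of_apply]
    congr 1
    apply Complex.ext <;> simp
    ring
  · have h01 := h (Sum.inr 0) (Sum.inr 1)
    have h10 := h (Sum.inr 1) (Sum.inr 0)
    have h00 := h (Sum.inr 0) (Sum.inr 0)
    simp only [Sum.map_inr, Equiv.swap_apply_left, Equiv.swap_apply_right] at h01 h10 h00
    ext i j
    rcases i with i | i <;> rcases j with j | j <;>
      [skip; fin_cases j; fin_cases i; (fin_cases i <;> fin_cases j)]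
    · simp [compactMat, A0, nilMat, Matrix.toBlocks₁₁]
    · simp [compactMat, A0, nilMat]
    · simp [compactMat, A0, nilMat]
    · have := h (Sum.inr 1) (Sum.inl j)
      simp only [Sum.map_inl, Sum.map_inr, id, Equiv.swap_apply_right] at this
      simp [compactMat, A0, nilMat, this]
    · have := h (Sum.inr 0) (Sum.inl j)
      simp only [Sum.map_inl, Sum.map_inr, id, Equiv.swap_apply_left] at this
      simp [compactMat, A0, nilMat, this]
    · apply Complex.ext <;> simp [compactMat, A0, nilMat]
    · have h1 := congrArg Complex.re h10
      simp at h1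
      apply Complex.ext <;> simp [compactMat, A0, nilMat]
      linarith
    · have h1 := congrArg Complex.re h01
      simp at h1
      apply Complex.ext <;> simp [compactMat, A0, nilMat]
      linarith
    · simp only [Fin.mk_one, Fin.isValue, h00]
      apply Complex.ext <;> simp [compactMat, A0, nilMat]

theorem compactMat_conjTranspose {k : ℕ} {U : Matrix (Fin k) (Fin k) ℂ} (hU : Uᴴ = -U) (c : ℝ) :
    (compactMat U c)ᴴ = -compactMat U c := by
  rw [compactMat, Matrix.fromBlocks_conjTranspose, hU, Matrix.fromBlocks_neg]
  congr 1
  · simp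
  · simp
  · ext i j
    fin_cases i <;> fin_cases j <;> simp

theorem A0_conjTranspose (k : ℕ) : (A0 k)ᴴ = A0 k := by
  rw [A0, Matrix.fromBlocks_conjTranspose]
  congr 1
  · simp
  · simp
  · simp
  · ext i j
    fin_cases i <;> fin_cases j <;> simp

theorem lie_A0_compactMat {k : ℕ} (U : Matrix (Fin k) (Fin k) ℂ) (c : ℝ) :
    ⁅A0 k, compactMat U c⁆ = 0 := by
  rw [Ring.lie_def, A0, compactMat, Matrix.fromBlocks_multiply, Matrix.fromBlocks_multiply]
  ext i j
  rcases i with i | i <;> rcases j with j | j <;> simp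

theorem lie_A0_nilMat {k : ℕ} (v : Fin k → ℂ) (b : ℝ) :
    ⁅A0 k, nilMat v b⁆ = nilMat v (2 * b) := by
  rw [Ring.lie_def]
  ext i j
  rcases i with i | i <;> rcases j with j | j <;>
    [skip; fin_cases j; fin_cases i; (fin_cases i <;> fin_cases j)] <;>
    simp [A0, nilMat, Matrix.mul_apply]
  ring

theorem lie_A0_conjTranspose {k : ℕ} (A : Mat k) : ⁅A0 k, Aᴴ⁆ = -⁅A0 k, A⁆ᴴ := by
  rw [Ring.lie_def, Ring.lie_def, Matrix.conjTranspose_sub, Matrix.conjTranspose_mul,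
    Matrix.conjTranspose_mul, A0_conjTranspose]
  abel

theorem nilMat_smul {k : ℕ} (a : ℝ) (v : Fin k → ℂ) (b : ℝ) :
    nilMat (a • v) (a * b) = a • nilMat v b := by
  ext i j
  rcases i with i | i <;> rcases j with j | j <;>
    [skip; fin_cases j; fin_cases i; (fin_cases i <;> fin_cases j)] <;> simp [nilMat]
  ring

theorem nilMat_add {k : ℕ} (v v' : Fin k → ℂ) (b b' : ℝ) :
    nilMat (v + v') (b + b') = nilMat v b + nilMat v' b' := by
  ext i j
  rcases i with i | i <;> rcases j with j | j <;>
    [skip; fin_cases j; fin_cases i; (fin_cases i <;> fin_cases j)] <;> simp [nilMat] <;> ring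

theorem nilMat_split {k : ℕ} (v : Fin k → ℂ) (b : ℝ) :
    nilMat v b = nilMat v 0 + nilMat 0 b := by
  rw [← nilMat_add, add_zero, zero_add]

theorem A0_mem_su (k : ℕ) : A0 k ∈ su k := by
  refine ⟨?_, by simp [A0, Matrix.trace]⟩
  rw [A0_conjTranspose, A0, hermMatrix, Matrix.fromBlocks_multiply, Matrix.fromBlocks_multiply]
  ext i j
  rcases i with i | i <;> rcases j with j | j <;> simp
  fin_cases i <;> fin_cases j <;> simp

theorem compactPart_le_su (k : ℕ) : compactPart k ≤ su k := by
  rintro _ ⟨U, c, hU, ht, rfl⟩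
  refine ⟨?_, ?_⟩
  · rw [compactMat_conjTranspose hU, compactMat, hermMatrix, Matrix.fromBlocks_neg,
      Matrix.fromBlocks_multiply, Matrix.fromBlocks_multiply]
    ext i j
    rcases i with i | i <;> rcases j with j | j <;> simp
    fin_cases i <;> fin_cases j <;> simp
  · rw [← ht]
    simp [compactMat, Matrix.trace]
    ring

theorem nilPart_le_su (k : ℕ) : nilPart k ≤ su k := by
  rintro _ ⟨v, b, rfl⟩
  refine ⟨?_, ?_⟩
  · ext i j
    rcases i with i | i <;> rcases j with j | j <;>
      [skip; fin_cases j; fin_cases i; (fin_cases i <;> fin_cases j)] <;>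
      simp [nilMat, hermMatrix, Matrix.mul_apply, Matrix.one_apply]
  · simp [nilMat, Matrix.trace]

theorem nilMat_mem_su {k : ℕ} (v : Fin k → ℂ) (b : ℝ) : nilMat v b ∈ su k :=
  nilPart_le_su k ⟨v, b, rfl⟩

/-! ### Special brackets -/

/-- The centre of `𝔫` and its conjugate transpose span, together with `A0 k`, a copy of `𝔰𝔩₂(ℝ)`. -/
theorem lie_nilMat_center {k : ℕ} :
    ⁅(nilMat 0 1 : Mat k), (nilMat 0 1 : Mat k)ᴴ⁆ = A0 k := by
  rw [Ring.lie_def]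
  ext i j
  rcases i with i | i <;> rcases j with j | j <;>
    [skip; fin_cases j; fin_cases i; (fin_cases i <;> fin_cases j)] <;>
    simp [nilMat, A0, Matrix.mul_apply]

theorem lie_nilMat_center_neg {k : ℕ} (w : Fin k → ℂ) :
    ⁅(nilMat 0 1 : Mat k), (nilMat w 0)ᴴ⁆ = nilMat (Complex.I • w) 0 := by
  rw [Ring.lie_def]
  ext i j
  rcases i with i | i <;> rcases j with j | j <;>
    [skip; fin_cases j; fin_cases i; (fin_cases i <;> fin_cases j)] <;>
    simp [nilMat, Matrix.mul_apply]
  ring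

theorem lie_nilMat_neg {k : ℕ} (v w : Fin k → ℂ) :
    ⁅nilMat v 0, (nilMat w 0)ᴴ⁆ = Matrix.fromBlocks
      (Matrix.vecMulVec v (star w) - Matrix.vecMulVec w (star v)) 0 0
      !![star v ⬝ᵥ w, 0; 0, -(star w ⬝ᵥ v)] := by
  rw [Ring.lie_def]
  ext i j
  rcases i with i | i <;> rcases j with j | j <;>
    [skip; fin_cases j; fin_cases i; (fin_cases i <;> fin_cases j)] <;>
    simp [nilMat, Matrix.mul_apply, Matrix.vecMulVec, dotProduct]

theorem star_dotProduct_self {k : ℕ} (w : Fin k → ℂ) :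
    star w ⬝ᵥ w = ((∑ i, Complex.normSq (w i) : ℝ) : ℂ) := by
  simp [dotProduct, Complex.normSq_eq_conj_mul_self]

theorem lie_nilMat_neg_self {k : ℕ} (w : Fin k → ℂ) :
    ⁅nilMat w 0, (nilMat w 0)ᴴ⁆ = (∑ i, Complex.normSq (w i)) • A0 k := by
  rw [lie_nilMat_neg, star_dotProduct_self]
  ext i j
  rcases i with i | i <;> rcases j with j | j <;>
    [skip; fin_cases j; fin_cases i; (fin_cases i <;> fin_cases j)] <;> simp [A0]

theorem lie_lie_nilMat_neg {k : ℕ} (w : Fin k → ℂ) :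
    ⁅⁅nilMat (Complex.I • w) 0, (nilMat w 0)ᴴ⁆, (nilMat w 0)ᴴ⁆ =
      (3 * ∑ i, Complex.normSq (w i)) • (nilMat (Complex.I • w) 0)ᴴ := by
  have h1 : ∀ i, ∑ j, w i * conj (w j) * w j =
      ((∑ i, Complex.normSq (w i) : ℝ) : ℂ) * w i := by
    intro i
    rw [← star_dotProduct_self, dotProduct, Finset.sum_mul]
    exact Finset.sum_congr rfl fun j _ => by simp; ring
  have h2 : ∀ i, ∑ j, conj (w j) * (w j * conj (w i)) =
      ((∑ i, Complex.normSq (w i) : ℝ) : ℂ) * conj (w i) := by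
    intro i
    rw [← star_dotProduct_self, dotProduct, Finset.sum_mul]
    exact Finset.sum_congr rfl fun j _ => by simp; ring
  have e1 : star (Complex.I • w) ⬝ᵥ w =
      -Complex.I * ((∑ i, Complex.normSq (w i) : ℝ) : ℂ) := by
    rw [star_smul, smul_dotProduct, star_dotProduct_self]; simp
  have e2 : star w ⬝ᵥ (Complex.I • w) =
      Complex.I * ((∑ i, Complex.normSq (w i) : ℝ) : ℂ) := by
    rw [dotProduct_smul, star_dotProduct_self]; simp
  have e3 : Matrix.vecMulVec (Complex.I • w) (star w) - Matrix.vecMulVec w (star (Complex.I • w)) =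
      (2 * Complex.I) • Matrix.of fun i j => w i * conj (w j) := by
    ext i j
    simp [Matrix.vecMulVec]
    ring
  rw [lie_nilMat_neg, e1, e2, e3, Ring.lie_def]
  set r : ℝ := ∑ i, Complex.normSq (w i)
  ext i j
  rcases i with i | i <;> rcases j with j | j <;>
    [skip; fin_cases j; fin_cases i; (fin_cases i <;> fin_cases j)]
  · simp [nilMat, Matrix.mul_apply]
  · have : ∑ x, -(2 * Complex.I * (w i * conj (w x)) * w x) = -(2 * Complex.I) * (r * w i) := by
      rw [← h1, Finset.mul_sum]
      exact Finset.sum_congr rfl fun j _ => by ring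
    simp [nilMat, Matrix.mul_apply] at this ⊢
    rw [this]
    ring
  · simp [nilMat, Matrix.mul_apply]
  · simp [nilMat, Matrix.mul_apply]
  · have : ∑ x, conj (w x) * (2 * Complex.I * (w x * conj (w j))) =
        (2 * Complex.I) * (r * conj (w j)) := by
      rw [← h2, Finset.mul_sum]
      exact Finset.sum_congr rfl fun j _ => by ring
    simp [nilMat, Matrix.mul_apply] at this ⊢
    rw [this]
    ring
  · simp [nilMat, Matrix.mul_apply]
  · simp [nilMat, Matrix.mul_apply]
  · simp [nilMat, Matrix.mul_apply]
  · simp [nilMat, Matrix.mul_apply]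

/-! ### Transitive subalgebras of `𝔰𝔲(n,1)` -/

/-- `g` is a subalgebra of `𝔰𝔲(n,1)` that is transitive at the base point. -/
structure IsTransitiveSubalgebra {k : ℕ} (g : Submodule ℝ (Mat k)) : Prop where
  le_su : g ≤ su k
  lie_mem : ∀ A ∈ g, ∀ B ∈ g, ⁅A, B⁆ ∈ g
  -- Equal hermitian parts mean equal velocities at the base point, since the isotropy algebra there
  -- is the skew-hermitian part; see `generator_conj_eq_zero_iff`.
  transitive : ∀ A ∈ su k, ∃ D ∈ g, D + Dᴴ = A + Aᴴ

/-- `x` is a unitary matrix that preserves the hermitian product. -/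
structure IsCompactUnitary {k : ℕ} (x : Mat k) : Prop where
  unitary : xᴴ * x = 1
  commute : x * hermMatrix k = hermMatrix k * x

namespace IsCompactUnitary

variable {k : ℕ} {x : Mat k}

theorem mul_conjTranspose (hx : IsCompactUnitary x) : x * xᴴ = 1 :=
  mul_eq_one_comm.1 hx.unitary

theorem isUnitaryHerm (hx : IsCompactUnitary x) : IsUnitaryHerm x := by
  rw [IsUnitaryHerm, mul_assoc, ← hx.commute, ← mul_assoc, hx.unitary, one_mul]

theorem inv_eq (hx : IsCompactUnitary x) : x⁻¹ = xᴴ := Matrix.inv_eq_left_inv hx.unitary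

theorem conjTranspose (hx : IsCompactUnitary x) : IsCompactUnitary xᴴ := by
  refine ⟨by rw [Matrix.conjTranspose_conjTranspose, hx.mul_conjTranspose], ?_⟩
  have := congrArg Matrix.conjTranspose hx.commute
  rw [Matrix.conjTranspose_mul, Matrix.conjTranspose_mul, hermMatrix_conjTranspose] at this
  exact this.symm

theorem mul {y : Mat k} (hx : IsCompactUnitary x) (hy : IsCompactUnitary y) :
    IsCompactUnitary (x * y) := by
  refine ⟨?_, by rw [mul_assoc, hy.commute, ← mul_assoc, hx.commute, mul_assoc]⟩
  rw [Matrix.conjTranspose_mul, mul_assoc, ← mul_assoc _ x, hx.unitary, one_mul, hy.unitary]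

theorem of_hermMatrix (k : ℕ) : IsCompactUnitary (hermMatrix k) :=
  ⟨by rw [hermMatrix_conjTranspose, hermMatrix_mul_self], rfl⟩

theorem conj_mem_su (hx : IsCompactUnitary x) {A : Mat k} (hA : A ∈ su k) :
    x * A * xᴴ ∈ su k := by
  rw [← hx.inv_eq]; exact hx.isUnitaryHerm.conj_mem_su hA

theorem conj_conj (hx : IsCompactUnitary x) (A : Mat k) : x * (xᴴ * A * x) * xᴴ = A := by
  rw [mul_assoc xᴴ, ← mul_assoc x, hx.mul_conjTranspose, one_mul, mul_assoc,
    hx.mul_conjTranspose, mul_one]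

theorem conj_lie (hx : IsCompactUnitary x) (A B : Mat k) :
    x * ⁅A, B⁆ * xᴴ = ⁅x * A * xᴴ, x * B * xᴴ⁆ := by
  have h : ∀ A B : Mat k, x * A * xᴴ * (x * B * xᴴ) = x * (A * B) * xᴴ := by
    intro A B
    rw [mul_assoc (x * A), ← mul_assoc xᴴ, ← mul_assoc xᴴ, hx.unitary, one_mul]
    simp only [mul_assoc]
  rw [Ring.lie_def, Ring.lie_def, h, h, mul_sub, sub_mul]

end IsCompactUnitary

/-- The subspace of the `A` such that `x A xᴴ` is in `g`. -/
def conjBy {k : ℕ} (g : Submodule ℝ (Mat k)) (x : Mat k) : Submodule ℝ (Mat k) where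
  carrier := {A | x * A * xᴴ ∈ g}
  zero_mem' := by simp
  add_mem' := by
    intro A B hA hB
    change x * (A + B) * xᴴ ∈ g
    rw [mul_add, add_mul]
    exact g.add_mem hA hB
  smul_mem' := by
    intro c A hA
    change x * (c • A) * xᴴ ∈ g
    rw [mul_smul_comm, smul_mul_assoc]
    exact g.smul_mem c hA

theorem mem_conjBy {k : ℕ} {g : Submodule ℝ (Mat k)} {x A : Mat k} :
    A ∈ conjBy g x ↔ x * A * xᴴ ∈ g := Iff.rfl

theorem conjBy_conjBy {k : ℕ} (g : Submodule ℝ (Mat k)) (x y : Mat k) :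
    conjBy (conjBy g x) y = conjBy g (x * y) := by
  ext A
  simp only [mem_conjBy, Matrix.conjTranspose_mul, mul_assoc]

theorem IsTransitiveSubalgebra.conjBy {k : ℕ} {g : Submodule ℝ (Mat k)}
    (hg : IsTransitiveSubalgebra g) {x : Mat k} (hx : IsCompactUnitary x) :
    IsTransitiveSubalgebra (conjBy g x) := by
  refine ⟨?_, ?_, ?_⟩
  · intro A hA
    have := hx.conjTranspose.conj_mem_su (hg.le_su (mem_conjBy.1 hA))
    rw [Matrix.conjTranspose_conjTranspose] at this
    have h2 := hx.conjTranspose.conj_conj A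
    rw [Matrix.conjTranspose_conjTranspose] at h2
    rwa [h2] at this
  · intro A hA B hB
    rw [mem_conjBy, hx.conj_lie]
    exact hg.lie_mem _ hA _ hB
  · intro A hA
    obtain ⟨D, hD, h⟩ := hg.transitive _ (hx.conj_mem_su hA)
    refine ⟨xᴴ * D * x, ?_, ?_⟩
    · rwa [mem_conjBy, hx.conj_conj]
    · have h2 := hx.conjTranspose.conj_conj (A + Aᴴ)
      rw [Matrix.conjTranspose_conjTranspose] at h2
      have h3 : (x * A * xᴴ)ᴴ = x * Aᴴ * xᴴ := by
        simp [Matrix.conjTranspose_mul, mul_assoc]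
      have h4 : (xᴴ * D * x)ᴴ = xᴴ * Dᴴ * x := by
        simp [Matrix.conjTranspose_mul, mul_assoc]
      rw [h3, ← add_mul, ← mul_add] at h
      rw [h4, ← add_mul, ← mul_add, h, h2]

/-- Applying `ad (A0 k)` one to four times gives combinations with powers of the distinct
eigenvalues `1, 2, -1, -2`. The numerical factors in the proof invert this Vandermonde system. -/
theorem graded_mem {k : ℕ} {g : Submodule ℝ (Mat k)} (hgr : ∀ A ∈ g, ⁅A0 k, A⁆ ∈ g)
    {U : Matrix (Fin k) (Fin k) ℂ} {c t b d : ℝ} {v w : Fin k → ℂ}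
    (hA : compactMat U c + t • A0 k + nilMat v 0 + nilMat 0 b + (nilMat w 0)ᴴ + (nilMat 0 d)ᴴ ∈ g) :
    nilMat v 0 ∈ g ∧ nilMat 0 b ∈ g ∧ (nilMat w 0)ᴴ ∈ g ∧ (nilMat 0 d)ᴴ ∈ g ∧
      compactMat U c + t • A0 k ∈ g := by
  have e2 : ∀ b : ℝ, ⁅A0 k, (nilMat 0 b : Mat k)⁆ = (2 : ℝ) • nilMat 0 b := by
    intro b
    rw [lie_A0_nilMat, ← nilMat_smul, smul_zero]
  have e1 : ∀ v : Fin k → ℂ, ⁅A0 k, nilMat v 0⁆ = nilMat v 0 := by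
    intro v
    rw [lie_A0_nilMat, mul_zero]
  have h1 := hgr _ hA
  have h2 := hgr _ h1
  have h3 := hgr _ h2
  have h4 := hgr _ h3
  simp only [lie_add, lie_smul, lie_neg, lie_A0_compactMat, lie_self, e1, e2, lie_A0_conjTranspose,
    Matrix.conjTranspose_smul, star_trivial, smul_zero, zero_add, add_zero, smul_neg,
    neg_neg] at h1 h2 h3 h4
  have k2 : nilMat 0 b ∈ g := by
    have := g.smul_mem (1 / 24 : ℝ) (g.add_mem (g.smul_mem (2 : ℝ) (g.sub_mem h3 h1))
      (g.sub_mem h4 h2))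
    convert this using 1
    module
  have k2' : (nilMat 0 d)ᴴ ∈ g := by
    have := g.smul_mem (1 / 24 : ℝ) (g.sub_mem (g.sub_mem h4 h2)
      (g.smul_mem (2 : ℝ) (g.sub_mem h3 h1)))
    convert this using 1
    module
  have k1 : nilMat v 0 ∈ g := by
    have := g.smul_mem (1 / 2 : ℝ) (g.sub_mem (g.sub_mem (g.add_mem h1 h2)
      (g.smul_mem (6 : ℝ) k2)) (g.smul_mem (2 : ℝ) k2'))
    convert this using 1
    module
  have k1' : (nilMat w 0)ᴴ ∈ g := by
    have := g.smul_mem (1 / 2 : ℝ) (g.sub_mem (g.sub_mem (g.sub_mem h2 h1)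
      (g.smul_mem (2 : ℝ) k2)) (g.smul_mem (6 : ℝ) k2'))
    convert this using 1
    module
  refine ⟨k1, k2, k1', k2', ?_⟩
  have := g.sub_mem (g.sub_mem (g.sub_mem (g.sub_mem hA k1) k2) k1') k2'
  convert this using 1
  module

theorem nilMat_add_conjTranspose_inj {k : ℕ} {U : Matrix (Fin k) (Fin k) ℂ} (hU : Uᴴ = -U)
    {c t b d : ℝ} {v w v' : Fin k → ℂ} {b' : ℝ} {D : Mat k}
    (hD : D = compactMat U c + t • A0 k + nilMat v 0 + nilMat 0 b + (nilMat w 0)ᴴ + (nilMat 0 d)ᴴ)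
    (h : D + Dᴴ = nilMat v' b' + (nilMat v' b')ᴴ) : v + w = v' ∧ b + d = b' := by
  have hD' : D + Dᴴ = (2 * t) • A0 k + nilMat (v + w) (b + d) + (nilMat (v + w) (b + d))ᴴ := by
    rw [nilMat_split (v + w)]
    have e1 : nilMat (v + w) 0 = nilMat v 0 + nilMat w 0 := by rw [← nilMat_add, add_zero]
    have e2 : (nilMat 0 (b + d) : Mat k) = nilMat 0 b + nilMat 0 d := by
      rw [← nilMat_add, add_zero]
    rw [e1, e2, hD]
    simp only [Matrix.conjTranspose_add, compactMat_conjTranspose hU, Matrix.conjTranspose_smul,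
      A0_conjTranspose, Matrix.conjTranspose_conjTranspose, star_trivial]
    module
  rw [hD'] at h
  constructor
  · funext i
    have := congrFun (congrFun h (Sum.inl i)) (Sum.inr 1)
    simpa [nilMat, A0] using this
  · have := congrFun (congrFun h (Sum.inr 0)) (Sum.inr 1)
    have := congrArg Complex.im this
    simpa [nilMat, A0] using this

theorem ip_A0_A0 (k : ℕ) : ip (A0 k) (A0 k) = 2 := by
  rw [ip_self]
  simp [A0]
  norm_num

/-- Transitivity provides an element of `g` with the hermitian part of `nilMat v' b'`. Opposite root
spaces contribute to the same hermitian part, so only the sums `v + w` and `b + d` are prescribed.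
-/
theorem exists_graded_parts {k : ℕ} {g : Submodule ℝ (Mat k)} (hg : IsTransitiveSubalgebra g)
    (hgr : ∀ A ∈ g, ⁅A0 k, A⁆ ∈ g) (v' : Fin k → ℂ) (b' : ℝ) :
    ∃ v w b d, v + w = v' ∧ b + d = b' ∧ nilMat v 0 ∈ g ∧ nilMat 0 b ∈ g ∧ (nilMat w 0)ᴴ ∈ g ∧
      (nilMat 0 d)ᴴ ∈ g := by
  obtain ⟨D, hD, h⟩ := hg.transitive _ (nilMat_mem_su v' b')
  obtain ⟨U, c, t, v, b, w, d, hU, -, hDec⟩ := exists_decomposition_of_mem_su (hg.le_su hD)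
  obtain ⟨h1, h2⟩ := nilMat_add_conjTranspose_inj hU hDec h
  rw [hDec] at hD
  obtain ⟨a1, a2, a3, a4, -⟩ := graded_mem hgr hD
  exact ⟨v, w, b, d, h1, h2, a1, a2, a3, a4⟩

theorem nilMat_center_smul {k : ℕ} (b : ℝ) :
    (nilMat 0 b : Mat k) = b • nilMat 0 1 := by
  rw [← nilMat_smul, smul_zero, mul_one]

/-- The root spaces for `±2` are lines, and the two components supplied by transitivity add up to
`1`, so one of them is nonzero. -/
theorem center_mem_or {k : ℕ} {g : Submodule ℝ (Mat k)} (hg : IsTransitiveSubalgebra g)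
    (hgr : ∀ A ∈ g, ⁅A0 k, A⁆ ∈ g) : nilMat 0 1 ∈ g ∨ (nilMat 0 1)ᴴ ∈ g := by
  obtain ⟨v, w, b, d, -, h, -, hb, -, hd⟩ := exists_graded_parts hg hgr 0 1
  by_cases hb0 : b = 0
  · right
    have : d = 1 := by linarith
    rwa [this] at hd
  · left
    have := g.smul_mem b⁻¹ hb
    rwa [nilMat_center_smul, smul_smul, inv_mul_cancel₀ hb0, one_smul] at this

/-- Orthogonality of brackets to `A0 k` forbids a pair of opposite root vectors in `g`. Once the
centre of `𝔫` is present, this removes all negative roots, and transitivity must then be achieved by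
the positive ones alone. -/
theorem nil_le_of_center_mem {k : ℕ} {g : Submodule ℝ (Mat k)} (hg : IsTransitiveSubalgebra g)
    (hgr : ∀ A ∈ g, ⁅A0 k, A⁆ ∈ g) (horth : ∀ A ∈ g, ∀ B ∈ g, ip ⁅A, B⁆ (A0 k) = 0)
    (hZ : nilMat 0 1 ∈ g) :
    nilPart k ≤ g ∧ g ≤ (compactPart k ⊔ Submodule.span ℝ {A0 k}) ⊔ nilPart k := by
  have hd0 : ∀ d : ℝ, (nilMat 0 d : Mat k)ᴴ ∈ g → d = 0 := by
    intro d hd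
    have := horth _ hZ _ hd
    rw [nilMat_center_smul d, Matrix.conjTranspose_smul, lie_smul, lie_nilMat_center, map_smul,
      LinearMap.smul_apply, ip_A0_A0] at this
    simpa using this
  -- Bracketing the centre with `(nilMat w 0)ᴴ` produces `nilMat (Complex.I • w) 0`; lowering this
  -- twice by `(nilMat w 0)ᴴ` produces its own conjugate transpose, up to the factor `3 |w|²`. That
  -- opposite pair has bracket `|w|² A₀`.
  have hw0 : ∀ w : Fin k → ℂ, (nilMat w 0)ᴴ ∈ g → w = 0 := by
    intro w hw
    by_contra hne
    have hr : 0 < ∑ i, Complex.normSq (w i) := by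
      obtain ⟨i, hi⟩ := Function.ne_iff.1 hne
      exact Finset.sum_pos' (fun i _ => Complex.normSq_nonneg _)
        ⟨i, Finset.mem_univ i, Complex.normSq_pos.2 hi⟩
    have h1 : nilMat (Complex.I • w) 0 ∈ g := by
      rw [← lie_nilMat_center_neg]; exact hg.lie_mem _ hZ _ hw
    have h2 := hg.lie_mem _ (hg.lie_mem _ h1 _ hw) _ hw
    rw [lie_lie_nilMat_neg, g.smul_mem_iff (by positivity)] at h2
    have h3 := horth _ h1 _ h2
    rw [lie_nilMat_neg_self, map_smul, LinearMap.smul_apply, ip_A0_A0] at h3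
    have h4 : ∑ i, Complex.normSq ((Complex.I • w) i) = ∑ i, Complex.normSq (w i) := by
      simp
    rw [h4] at h3
    simp at h3
    exact hr.ne' h3
  constructor
  · rintro _ ⟨v', b', rfl⟩
    obtain ⟨v, w, b, d, h1, h2, hv, hb, hw, hd⟩ := exists_graded_parts hg hgr v' b'
    rw [hw0 w hw, add_zero] at h1
    rw [hd0 d hd, add_zero] at h2
    subst h1 h2
    rw [nilMat_split]
    exact g.add_mem hv hb
  · intro A hA
    obtain ⟨U, c, t, v, b, w, d, hU, ht, hDec⟩ := exists_decomposition_of_mem_su (hg.le_su hA)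
    rw [hDec] at hA
    obtain ⟨-, -, hw, hd, -⟩ := graded_mem hgr hA
    rw [hDec, hw0 w hw, hd0 d hd]
    have h0 : (nilMat 0 0 : Mat k)ᴴ = 0 := by
      rw [nilMat_center_smul, zero_smul, Matrix.conjTranspose_zero]
    rw [h0, add_zero, add_zero, add_assoc]
    exact Submodule.add_mem_sup (Submodule.add_mem_sup ⟨U, c, hU, ht, rfl⟩
      (Submodule.smul_mem _ _ (Submodule.mem_span_singleton_self _)))
      (Submodule.add_mem _ ⟨v, 0, rfl⟩ ⟨0, b, rfl⟩)

/-! ### Rotating a direction to `A₀` -/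

/-- The base vector `(0, …, 0, -1, 1)`. -/
abbrev baseVec (k : ℕ) : Idx k → ℂ := lift (basePoint k)

/-- The hermitian elements of `𝔰𝔲(n,1)` form the complement of the isotropy algebra of the base
point, so the velocity there determines them. -/
theorem eq_zero_of_mulVec_baseVec {k : ℕ} {ξ : Mat k} (hξ : ξ ∈ su k) (hh : ξᴴ = ξ)
    (h0 : ξ *ᵥ baseVec k = 0) : ξ = 0 := by
  have hs := swap_apply_of_mem_su hξ
  have hc : ∀ i j, conj (ξ j i) = ξ i j := fun i j => congrFun (congrFun hh i) j
  simp only [hc] at hs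
  have ho : ∀ i, ξ i (Sum.inr 1) = ξ i (Sum.inr 0) := by
    intro i
    have := congrFun h0 i
    simp [Matrix.mulVec, dotProduct, lift, basePoint] at this
    linear_combination this
  have h11 : ∀ i j, ξ (Sum.inl i) (Sum.inl j) = 0 := by
    intro i j
    have := hs (Sum.inl i) (Sum.inl j)
    simp only [Sum.map_inl, id] at this
    exact self_eq_neg.1 this
  have h10 : ∀ i, ξ (Sum.inl i) (Sum.inr 0) = 0 := by
    intro i
    have := hs (Sum.inl i) (Sum.inr 0)
    simp only [Sum.map_inl, id, Sum.map_inr, Equiv.swap_apply_left, ho] at this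
    exact self_eq_neg.1 this
  have h11' : ∀ i, ξ (Sum.inl i) (Sum.inr 1) = 0 := fun i => by rw [ho, h10]
  have h01 : ∀ i, ξ (Sum.inr 0) (Sum.inl i) = 0 := fun i => by rw [← hc, h10, map_zero]
  have h01' : ∀ i, ξ (Sum.inr 1) (Sum.inl i) = 0 := fun i => by rw [← hc, h11', map_zero]
  have a1 := hs (Sum.inr 0) (Sum.inr 1)
  have a2 := ho (Sum.inr 0)
  have a3 := ho (Sum.inr 1)
  have a4 := hc (Sum.inr 0) (Sum.inr 0)
  have a5 := hc (Sum.inr 0) (Sum.inr 1)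
  simp only [Sum.map_inr, Equiv.swap_apply_left, Equiv.swap_apply_right] at a1
  have b1 : ξ (Sum.inr 0) (Sum.inr 0) = 0 := by
    rw [a2] at a1 a5
    rw [a1, map_neg, a4] at a5
    exact self_eq_neg.1 a5.symm
  have b2 : ξ (Sum.inr 1) (Sum.inr 0) = 0 := by rw [a1, a2, b1, neg_zero]
  ext i j
  rcases i with i | i <;> rcases j with j | j <;>
      [skip; fin_cases j; fin_cases i; (fin_cases i <;> fin_cases j)]
  · exact h11 i j
  · exact h10 i
  · exact h11' i
  · exact h01 j
  · exact h01' j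
  · exact b1
  · exact a2.trans b1
  · exact b2
  · exact a3.trans b2

theorem hermMatrix_mulVec_baseVec (k : ℕ) : hermMatrix k *ᵥ baseVec k = -baseVec k := by
  rw [hermMatrix_mulVec]
  funext i
  rcases i with i | i
  · simp [lift, basePoint]
  · fin_cases i <;> simp [lift, basePoint]

/-- The witness is the complex reflection `1 - s⁻¹ w w*` with `w = e - u` and `s = w* e`. It is
unitary because equal norms give `w* w = s + conj s`. It fixes the base vector and commutes with the
Gram matrix because `w` lies in the `+1` eigenspace of the latter and the base vector in the `-1`
eigenspace. -/
theorem exists_rotation {k : ℕ} {e u : Idx k → ℂ} (he : hermMatrix k *ᵥ e = e)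
    (hu : hermMatrix k *ᵥ u = u) (hnorm : star e ⬝ᵥ e = star u ⬝ᵥ u) :
    ∃ x : Mat k, IsCompactUnitary x ∧ xᴴ *ᵥ baseVec k = baseVec k ∧ x *ᵥ e = u := by
  set w := e - u with hw
  have hHw : hermMatrix k *ᵥ w = w := by rw [hw, Matrix.mulVec_sub, he, hu]
  have hstarH : star w ᵥ* hermMatrix k = star w := by
    rw [← hermMatrix_conjTranspose, ← Matrix.star_mulVec, hHw]
  have hwo : star w ⬝ᵥ baseVec k = 0 := by
    have h1 : star w ⬝ᵥ (hermMatrix k *ᵥ baseVec k) = star w ⬝ᵥ baseVec k := by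
      rw [Matrix.dotProduct_mulVec, hstarH]
    rw [hermMatrix_mulVec_baseVec, dotProduct_neg] at h1
    exact self_eq_neg.1 h1.symm
  set s : ℂ := star w ⬝ᵥ e with hs
  set W : Mat k := Matrix.vecMulVec w (star w) with hW
  have hWH : Wᴴ = W := by simp [hW, Matrix.conjTranspose_vecMulVec]
  have hWW : W * W = (star w ⬝ᵥ w) • W := by
    rw [hW, Matrix.vecMulVec_mul_vecMulVec]
    ext i j
    simp [Matrix.vecMulVec]
    ring
  have hWv : ∀ v, W *ᵥ v = (star w ⬝ᵥ v) • w := by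
    intro v
    rw [hW, Matrix.vecMulVec_mulVec]
    ext i
    simp [mul_comm]
  have hsw : star w ⬝ᵥ w = s + conj s := by
    have h1 : conj s = star e ⬝ᵥ w := by
      rw [hs, ← Complex.star_def, Matrix.star_dotProduct, star_star]
    have h3 : star w ⬝ᵥ w = star w ⬝ᵥ e - star w ⬝ᵥ u := by
      rw [← dotProduct_sub]
    have h4 : star w ⬝ᵥ u = star e ⬝ᵥ u - star u ⬝ᵥ u := by
      rw [hw, star_sub, sub_dotProduct]
    have h5 : star e ⬝ᵥ w = star e ⬝ᵥ e - star e ⬝ᵥ u := by rw [hw, dotProduct_sub]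
    rw [h3, h4, h1, h5, hnorm]
    ring
  refine ⟨1 - s⁻¹ • W, ⟨?_, ?_⟩, ?_, ?_⟩
  · rw [Matrix.conjTranspose_sub, Matrix.conjTranspose_one, Matrix.conjTranspose_smul, hWH, sub_mul,
      one_mul, mul_sub, mul_one, smul_mul_smul_comm, hWW, smul_smul, hsw]
    have : star s⁻¹ * s⁻¹ * (s + conj s) = s⁻¹ + star s⁻¹ := by
      rw [Complex.star_def, map_inv₀]
      by_cases h0 : s = 0
      · simp [h0]
      · have h0' : conj s ≠ 0 := by simpa using h0
        field_simp
        ring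
    rw [this]
    module
  · have h1 : W * hermMatrix k = W := by rw [hW, Matrix.vecMulVec_mul, hstarH]
    have h2 : hermMatrix k * W = W := by rw [hW, Matrix.mul_vecMulVec, hHw]
    rw [sub_mul, mul_sub, smul_mul_assoc, mul_smul_comm, h1, h2, one_mul, mul_one]
  · rw [Matrix.conjTranspose_sub, Matrix.conjTranspose_one, Matrix.conjTranspose_smul, hWH,
      Matrix.sub_mulVec, Matrix.one_mulVec, Matrix.smul_mulVec, hWv, hwo, zero_smul, smul_zero,
      sub_zero]
  · rw [Matrix.sub_mulVec, Matrix.one_mulVec, Matrix.smul_mulVec, hWv, ← hs, smul_smul]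
    -- For `s = 0` the inverse is `0` by convention and the reflection degenerates to the identity;
    -- then `w* w = 0`, so `e = u`.
    by_cases h0 : s = 0
    · have hww : star w ⬝ᵥ w = 0 := by rw [hsw, h0]; simp
      have : w = 0 := by
        open scoped ComplexOrder in exact dotProduct_star_self_eq_zero.1 hww
      rw [this, smul_zero, sub_zero]
      exact sub_eq_zero.1 this
    · rw [inv_mul_cancel₀ h0, one_smul, hw]
      abel

/-- Rank one: the stabilizer of the base vector is transitive on spheres in the `+1` eigenspace of
the Gram matrix, and a hermitian element is known once its image of the base vector is. -/
theorem exists_conj_A0 {k : ℕ} {ξ : Mat k} (hξ : ξ ∈ su k) (hh : ξᴴ = ξ) (hne : ξ ≠ 0) :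
    ∃ (x : Mat k) (c : ℝ), IsCompactUnitary x ∧ c ≠ 0 ∧ x * A0 k * xᴴ = c • ξ := by
  set e : Idx k → ℂ := A0 k *ᵥ baseVec k with he
  have hHA : ∀ A ∈ su k, Aᴴ = A → hermMatrix k *ᵥ (A *ᵥ baseVec k) = A *ᵥ baseVec k := by
    intro A hA hAh
    rw [Matrix.mulVec_mulVec, hermMatrix_mul_of_mem_su hA, hAh, Matrix.neg_mulVec,
      ← Matrix.mulVec_mulVec, hermMatrix_mulVec_baseVec, Matrix.mulVec_neg, neg_neg]
  have hu0 : ξ *ᵥ baseVec k ≠ 0 := fun h => hne (eq_zero_of_mulVec_baseVec hξ hh h)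
  set r : ℝ := ∑ i, Complex.normSq ((ξ *ᵥ baseVec k) i) with hr
  have hr0 : 0 < r := by
    obtain ⟨i, hi⟩ := Function.ne_iff.1 hu0
    exact Finset.sum_pos' (fun i _ => Complex.normSq_nonneg _)
      ⟨i, Finset.mem_univ i, Complex.normSq_pos.2 hi⟩
  -- `A0 k` sends the base vector to a vector of squared norm `2`, and `c • ξ` is scaled to match.
  set c : ℝ := Real.sqrt (2 / r) with hc
  have hc0 : 0 < c := Real.sqrt_pos.2 (by positivity)
  have hcc : c * c = 2 / r := Real.mul_self_sqrt (by positivity)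
  have hcξ : c • ξ ∈ su k := (su k).smul_mem c hξ
  have hcξh : (c • ξ)ᴴ = c • ξ := by rw [Matrix.conjTranspose_smul, hh, star_trivial]
  have hself : ∀ v : Idx k → ℂ, star v ⬝ᵥ v = ((∑ i, Complex.normSq (v i) : ℝ) : ℂ) := by
    intro v
    simp [dotProduct, Complex.normSq_eq_conj_mul_self]
  obtain ⟨x, hx, hxo, hxe⟩ := exists_rotation (hHA _ (A0_mem_su k) (A0_conjTranspose k))
    (hHA _ hcξ hcξh) (by
      rw [hself, hself]
      congr 1
      have h1 : ∑ i, Complex.normSq ((A0 k *ᵥ baseVec k) i) = 2 := by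
        simp [A0, Matrix.mulVec, dotProduct, lift, basePoint]
        norm_num
      have h2 : ∀ i, Complex.normSq (((c • ξ) *ᵥ baseVec k) i) =
          c * c * Complex.normSq ((ξ *ᵥ baseVec k) i) := by
        intro i
        rw [Matrix.smul_mulVec, Pi.smul_apply, Complex.real_smul, Complex.normSq_mul,
          Complex.normSq_ofReal]
      rw [h1]
      simp only [h2]
      rw [← Finset.mul_sum, hcc, ← hr, div_mul_cancel₀ _ hr0.ne'])
  refine ⟨x, c, hx, hc0.ne', ?_⟩
  rw [← sub_eq_zero]
  apply eq_zero_of_mulVec_baseVec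
  · exact (su k).sub_mem (hx.conj_mem_su (A0_mem_su k)) hcξ
  · rw [Matrix.conjTranspose_sub, hcξh]
    simp [Matrix.conjTranspose_mul, A0_conjTranspose, mul_assoc]
  · rw [Matrix.sub_mulVec, ← Matrix.mulVec_mulVec, ← Matrix.mulVec_mulVec, hxo, hxe, sub_self]

/-- A transitive subalgebra of `𝔰𝔲(n,1)` contains all hermitian elements, or it is conjugate to
a subalgebra of `𝔰(𝔲(n-1) + 𝔲(1)) + 𝔞 + 𝔫` that contains `𝔫`. -/
theorem IsTransitiveSubalgebra.classification {k : ℕ} {g : Submodule ℝ (Mat k)}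
    (hg : IsTransitiveSubalgebra g) :
    (∀ A ∈ su k, Aᴴ = A → A ∈ g) ∨
    ∃ x : Mat k, IsCompactUnitary x ∧ nilPart k ≤ CHn.conjBy g x ∧
      CHn.conjBy g x ≤ (compactPart k ⊔ Submodule.span ℝ {A0 k}) ⊔ nilPart k := by
  obtain ⟨ξ, hξh, hξsu, horth, hnorm⟩ := exists_mean_curvature g hg.lie_mem
  replace hξsu := hξsu hg.le_su
  -- For `ξ = 0` the criterion of `exists_mean_curvature` is vacuous, so `D + Dᴴ` normalizes `g` for
  -- all `D` in `g`; by transitivity every hermitian element does.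
  by_cases hξ0 : ξ = 0
  · left
    intro Y hY hYh
    by_cases hY0 : Y = 0
    · rw [hY0]; exact g.zero_mem
    obtain ⟨x, c, hx, hc, hxY⟩ := exists_conj_A0 hY hYh hY0
    have hg' := hg.conjBy hx
    have hN : ∀ B ∈ su k, Bᴴ = B → ∀ A ∈ CHn.conjBy g x, ⁅B, A⁆ ∈ CHn.conjBy g x := by
      intro B hB hBh A hA
      rw [mem_conjBy, hx.conj_lie]
      obtain ⟨D, hD, hDe⟩ := hg.transitive _ (hx.conj_mem_su hB)
      have h1 := hnorm D hD (by rw [hξ0, map_zero]) _ hA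
      have h2 : (x * B * xᴴ)ᴴ = x * B * xᴴ := by
        simp [Matrix.conjTranspose_mul, hBh, mul_assoc]
      rw [hDe, h2, ← two_smul ℝ, smul_lie, g.smul_mem_iff two_ne_zero] at h1
      exact h1
    have hgr := hN _ (A0_mem_su k) (A0_conjTranspose k)
    -- `Z + Zᴴ`, with `Z` central in `𝔫`, is hermitian and hence normalizes; its bracket with
    -- whichever of `Z`, `Zᴴ` lies in the algebra is `∓A₀`.
    have hA0 : A0 k ∈ CHn.conjBy g x := by
      have hZ := nilMat_mem_su (0 : Fin k → ℂ) 1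
      have h1 := hN _ ((su k).add_mem hZ (conjTranspose_mem_su hZ)) (by simp [add_comm])
      rcases center_mem_or hg' hgr with h | h
      · have := (CHn.conjBy g x).neg_mem (h1 _ h)
        rwa [add_lie, lie_self, zero_add, lie_skew, lie_nilMat_center] at this
      · have := h1 _ h
        rwa [add_lie, lie_self, add_zero, lie_nilMat_center] at this
    rw [mem_conjBy, hxY, g.smul_mem_iff hc] at hA0
    exact hA0
  · right
    obtain ⟨D, hD, hDe⟩ := hg.transitive ξ hξsu
    rw [hξh, ← two_smul ℝ] at hDe
    -- The criterion applies to a `D` with hermitian part `ξ`: moving `ad ξ` across the inner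
    -- product turns the condition into `⁅ξ, ξ⁆ = 0`.
    have hξg : ∀ A ∈ g, ⁅ξ, A⁆ ∈ g := by
      intro A hA
      have h1 := hnorm D hD (by
        rw [hDe, lie_smul, map_smul, LinearMap.smul_apply, ip_comm, ← lie_skew, map_neg, ip_comm,
          ip_lie, hξh, lie_self]
        simp) A hA
      rw [hDe, smul_lie, g.smul_mem_iff two_ne_zero] at h1
      exact h1
    obtain ⟨x, c, hx, hc, hxξ⟩ := exists_conj_A0 hξsu hξh hξ0
    have hgr : ∀ A ∈ CHn.conjBy g x, ⁅A0 k, A⁆ ∈ CHn.conjBy g x := by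
      intro A hA
      rw [mem_conjBy, hx.conj_lie, hxξ, smul_lie]
      exact g.smul_mem c (hξg _ hA)
    have horth' : ∀ A ∈ CHn.conjBy g x, ∀ B ∈ CHn.conjBy g x, ip ⁅A, B⁆ (A0 k) = 0 := by
      intro A hA B hB
      have h1 := horth _ hA _ hB
      rw [← hx.conj_lie] at h1
      have h2 : ip (x * ⁅A, B⁆ * xᴴ) (x * A0 k * xᴴ) = ip ⁅A, B⁆ (A0 k) := by
        rw [ip_apply, ip_apply]
        simp only [Matrix.conjTranspose_mul, Matrix.conjTranspose_conjTranspose]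
        rw [Matrix.trace_mul_comm, ← mul_assoc, Matrix.trace_mul_comm]
        have e : xᴴ * (x * ((A0 k)ᴴ * xᴴ) * (x * ⁅A, B⁆)) = (A0 k)ᴴ * (xᴴ * x) * ⁅A, B⁆ := by
          rw [← mul_assoc, ← mul_assoc, ← mul_assoc xᴴ x, hx.unitary, one_mul, mul_assoc _ xᴴ x,
            hx.unitary]
        rw [e, hx.unitary, mul_one, Matrix.trace_mul_comm]
      rw [← h2, hxξ, map_smul, h1, smul_zero]
    have hg' := hg.conjBy hx
    rcases center_mem_or hg' hgr with h | h
    · exact ⟨x, hx, nil_le_of_center_mem hg' hgr horth' h⟩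
    -- Only the opposite root vector is available: conjugation by the Gram matrix, `A ↦ -Aᴴ` on
    -- `𝔰𝔲(n,1)`, exchanges the signs of the roots and reduces to the other case.
    · have hH := IsCompactUnitary.of_hermMatrix k
      refine ⟨x * hermMatrix k, hx.mul hH, ?_⟩
      rw [← conjBy_conjBy]
      have hHA : ∀ A ∈ su k, hermMatrix k * A * (hermMatrix k)ᴴ = -Aᴴ := by
        intro A hA
        rw [hermMatrix_conjTranspose, conj_hermMatrix_of_mem_su hA]
      refine nil_le_of_center_mem (hg'.conjBy hH) ?_ ?_ ?_
      · intro A hA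
        rw [mem_conjBy, hH.conj_lie, hHA _ (A0_mem_su k), A0_conjTranspose, neg_lie]
        exact Submodule.neg_mem _ (hgr _ hA)
      · intro A hA B hB
        have h1 := horth' _ hA _ hB
        have hA' := (hg'.conjBy hH).le_su hA
        have hB' := (hg'.conjBy hH).le_su hB
        rw [hHA _ hA', hHA _ hB', neg_lie, lie_neg, neg_neg] at h1
        have h2 : ⁅Aᴴ, Bᴴ⁆ = -⁅A, B⁆ᴴ := by
          rw [Ring.lie_def, Ring.lie_def, Matrix.conjTranspose_sub, Matrix.conjTranspose_mul,
            Matrix.conjTranspose_mul]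
          abel
        have h3 : ip ⁅A, B⁆ᴴ (A0 k) = ip ⁅A, B⁆ (A0 k) := by
          rw [ip_comm, ip_apply, ip_apply, Matrix.conjTranspose_conjTranspose, A0_conjTranspose,
            Matrix.trace_mul_comm]
        rw [h2, map_neg, LinearMap.neg_apply, h3, neg_eq_zero] at h1
        exact h1
      · rw [mem_conjBy, hHA _ (nilMat_mem_su _ _)]
        exact Submodule.neg_mem _ h

/-! ### Transitivity -/

/-- The group of `𝔞 + 𝔫` is already transitive on the Siegel domain: `x` is the dilation by `s`
followed by the Heisenberg translation with parameters `p.1` and `p.2.im`. Comparing `herm` of the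
base vector, which is `-2`, with that of `lift p` fixes `s² = -herm (lift p) (lift p) / 2`. -/
theorem exists_isUnitaryHerm_baseVec {k : ℕ} {p : E k} (hp : p ∈ CH k) :
    ∃ (x : Mat k) (c : ℂ), IsUnitaryHerm x ∧ c ≠ 0 ∧ x *ᵥ baseVec k = c • lift p := by
  have hp' : (herm (lift p) (lift p)).re < 0 := hp
  set q : ℝ := ∑ i, Complex.normSq (p.1 i) with hq
  have hqc : ∑ i, p.1 i * conj (p.1 i) = (q : ℂ) := by
    simp [hq, Complex.mul_conj]
  have hre : (herm (lift p) (lift p)).re = q + 2 * p.2.re := by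
    simp only [herm, lift, Sum.elim_inl, Sum.elim_inr, hqc]
    simp
    ring
  set r : ℝ := -(q / 2 + p.2.re) with hr
  have hr0 : 0 < r := by rw [hre] at hp'; rw [hr]; linarith
  set s : ℝ := Real.sqrt r with hs
  have hs0 : 0 < s := Real.sqrt_pos.2 hr0
  have hss : (s : ℂ) * s = r := by rw [← Complex.ofReal_mul, Real.mul_self_sqrt hr0.le]
  have hsc : (s : ℂ) ≠ 0 := by exact_mod_cast hs0.ne'
  set β : ℂ := ⟨-(q / 2), p.2.im⟩ with hβ
  have hββ : β + conj β = -q := by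
    rw [hβ]; apply Complex.ext <;> simp
    ring
  have hβp : -(r : ℂ) + β = p.2 := by
    rw [hβ, hr]; apply Complex.ext <;> simp
  set x : Mat k := Matrix.fromBlocks 1 (Matrix.of fun i j => if j = 1 then p.1 i / s else 0)
    (Matrix.of fun i j => if i = 0 then -conj (p.1 j) else 0) !![(s : ℂ), β / s; 0, 1 / s] with hx
  have x1 : ∀ X i, (x *ᵥ X) (Sum.inl i) = X (Sum.inl i) + X (Sum.inr 1) / s * p.1 i := by
    intro X i
    simp [hx, Matrix.mulVec, dotProduct, Matrix.one_apply]
    ring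
  have x2 : ∀ X, (x *ᵥ X) (Sum.inr 0) = -(∑ j, X (Sum.inl j) * conj (p.1 j)) + s * X (Sum.inr 0) +
      X (Sum.inr 1) / s * β := by
    intro X
    simp [hx, Matrix.mulVec, dotProduct]
    rw [Finset.sum_congr rfl fun j _ => mul_comm (conj (p.1 j)) (X (Sum.inl j))]
    ring
  have x3 : ∀ X, (x *ᵥ X) (Sum.inr 1) = X (Sum.inr 1) / s := by
    intro X
    simp [hx, Matrix.mulVec, dotProduct]
    ring
  refine ⟨x, (1 / s : ℂ), ?_, by simpa using hsc, ?_⟩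
  · rw [isUnitaryHerm_iff]
    intro X Y
    simp only [herm, x1, x2, x3, map_add, map_mul, map_neg, map_sum, map_div₀, Complex.conj_conj,
      Complex.conj_ofReal]
    have hsum : ∑ i, (X (Sum.inl i) + X (Sum.inr 1) / s * p.1 i) *
        (conj (Y (Sum.inl i)) + conj (Y (Sum.inr 1)) / s * conj (p.1 i)) =
        ∑ i, X (Sum.inl i) * conj (Y (Sum.inl i)) +
        conj (Y (Sum.inr 1)) / s * ∑ i, X (Sum.inl i) * conj (p.1 i) +
        X (Sum.inr 1) / s * ∑ i, conj (Y (Sum.inl i)) * p.1 i +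
        X (Sum.inr 1) / s * (conj (Y (Sum.inr 1)) / s) * q := by
      rw [← hqc, Finset.mul_sum, Finset.mul_sum, Finset.mul_sum, ← Finset.sum_add_distrib,
        ← Finset.sum_add_distrib, ← Finset.sum_add_distrib]
      exact Finset.sum_congr rfl fun i _ => by ring
    rw [hsum]
    have e1 : (s : ℂ) * (s : ℂ)⁻¹ = 1 := mul_inv_cancel₀ hsc
    simp only [div_eq_mul_inv]
    linear_combination (X (Sum.inr 1) * (s : ℂ)⁻¹ * (conj (Y (Sum.inr 1)) * (s : ℂ)⁻¹)) * hββ +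
      (X (Sum.inr 0) * conj (Y (Sum.inr 1)) + X (Sum.inr 1) * conj (Y (Sum.inr 0))) * e1
  · funext i
    have e1 : (s : ℂ) * (s : ℂ)⁻¹ = 1 := mul_inv_cancel₀ hsc
    rcases i with i | i
    · rw [x1]
      simp [lift, basePoint]
    · fin_cases i
      · refine (x2 _).trans ?_
        simp [lift, basePoint, ← hβp]
        rw [← hss]
        linear_combination (s : ℂ) * e1
      · refine (x3 _).trans ?_
        simp [lift, basePoint]

theorem herm_baseVec_right {k : ℕ} (u : Idx k → ℂ) :
    herm u (baseVec k) = u (Sum.inr 0) - u (Sum.inr 1) := by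
  simp [herm, lift, basePoint]
  ring

/-- Orthogonality to the base vector says that the last two coordinates agree, and there the form is
a sum of squares. -/
theorem herm_self_re_pos {k : ℕ} {u : Idx k → ℂ} (h : herm u (baseVec k) = 0) (hu : u ≠ 0) :
    0 < (herm u u).re := by
  rw [herm_baseVec_right, sub_eq_zero] at h
  have h1 : (herm u u).re = ∑ i, Complex.normSq (u (Sum.inl i)) +
      2 * Complex.normSq (u (Sum.inr 1)) := by
    simp only [herm, h, Complex.mul_conj]
    simp
    ring
  rw [h1]
  have a1 : 0 ≤ ∑ i, Complex.normSq (u (Sum.inl i)) :=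
    Finset.sum_nonneg fun i _ => Complex.normSq_nonneg _
  have a2 := Complex.normSq_nonneg (u (Sum.inr 1))
  refine lt_of_le_of_ne (by linarith) fun h2 => hu ?_
  have b1 : ∑ i, Complex.normSq (u (Sum.inl i)) = 0 := by linarith
  have b2 : u (Sum.inr 1) = 0 := Complex.normSq_eq_zero.1 (by linarith)
  rw [Finset.sum_eq_zero_iff_of_nonneg fun i _ => Complex.normSq_nonneg _] at b1
  funext i
  rcases i with i | i
  · exact Complex.normSq_eq_zero.1 (b1 i (Finset.mem_univ i))
  · fin_cases i
    · exact h.trans b2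
    · exact b2

theorem hor_ne_zero {k : ℕ} {p X : E k} (hX : X ≠ 0) : hor p X ≠ 0 := by
  intro h
  apply hX
  rw [← dehom_hor p X, h, map_zero]

/-- An isometry carrying the base line to the line of `lift p` reduces this to `herm_self_re_pos`.
-/
theorem herm_hor_self_re_pos {k : ℕ} {p : E k} (hp : p ∈ CH k) {X : E k} (hX : X ≠ 0) :
    0 < (herm (hor p X) (hor p X)).re := by
  obtain ⟨x, c, hx, hc, hxp⟩ := exists_isUnitaryHerm_baseVec hp
  have h1 : hor p X = x *ᵥ (x⁻¹ *ᵥ hor p X) := by simp [hx.mul_inv]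
  rw [h1, hx.herm_apply]
  apply herm_self_re_pos
  · rw [← hx.herm_apply, ← h1, hxp, herm_smul_right, herm_hor_lift (herm_lift_ne_zero hp), mul_zero]
  · intro h2
    rw [h2, Matrix.mulVec_zero] at h1
    exact hor_ne_zero hX h1

theorem metric_self_pos {k : ℕ} {μ : ℝ} (hμ : 0 < μ) {p : E k} (hp : p ∈ CH k) {X : E k}
    (hX : X ≠ 0) : 0 < metric μ p X X := by
  have hp' : (herm (lift p) (lift p)).re < 0 := hp
  have h1 : metric μ p X X = μ / (-(herm (lift p) (lift p)).re) *
    (herm (hor p X) (hor p X)).re := rfl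
  rw [h1]
  exact mul_pos (div_pos hμ (by linarith)) (herm_hor_self_re_pos hp hX)

theorem metric_symm {k : ℕ} (μ : ℝ) (p X Y : E k) : metric μ p X Y = metric μ p Y X := by
  have h1 : ∀ X Y, metric μ p X Y = μ / (-(herm (lift p) (lift p)).re) *
    (herm (hor p X) (hor p Y)).re := fun _ _ => rfl
  rw [h1, h1, ← herm_conj (hor p Y), Complex.conj_re]

theorem metric_J_J {k : ℕ} (μ : ℝ) (p X Y : E k) : metric μ p (J X) (J Y) = metric μ p X Y := by
  have h1 : ∀ X Y, metric μ p X Y = μ / (-(herm (lift p) (lift p)).re) *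
    (herm (hor p X) (hor p Y)).re := fun _ _ => rfl
  rw [h1, h1, J, J, hor_csmul, hor_csmul, herm_smul_left, herm_smul_right]
  congr 2
  rw [← mul_assoc, Complex.mul_conj]
  simp

theorem eta_self_ne_zero {k : ℕ} {p : E k} (hp : p ∈ CH k) {X : E k} (hX : X ≠ 0) :
    eta p X X ≠ 0 := by
  refine div_ne_zero (fun h => ?_) (herm_lift_ne_zero hp)
  have := herm_hor_self_re_pos hp hX
  rw [h] at this
  simp at this

/-! ### The infinitesimal isometries at a point -/

/-- `generator A p` as a linear function of `A`. -/
def genL {k : ℕ} (p : E k) : Mat k →ₗ[ℝ] E k where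
  toFun A := generator A p
  map_add' A B := by
    simp only [generator_eq_dehom, Matrix.add_mulVec, map_add]
  map_smul' c A := by
    have : c • A = (c : ℂ) • A := by ext i j; simp
    rw [RingHom.id_apply, this, generator_eq_dehom, generator_eq_dehom, Matrix.smul_mulVec, map_smul]
    rfl

theorem genL_apply {k : ℕ} (p : E k) (A : Mat k) : genL p A = generator A p := rfl

/-- `rho` as a bilinear map. -/
def rhoL {k : ℕ} (p : E k) : Mat k →ₗ[ℝ] E k →ₗ[ℝ] E k :=
  LinearMap.mk₂ ℝ (rho p)
    (by
      intro A B V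
      simp only [rho, Matrix.add_mulVec, map_add, herm_add_left, add_div, add_smul]
      abel)
    (by
      intro c A V
      have h1 : c • A = (c : ℂ) • A := by ext i j; simp
      have h2 : c • rho p A V = (c : ℂ) • rho p A V := rfl
      rw [h1, h2, rho, rho, Matrix.smul_mulVec, Matrix.smul_mulVec, map_smul, herm_smul_left]
      module)
    (by
      intro A V W
      simp only [rho, hor_add, Matrix.mulVec_add, map_add, smul_add]
      abel)
    (by
      intro c A V
      have h2 : c • rho p A V = (c : ℂ) • rho p A V := rfl
      have h3 : c • V = (c : ℂ) • V := rfl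
      rw [h2, h3, rho, rho, hor_csmul, Matrix.mulVec_smul, map_smul]
      module)

theorem rhoL_apply {k : ℕ} (p : E k) (A : Mat k) (V : E k) : rhoL p A V = rho p A V := rfl

theorem dehom_hor_decomposition {k : ℕ} {p : E k} (h0 : herm (lift p) (lift p) ≠ 0)
    (u : Idx k → ℂ) :
    u = hor p (dehom p u) + (herm u (lift p) / herm (lift p) (lift p)) • lift p := by
  rw [hor_dehom h0]; abel

theorem exists_eq_smul_of_dehom_eq_zero {k : ℕ} {p : E k} {u : Idx k → ℂ}
    (h : dehom p u = 0) : u = u (Sum.inr 1) • lift p := by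
  have := tlift_dehom p u
  rw [h] at this
  have h0 : tlift (0 : E k) = 0 := by
    have := tlift_csmul (0 : ℂ) (0 : E k)
    rwa [zero_smul, zero_smul] at this
  rw [h0] at this
  exact (sub_eq_zero.1 this.symm)

/-- The metric sees only the real part of the hermitian form; the imaginary part follows on
replacing `X` by `J X`, because `T` commutes with `J`. -/
theorem herm_hor_skew {k : ℕ} {μ : ℝ} (hμ : 0 < μ) {p : E k} (hp : p ∈ CH k) {T : E k →ₗ[ℝ] E k}
    (hTJ : ∀ V, T (J V) = J (T V))
    (hT : ∀ X Y, metric μ p (T X) Y = -metric μ p X (T Y)) (X Y : E k) :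
    herm (hor p (T X)) (hor p Y) = -herm (hor p X) (hor p (T Y)) := by
  have hp' : (herm (lift p) (lift p)).re < 0 := hp
  have hc : μ / (-(herm (lift p) (lift p)).re) ≠ 0 := by
    have : -(herm (lift p) (lift p)).re ≠ 0 := by linarith
    positivity
  have hre : ∀ X Y, (herm (hor p (T X)) (hor p Y)).re = (-herm (hor p X) (hor p (T Y))).re := by
    intro X Y
    have h1 : μ / (-(herm (lift p) (lift p)).re) * (herm (hor p (T X)) (hor p Y)).re =
        -(μ / (-(herm (lift p) (lift p)).re) * (herm (hor p X) (hor p (T Y))).re) := hT X Y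
    rw [Complex.neg_re]
    apply mul_left_cancel₀ hc
    rw [h1]
    ring
  apply Complex.ext
  · exact hre X Y
  · have h2 := hre (J X) Y
    rw [hTJ, J, J, hor_csmul, hor_csmul, herm_smul_left, herm_smul_left] at h2
    simp at h2
    rw [Complex.neg_im, ← h2, neg_neg]

/-- Every pair of a tangent vector and a skew-hermitian endomorphism comes from `𝔰𝔲(n,1)`. -/
theorem exists_mem_su {k : ℕ} {μ : ℝ} (hμ : 0 < μ) {p : E k} (hp : p ∈ CH k) (X : E k)
    {T : E k →ₗ[ℝ] E k} (hTJ : ∀ V, T (J V) = J (T V))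
    (hT : ∀ X Y, metric μ p (T X) Y = -metric μ p X (T Y)) :
    ∃ A ∈ su k, generator A p = X ∧ ∀ V, rho p A V = T V := by
  have h0 := herm_lift_ne_zero hp
  have hskew := herm_hor_skew hμ hp hTJ hT
  have hTc : ∀ (c : ℂ) (V : E k), T (c • V) = c • T V := by
    intro c V
    have h1 : ∀ V : E k, c • V = c.re • V + c.im • J V := by
      intro V
      have h2 : c.re • V + c.im • J V = (c.re : ℂ) • V + (c.im : ℂ) • (Complex.I • V) := rfl
      rw [h2, smul_smul, ← add_smul, Complex.re_add_im]
    rw [h1, map_add, map_smul, map_smul, hTJ, ← h1]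
  -- The first two terms are the skew operator that moves `lift p` to `hor p X`; the last one acts
  -- as `T` on horizontal vectors and kills `lift p`.
  let f : (Idx k → ℂ) →ₗ[ℂ] (Idx k → ℂ) :=
    { toFun := fun u => (herm u (lift p) / herm (lift p) (lift p)) • hor p X -
        (herm u (hor p X) / herm (lift p) (lift p)) • lift p + hor p (T (dehom p u))
      map_add' := by
        intro u u'
        simp only [herm_add_left, map_add, hor_add, add_div, add_smul]
        abel
      map_smul' := by
        intro c u
        simp only [herm_smul_left, map_smul, hTc, hor_csmul, RingHom.id_apply, smul_add, smul_sub,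
          smul_smul, mul_div_assoc] }
  have hf : ∀ u, f u = (herm u (lift p) / herm (lift p) (lift p)) • hor p X -
        (herm u (hor p X) / herm (lift p) (lift p)) • lift p + hor p (T (dehom p u)) :=
    fun u => rfl
  set A : Mat k := LinearMap.toMatrix' f with hA
  have hAf : ∀ u, A *ᵥ u = f u := fun u => LinearMap.toMatrix'_mulVec f u
  have hfskew : ∀ u u', herm (f u) u' = -herm u (f u') := by
    intro u u'
    have e1 : herm (hor p (T (dehom p u))) u' =
        herm (hor p (T (dehom p u))) (hor p (dehom p u')) := by
      conv_lhs => rw [dehom_hor_decomposition h0 u']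
      rw [herm_add_right, herm_smul_right, herm_hor_lift h0, mul_zero, add_zero]
    have e2 : herm u (hor p (T (dehom p u'))) =
        herm (hor p (dehom p u)) (hor p (T (dehom p u'))) := by
      conv_lhs => rw [dehom_hor_decomposition h0 u]
      rw [herm_add_left, herm_smul_left, herm_lift_hor h0, mul_zero, add_zero]
    rw [hf, hf, herm_add_left, herm_sub_left, herm_smul_left, herm_smul_left, herm_add_right,
      herm_sub_right, herm_smul_right, herm_smul_right, e1, e2, hskew, map_div₀, map_div₀,
      conj_herm_self, herm_conj, herm_conj]
    ring
  have hskewA : Aᴴ * hermMatrix k + hermMatrix k * A = 0 := by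
    apply matrix_ext_dotProduct
    intro X Y
    rw [Matrix.add_mulVec, dotProduct_add, ← herm_mulVec_left, ← herm_mulVec_right, hAf, hAf,
      hfskew]
    simp
  have htr : conj A.trace = -A.trace := by
    have h1 : Aᴴ = -(hermMatrix k * A * hermMatrix k) := by
      have h2 := congrArg (fun M => M * hermMatrix k) hskewA
      simp only [add_mul, zero_mul, mul_assoc Aᴴ, hermMatrix_mul_self, mul_one] at h2
      exact eq_neg_of_add_eq_zero_left h2
    rw [← Complex.star_def, ← Matrix.trace_conjTranspose, h1, Matrix.trace_neg,
      Matrix.trace_mul_comm, ← mul_assoc, hermMatrix_mul_self, one_mul]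
  -- The matrix size is `n + 1 = k + 2`. Removing the trace is harmless: a scalar matrix has zero
  -- generator and zero `rho`, and `c` is purely imaginary, so skewness persists.
  set c : ℂ := A.trace / ((k : ℂ) + 2) with hc
  have hcc : conj c = -c := by
    rw [hc, map_div₀, htr, map_add, Complex.conj_natCast, map_ofNat, neg_div]
  have hk : ((k : ℂ) + 2) ≠ 0 := by
    have : ((k + 2 : ℕ) : ℂ) ≠ 0 :=
      Nat.cast_ne_zero.2 (by omega)
    simpa using this
  have hB : ∀ u, (A - c • 1) *ᵥ u = f u - c • u := by
    intro u
    rw [Matrix.sub_mulVec, hAf, Matrix.smul_mulVec, Matrix.one_mulVec]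
  have hfz : f (lift p) = hor p X := by
    rw [hf, div_self h0, one_smul, herm_lift_hor h0, zero_div, zero_smul, dehom_lift, map_zero,
      ← horL_apply, ← horL_apply, map_zero, sub_zero, add_zero]
  refine ⟨A - c • 1, ⟨?_, ?_⟩, ?_, ?_⟩
  · rw [Matrix.conjTranspose_sub, Matrix.conjTranspose_smul, Matrix.conjTranspose_one,
      Complex.star_def, hcc, sub_mul, mul_sub, smul_mul_assoc, mul_smul_comm, one_mul, mul_one,
      ← hskewA]
    module
  · rw [Matrix.trace_sub, Matrix.trace_smul, Matrix.trace_one, hc]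
    simp only [Fintype.card_sum, Fintype.card_fin, smul_eq_mul]
    push_cast
    rw [div_mul_cancel₀ _ hk, sub_self]
  · rw [generator_eq_dehom, hB, map_sub, map_smul, dehom_lift, smul_zero, sub_zero, hfz, dehom_hor]
  · intro V
    rw [rho, hB, hB, hfz, hf, herm_hor_lift h0, zero_div, zero_smul, dehom_hor, herm_sub_left,
      herm_hor_lift h0, herm_smul_left, zero_sub, zero_sub, neg_div, mul_div_assoc, div_self h0,
      mul_one, map_sub, map_add, map_neg, map_smul, map_smul, dehom_lift, dehom_hor, dehom_hor]
    module

/-- An element of `𝔰𝔲(n,1)` is determined by its value and its derivative at a point. -/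
theorem eq_zero_of_generator_rho {k : ℕ} {p : E k} (hp : p ∈ CH k) {A : Mat k} (hA : A ∈ su k)
    (h1 : generator A p = 0) (h2 : ∀ V, rho p A V = 0) : A = 0 := by
  have h0 := herm_lift_ne_zero hp
  obtain ⟨c, hc⟩ : ∃ c : ℂ, A *ᵥ lift p = c • lift p :=
    ⟨_, exists_eq_smul_of_dehom_eq_zero h1⟩
  have hhor : ∀ V, A *ᵥ hor p V = c • hor p V := by
    intro V
    have h3 := h2 V
    rw [rho, hc, herm_smul_left, mul_div_assoc, div_self h0, mul_one] at h3
    have h4 := dehom_hor_decomposition h0 (A *ᵥ hor p V)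
    rw [herm_of_mem_su hA, hc, herm_smul_right, herm_hor_lift h0, mul_zero, neg_zero, zero_div,
      zero_smul, add_zero, sub_eq_zero.1 h3, hor_csmul] at h4
    exact h4
  have hAc : A = c • 1 := by
    apply matrix_ext_dotProduct
    intro X Y
    rw [dehom_hor_decomposition h0 X, Matrix.mulVec_add, Matrix.mulVec_smul, hhor, hc,
      Matrix.smul_mulVec, Matrix.one_mulVec]
    congr 1
    module
  have htr := hA.2
  rw [hAc, Matrix.trace_smul, Matrix.trace_one] at htr
  simp only [Fintype.card_sum, Fintype.card_fin, smul_eq_mul] at htr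
  have hk : ((k + 2 : ℕ) : ℂ) ≠ 0 :=
      Nat.cast_ne_zero.2 (by omega)
  rw [hAc, (mul_eq_zero.1 htr).resolve_right hk, zero_smul]

/-! ### The algebra of infinitesimal symmetries of `S` -/

/-- The infinitesimal isometries that preserve `S` to first order at `p`. -/
def symmetryAlgebra {k : ℕ} (S : TensorField12 k) (p : E k) : Submodule ℝ (Mat k) where
  carrier := {A | A ∈ su k ∧ Kills (S p) (rhoL p A - (S p (genL p A) : E k →ₗ[ℝ] E k))}
  zero_mem' := ⟨(su k).zero_mem, by intro X Y; simp⟩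
  add_mem' := by
    rintro A B ⟨hA, hA'⟩ ⟨hB, hB'⟩
    refine ⟨(su k).add_mem hA hB, ?_⟩
    intro X Y
    have h1 := hA' X Y
    have h2 := hB' X Y
    simp only [LinearMap.sub_apply, ContinuousLinearMap.coe_coe, map_add, map_sub,
      LinearMap.add_apply, _root_.add_apply, _root_.sub_apply] at h1 h2 ⊢
    linear_combination h1 + h2
  smul_mem' := by
    rintro c A ⟨hA, hA'⟩
    refine ⟨(su k).smul_mem c hA, ?_⟩
    intro X Y
    have h1 := congrArg (fun Z => c • Z) (hA' X Y)
    simp only [LinearMap.sub_apply, ContinuousLinearMap.coe_coe, map_sub,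
      _root_.sub_apply, map_smul, LinearMap.smul_apply, _root_.smul_apply, smul_sub,
      smul_add] at h1 ⊢
    exact h1

/-- The infinitesimal isometries whose derivative at `p` is given by `S`. -/
def transvectionSpace {k : ℕ} (S : TensorField12 k) (p : E k) : Submodule ℝ (Mat k) where
  carrier := {A | A ∈ su k ∧ ∀ Z, rhoL p A Z = S p (genL p A) Z}
  zero_mem' := ⟨(su k).zero_mem, by intro Z; simp⟩
  add_mem' := by
    rintro A B ⟨hA, hA'⟩ ⟨hB, hB'⟩
    refine ⟨(su k).add_mem hA hB, fun Z => ?_⟩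
    simp [hA', hB']
  smul_mem' := by
    rintro c A ⟨hA, hA'⟩
    refine ⟨(su k).smul_mem c hA, fun Z => ?_⟩
    simp [hA']

theorem transvectionSpace_le {k : ℕ} (S : TensorField12 k) (p : E k) :
    transvectionSpace S p ≤ symmetryAlgebra S p := by
  rintro A ⟨hA, hA'⟩
  refine ⟨hA, fun X Y => ?_⟩
  simp [hA']

namespace IsHomogeneousKahlerStructure

variable {k : ℕ} {μ : ℝ} {S : TensorField12 k}

/-- With `a = ∇A* - S_{A*}` and `b` likewise, the corresponding endomorphism for `⁅A, B⁆` is `⁅a,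
b⁆` minus the curvature of `∇ - S` at `A*, B*`. Endomorphisms that kill `S p` are closed under
commutators, and the curvature kills it by `kills_curvature`. -/
theorem lie_mem_symmetryAlgebra (hS : IsHomogeneousKahlerStructure μ S) {p : E k} (hp : p ∈ CH k)
    {A B : Mat k} (hA : A ∈ symmetryAlgebra S p) (hB : B ∈ symmetryAlgebra S p) :
    ⁅A, B⁆ ∈ symmetryAlgebra S p := by
  have h0 := herm_lift_ne_zero hp
  obtain ⟨hAsu, hA'⟩ := hA
  obtain ⟨hBsu, hB'⟩ := hB
  refine ⟨lie_mem_su hAsu hBsu, ?_⟩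
  set a := rhoL p A - (S p (genL p A) : E k →ₗ[ℝ] E k) with ha
  set b := rhoL p B - (S p (genL p B) : E k →ₗ[ℝ] E k) with hb
  have hK := hS.kills_curvature hp (genL p A) (genL p B)
  set K : E k → E k := fun Z => curvature p (genL p A) (genL p B) Z -
    (S p (genL p A) (S p (genL p B) Z) - S p (genL p B) (S p (genL p A) Z)) +
      S p (S p (genL p A) (genL p B) - S p (genL p B) (genL p A)) Z with hKdef
  have hra : ∀ Z, rhoL p A Z = a Z + S p (genL p A) Z := fun Z => by simp [ha]
  have hrb : ∀ Z, rhoL p B Z = b Z + S p (genL p B) Z := fun Z => by simp [hb]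
  have hv : genL p ⁅A, B⁆ = rhoL p A (genL p B) - rhoL p B (genL p A) := generator_lie h0 A B
  have hr : ∀ Z, rhoL p ⁅A, B⁆ Z = rhoL p A (rhoL p B Z) - rhoL p B (rhoL p A Z) -
      curvature p (genL p A) (genL p B) Z := by
    intro Z
    rw [curvature_eq hp]
    exact rho_lie h0 hAsu hBsu Z
  have key : ∀ Z, (rhoL p ⁅A, B⁆ - (S p (genL p ⁅A, B⁆) : E k →ₗ[ℝ] E k)) Z =
      a (b Z) - b (a Z) - K Z := by
    intro Z
    have e1 := hA' (genL p B) Z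
    have e2 := hB' (genL p A) Z
    rw [LinearMap.sub_apply, ContinuousLinearMap.coe_coe, hr, hv, hKdef]
    simp only [hra, hrb, map_add, map_sub, _root_.add_apply, _root_.sub_apply] at e1 e2 ⊢
    rw [e1, e2]
    abel
  intro X Y
  rw [key, key, key, hK X Y, hB' X Y, hA' X Y]
  simp only [map_add, map_sub, _root_.sub_apply]
  rw [hA' (b X) Y, hA' X (b Y), hB' (a X) Y, hB' X (a Y)]
  abel

/-- Each `S_X` is skew and commutes with `J`, hence is an admissible derivative in `exists_mem_su`.
-/
theorem exists_transvection (hμ : 0 < μ) (hS : IsHomogeneousKahlerStructure μ S) {p : E k}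
    (hp : p ∈ CH k) (X : E k) : ∃ A ∈ transvectionSpace S p, generator A p = X := by
  obtain ⟨A, hA, h1, h2⟩ := exists_mem_su hμ hp X (T := (S p X : E k →ₗ[ℝ] E k))
    (fun V => hS.apply_J hp X V) (fun Y Z => hS.metric_skew hp X Y Z)
  refine ⟨A, ⟨hA, fun Z => ?_⟩, h1⟩
  rw [rhoL_apply, h2, genL_apply, h1]
  rfl

/-- If the curvature and all the `S_X` act trivially on `S`, then `S` vanishes. -/
theorem eq_zero_of_kills (hS : IsHomogeneousKahlerStructure μ S) {p : E k} (hp : p ∈ CH k)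
    (h : ∀ X, Kills (S p) (S p X)) : S p = 0 := by
  have h0 := herm_lift_ne_zero hp
  -- The curvature of `∇ - S` differs from `R` by a commutator of operators `S_X` and by one more
  -- such operator, all of which kill `S p` by hypothesis.
  have hR : ∀ U V, Kills (S p) (curvature p U V) := by
    intro U V X Y
    have h1 := hS.kills_curvature hp U V X Y
    have h2 := h (S p U V - S p V U) X Y
    have h3 : S p U (S p V (S p X Y)) - S p V (S p U (S p X Y)) =
        S p (S p U (S p V X) - S p V (S p U X)) Y + S p X (S p U (S p V Y) - S p V (S p U Y)) := by
      rw [h V X Y, h U X Y]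
      simp only [map_add, map_sub, _root_.sub_apply]
      rw [h U (S p V X) Y, h U X (S p V Y), h V (S p U X) Y, h V X (S p U Y)]
      abel
    simp only [map_add, map_sub, _root_.add_apply, _root_.sub_apply] at h1 h2 h3 ⊢
    linear_combination h1 - h2 + h3
  have hc : ∀ (c : ℂ) (V Y : E k), S p V (c • Y) = c • S p V Y := by
    intro c V Y
    have h1 : ∀ V : E k, c • V = c.re • V + c.im • J V := by
      intro V
      have h2 : c.re • V + c.im • J V = (c.re : ℂ) • V + (c.im : ℂ) • (Complex.I • V) := rfl
      rw [h2, smul_smul, ← add_smul, Complex.re_add_im]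
    rw [h1, map_add, map_smul, map_smul, hS.apply_J hp, ← h1]
  -- `R(X, J X)` is a multiple of `J (1 + P)`, where `P` is the orthogonal projection onto the
  -- complex line of `X`; it doubles `X`. Its trivial action on `S p` reads `2 S_{JX} = J ∘ [P,
  -- S_X]`.
  have key : ∀ X ≠ 0, ∀ Y, (2 : ℝ) • S p (J X) Y =
      J ((eta p (S p X Y) X / eta p X X) • X - S p X ((eta p Y X / eta p X X) • X)) := by
    intro X hX0 Y
    have he := eta_self_ne_zero hp hX0
    have hee : conj (eta p X X) = eta p X X := by
      rw [eta, map_div₀, herm_conj, herm_conj]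
    have hcurv : ∀ Z, curvature p X (J X) Z =
        (-2 * Complex.I * eta p X X) • ((eta p Z X / eta p X X) • X + Z) := by
      intro Z
      have e1 : ∀ Z, eta p Z (J X) = -Complex.I * eta p Z X := by
        intro Z
        rw [eta, J, hor_csmul, herm_smul_right, Complex.conj_I, mul_div_assoc, eta]
      have e2 : eta p (J X) X = Complex.I * eta p X X := by
        rw [eta, J, hor_csmul, herm_smul_left, mul_div_assoc, eta]
      rw [curvature_eq hp, e1, e1, e2, J, smul_add, smul_smul, smul_smul]
      have : -2 * Complex.I * eta p X X * (eta p Z X / eta p X X) = -2 * Complex.I * eta p Z X := by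
        field_simp
      rw [this]
      module
    have h1 := hR X (J X) X Y
    rw [hcurv, hcurv, hcurv, div_self he, hc] at h1
    have h2 : (-2 * Complex.I * eta p X X) • ((1 : ℂ) • X + X) =
        (-4 * (eta p X X).re) • J X := by
      rw [one_smul, J, ← two_smul ℂ X, smul_smul, ← Complex.coe_smul, smul_smul]
      congr 1
      push_cast
      rw [Complex.conj_eq_iff_re.1 hee]
      ring
    rw [h2, map_smul, _root_.smul_apply, map_add] at h1
    have h3 : (-4 * (eta p X X).re) • S p (J X) Y =
        (-2 * eta p X X) • ((2 : ℝ) • S p (J X) Y) := by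
      rw [← Complex.coe_smul, ← Complex.coe_smul 2, smul_smul]
      congr 1
      push_cast
      rw [Complex.conj_eq_iff_re.1 hee]
      ring
    rw [h3] at h1
    have h4 : (-2 * eta p X X) ≠ 0 := mul_ne_zero (by norm_num) he
    have h5 : (-2 * eta p X X) • ((2 : ℝ) • S p (J X) Y) = (-2 * eta p X X) •
        J ((eta p (S p X Y) X / eta p X X) • X - S p X ((eta p Y X / eta p X X) • X)) := by
      have hJ : ∀ Z : E k, J Z = Complex.I • Z := fun _ => rfl
      rw [hJ (_ - _), eq_sub_of_add_eq h1.symm]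
      module
    exact smul_right_injective _ h4 h5
  have hmain : ∀ X, S p X = 0 := by
    intro X
    by_cases hX : X = 0
    · rw [hX, map_zero]
    have he := eta_self_ne_zero hp hX
    set P : E k →ₗ[ℂ] E k :=
      { toFun := fun Z => (eta p Z X / eta p X X) • X
        map_add' := by
          intro Z W
          simp only [eta, hor_add, herm_add_left, add_div, add_smul]
        map_smul' := by
          intro c Z
          simp only [eta, hor_csmul, herm_smul_left, RingHom.id_apply, smul_smul,
            mul_div_assoc] } with hP
    have hPZ : ∀ Z, P Z = (eta p Z X / eta p X X) • X := fun Z => rfl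
    have hPP : ∀ Z, P (P Z) = P Z := by
      intro Z
      conv_lhs => rw [hPZ Z, map_smul, hPZ X, div_self he, one_smul]
      rw [hPZ]
    have k1 : ∀ Y, (2 : ℂ) • S p (J X) Y = Complex.I • (P (S p X Y) - S p X (P Y)) := by
      intro Y
      exact key X hX Y
    have k2 : ∀ Y, (2 : ℂ) • S p X Y = -Complex.I • (P (S p (J X) Y) - S p (J X) (P Y)) := by
      intro Y
      have hJX : J X ≠ 0 := smul_ne_zero Complex.I_ne_zero hX
      have hJJ : J (J X) = -X := by
        rw [J, J, smul_smul, Complex.I_mul_I, neg_one_smul]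
      have hPJ : ∀ Z, (eta p Z (J X) / eta p (J X) (J X)) • J X = P Z := by
        intro Z
        rw [hPZ, J, smul_smul]
        congr 1
        simp only [eta, hor_csmul, herm_smul_left, herm_smul_right, Complex.conj_I]
        have hh : herm (hor p X) (hor p X) ≠ 0 := by
          intro h; apply he; rw [eta, h, zero_div]
        have hI := Complex.I_ne_zero
        field_simp
      have h1 := key (J X) hJX Y
      rw [hJJ, hPJ, hPJ, map_neg] at h1
      have h2 : (2 : ℂ) • (-S p X) Y = Complex.I • (P (S p (J X) Y) - S p (J X) (P Y)) := h1
      rw [_root_.neg_apply, smul_neg] at h2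
      rw [neg_smul, ← h2, neg_neg]
    -- Using the relation for `X` and for `J X` gives `4 S_X = [P, [P, S_X]]`. For a projection `P`
    -- the operator `(ad P)²` has only the eigenvalues `0` and `1`, so `S_X = 0`; composing with `P`
    -- on either side shows this block by block.
    have k3 : ∀ Y, (4 : ℂ) • S p X Y =
        P (S p X Y) - (2 : ℂ) • P (S p X (P Y)) + S p X (P Y) := by
      intro Y
      have h1 := congrArg P (k1 Y)
      have h2 := k1 (P Y)
      have h3 := k2 Y
      rw [hPP] at h2
      simp only [map_smul, map_sub, hPP] at h1
      have h4 : (4 : ℂ) • S p X Y = -Complex.I • ((2 : ℂ) • P (S p (J X) Y) -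
          (2 : ℂ) • S p (J X) (P Y)) := by
        rw [← smul_sub, smul_comm, ← h3, smul_smul]
        norm_num
      rw [h4, h1, h2, ← smul_sub, smul_smul]
      have : -Complex.I * Complex.I = 1 := by rw [neg_mul, Complex.I_mul_I, neg_neg]
      rw [this]
      module
    have k4 : ∀ Y, P (S p X (P Y)) = 0 := by
      intro Y
      have h1 := congrArg P (k3 (P Y))
      simp only [map_smul, map_sub, map_add, hPP] at h1
      have h2 : (4 : ℂ) • P (S p X (P Y)) = 0 := by
        rw [h1]; module
      exact (smul_eq_zero.1 h2).resolve_left (by norm_num)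
    have k5 : ∀ Y, P (S p X Y) = 0 := by
      intro Y
      have h1 := congrArg P (k3 Y)
      simp only [map_smul, map_add, hPP, k4, smul_zero, sub_zero, add_zero] at h1
      have h2 : (3 : ℂ) • P (S p X Y) = 0 := by
        have h3 : (3 : ℂ) • P (S p X Y) = (4 : ℂ) • P (S p X Y) - P (S p X Y) := by module
        rw [h3, h1, sub_self]
      exact (smul_eq_zero.1 h2).resolve_left (by norm_num)
    have k6 : ∀ Y, S p X (P Y) = 0 := by
      intro Y
      have h1 := k3 (P Y)
      rw [k5, hPP, k5, smul_zero, sub_zero, zero_add] at h1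
      have h2 : (3 : ℂ) • S p X (P Y) = 0 := by
        have h3 : (3 : ℂ) • S p X (P Y) = (4 : ℂ) • S p X (P Y) - S p X (P Y) := by module
        rw [h3, h1, sub_self]
      exact (smul_eq_zero.1 h2).resolve_left (by norm_num)
    refine ContinuousLinearMap.ext fun Y => ?_
    have h1 := k3 Y
    rw [k5, k6, map_zero, smul_zero, sub_zero, add_zero] at h1
    exact (smul_eq_zero.1 h1).resolve_left (by norm_num)
  exact ContinuousLinearMap.ext hmain

end IsHomogeneousKahlerStructure

/-! ### Conjugation to the base point -/

/-- Conjugation by `x`. -/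
def conjL {k : ℕ} (x : Mat k) : Mat k →ₗ[ℝ] Mat k where
  toFun A := x * A * x⁻¹
  map_add' A B := by rw [mul_add, add_mul]
  map_smul' c A := by rw [mul_smul_comm, smul_mul_assoc, RingHom.id_apply]

theorem conjL_apply {k : ℕ} (x A : Mat k) : conjL x A = x * A * x⁻¹ := rfl

theorem IsUnitaryHerm.conjL_lie {k : ℕ} {x : Mat k} (hx : IsUnitaryHerm x) (A B : Mat k) :
    conjL x ⁅A, B⁆ = ⁅conjL x A, conjL x B⁆ := by
  have h : ∀ A B : Mat k, conjL x A * conjL x B = conjL x (A * B) := by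
    intro A B
    rw [conjL_apply, conjL_apply, conjL_apply, mul_assoc (x * A), ← mul_assoc x⁻¹,
      ← mul_assoc x⁻¹, hx.inv_mul, one_mul]
    simp only [mul_assoc]
  rw [Ring.lie_def, Ring.lie_def, h, h, map_sub]

theorem IsUnitaryHerm.conjL_inv {k : ℕ} {x : Mat k} (hx : IsUnitaryHerm x) (A : Mat k) :
    conjL x (x⁻¹ * A * x) = A := by
  rw [conjL_apply, mul_assoc x⁻¹, ← mul_assoc x, hx.mul_inv, one_mul, mul_assoc, hx.mul_inv,
    mul_one]

/-- The base line is the `-1` eigenspace of the Gram matrix, so an element of `𝔰𝔲(n,1)` fixes it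
exactly when it commutes with the Gram matrix, i.e. when it is skew-hermitian. -/
theorem generator_conj_eq_zero_iff {k : ℕ} {p : E k} {x : Mat k} (hx : IsUnitaryHerm x) {c : ℂ}
    (hc : c ≠ 0) (hxp : x *ᵥ baseVec k = c • lift p) {D : Mat k} (hD : D ∈ su k) :
    generator (x * D * x⁻¹) p = 0 ↔ D + Dᴴ = 0 := by
  have hz : x⁻¹ *ᵥ lift p = c⁻¹ • baseVec k := by
    have : lift p = c⁻¹ • (x *ᵥ baseVec k) := by rw [hxp, smul_smul, inv_mul_cancel₀ hc, one_smul]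
    rw [this, Matrix.mulVec_smul, Matrix.mulVec_mulVec, hx.inv_mul, Matrix.one_mulVec]
  have hgen : generator (x * D * x⁻¹) p = c⁻¹ • dehom p (x *ᵥ (D *ᵥ baseVec k)) := by
    rw [generator_eq_dehom, ← Matrix.mulVec_mulVec, ← Matrix.mulVec_mulVec, hz,
      Matrix.mulVec_smul, Matrix.mulVec_smul, map_smul]
  have hHD : hermMatrix k * Dᴴ = -(D * hermMatrix k) := by
    have := hermMatrix_mul_of_mem_su (conjTranspose_mem_su hD)
    rwa [Matrix.conjTranspose_conjTranspose] at this
  constructor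
  · intro h
    rw [hgen, smul_eq_zero, or_iff_right (inv_ne_zero hc)] at h
    obtain ⟨l, hl⟩ : ∃ l : ℂ, D *ᵥ baseVec k = l • baseVec k := by
      have h1 := congrArg (fun u => x⁻¹ *ᵥ u) (exists_eq_smul_of_dehom_eq_zero h)
      simp only [Matrix.mulVec_mulVec, hx.inv_mul, Matrix.mulVec_smul, hz, ← mul_assoc,
        one_mul, smul_smul] at h1
      exact ⟨_, h1⟩
    apply eq_zero_of_mulVec_baseVec
    · exact (su k).add_mem hD (conjTranspose_mem_su hD)
    · simp [add_comm]
    · have h2 : Dᴴ *ᵥ baseVec k = -(l • baseVec k) := by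
        have h3 : Dᴴ *ᵥ (hermMatrix k *ᵥ baseVec k) = l • baseVec k := by
          rw [Matrix.mulVec_mulVec, ← neg_neg (Dᴴ * hermMatrix k), ← hermMatrix_mul_of_mem_su hD,
            Matrix.neg_mulVec, ← Matrix.mulVec_mulVec, hl, Matrix.mulVec_smul,
            hermMatrix_mulVec_baseVec, smul_neg, neg_neg]
        rw [hermMatrix_mulVec_baseVec, Matrix.mulVec_neg] at h3
        rw [← h3, neg_neg]
      rw [Matrix.add_mulVec, hl, h2, add_neg_cancel]
  · intro h
    have h1 : hermMatrix k *ᵥ (D *ᵥ baseVec k) = -(D *ᵥ baseVec k) := by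
      have h2 : D = -Dᴴ := eq_neg_of_add_eq_zero_left h
      conv_lhs => rw [h2]
      rw [Matrix.mulVec_mulVec, mul_neg, hHD, neg_neg, ← Matrix.mulVec_mulVec,
        hermMatrix_mulVec_baseVec, Matrix.mulVec_neg]
    have h2 : D *ᵥ baseVec k = (D *ᵥ baseVec k) (Sum.inr 1) • baseVec k := by
      set u := D *ᵥ baseVec k
      rw [hermMatrix_mulVec] at h1
      funext i
      rcases i with i | i
      · have := congrFun h1 (Sum.inl i)
        simp at this
        simp [lift, basePoint, self_eq_neg.1 this]
      · have := congrFun h1 (Sum.inr 0)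
        simp at this
        fin_cases i
        · simp [lift, basePoint, this]
        · simp [lift, basePoint]
    rw [hgen, h2, Matrix.mulVec_smul, hxp, map_smul, map_smul, dehom_lift, smul_zero, smul_zero,
      smul_zero]

/-- A hermitian element anticommutes with the Gram matrix and so exchanges the base line with its
orthogonal complement; `rho` sees only the diagonal blocks. These are the transvections of the
symmetric space. -/
theorem rho_conj_of_hermitian {k : ℕ} {p : E k} (hp : p ∈ CH k) {x : Mat k}
    (hx : IsUnitaryHerm x) {c : ℂ}
    (hc : c ≠ 0) (hxp : x *ᵥ baseVec k = c • lift p) {D : Mat k} (hD : D ∈ su k) (hDh : Dᴴ = D)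
    (V : E k) : rho p (x * D * x⁻¹) V = 0 := by
  have h0 := herm_lift_ne_zero hp
  have hA := hx.conj_mem_su hD
  have hHD : hermMatrix k * D = -(D * hermMatrix k) := by
    have := hermMatrix_mul_of_mem_su hD
    rwa [hDh] at this
  have hz : lift p = c⁻¹ • (x *ᵥ baseVec k) := by
    rw [hxp, smul_smul, inv_mul_cancel₀ hc, one_smul]
  have hker : ∀ u, hermMatrix k *ᵥ u = u → herm u (baseVec k) = 0 := by
    intro u hu
    rw [herm_baseVec_right]
    rw [hermMatrix_mulVec] at hu
    have := congrFun hu (Sum.inr 0)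
    simp at this
    rw [this, sub_self]
  have h1 : herm ((x * D * x⁻¹) *ᵥ lift p) (lift p) = 0 := by
    have h2 : (x * D * x⁻¹) *ᵥ (x *ᵥ baseVec k) = x *ᵥ (D *ᵥ baseVec k) := by
      simp only [Matrix.mulVec_mulVec, mul_assoc, hx.inv_mul, mul_one]
    rw [hz, Matrix.mulVec_smul, h2, herm_smul_left, herm_smul_right, hx.herm_apply, hker, mul_zero,
      mul_zero]
    rw [Matrix.mulVec_mulVec, hHD, Matrix.neg_mulVec, ← Matrix.mulVec_mulVec,
      hermMatrix_mulVec_baseVec, Matrix.mulVec_neg, neg_neg]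
  obtain ⟨w, hw⟩ : ∃ w, hor p V = x *ᵥ w := ⟨x⁻¹ *ᵥ hor p V, by simp [hx.mul_inv]⟩
  have hwo : herm w (baseVec k) = 0 := by
    rw [← hx.herm_apply, ← hw, hxp, herm_smul_right, herm_hor_lift h0, mul_zero]
  have hHw : hermMatrix k *ᵥ w = w := by
    rw [herm_baseVec_right, sub_eq_zero] at hwo
    rw [hermMatrix_mulVec]
    funext i
    rcases i with i | i
    · simp
    · fin_cases i
      · simp [hwo]
      · simp [hwo]
  have h3 : hermMatrix k *ᵥ (D *ᵥ w) = -(D *ᵥ w) := by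
    rw [Matrix.mulVec_mulVec, hHD, Matrix.neg_mulVec, ← Matrix.mulVec_mulVec, hHw]
  have h4 : D *ᵥ w = (D *ᵥ w) (Sum.inr 1) • baseVec k := by
    set u := D *ᵥ w
    rw [hermMatrix_mulVec] at h3
    funext i
    rcases i with i | i
    · have := congrFun h3 (Sum.inl i)
      simp at this
      simp [lift, basePoint, self_eq_neg.1 this]
    · have := congrFun h3 (Sum.inr 0)
      simp at this
      fin_cases i
      · simp [lift, basePoint, this]
      · simp [lift, basePoint]
  have h5 : (x * D * x⁻¹) *ᵥ hor p V = x *ᵥ (D *ᵥ w) := by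
    rw [hw]
    simp only [Matrix.mulVec_mulVec, mul_assoc, hx.inv_mul, mul_one]
  rw [rho, h1, zero_div, zero_smul, sub_zero, h5, h4, Matrix.mulVec_smul, hxp, map_smul, map_smul,
    dehom_lift, smul_zero, smul_zero]

theorem IsHomogeneousKahlerStructure.isTransitiveSubalgebra {k : ℕ} {μ : ℝ} (hμ : 0 < μ)
    {S : TensorField12 k} (hS : IsHomogeneousKahlerStructure μ S) {p : E k} (hp : p ∈ CH k)
    {x : Mat k} (hx : IsUnitaryHerm x) {c : ℂ} (hc : c ≠ 0)
    (hxp : x *ᵥ baseVec k = c • lift p) :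
    IsTransitiveSubalgebra ((symmetryAlgebra S p).comap (conjL x)) := by
  refine ⟨?_, ?_, ?_⟩
  · intro A hA
    exact hx.conj_mem_su_iff.1 hA.1
  · intro A hA B hB
    rw [Submodule.mem_comap, hx.conjL_lie]
    exact hS.lie_mem_symmetryAlgebra hp hA hB
  · intro A hA
    obtain ⟨B, hB, hBv⟩ := hS.exists_transvection hμ hp (generator (x * A * x⁻¹) p)
    refine ⟨x⁻¹ * B * x, ?_, ?_⟩
    · rw [Submodule.mem_comap, hx.conjL_inv]
      exact transvectionSpace_le S p hB
    · have hD : x⁻¹ * B * x ∈ su k := by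
        rw [← hx.conj_mem_su_iff, ← conjL_apply, hx.conjL_inv]
        exact hB.1
      have h1 := (generator_conj_eq_zero_iff hx hc hxp ((su k).sub_mem hD hA)).1 (by
        rw [← conjL_apply, map_sub, hx.conjL_inv, ← genL_apply, map_sub, genL_apply, hBv,
          genL_apply, conjL_apply, sub_self])
      rw [Matrix.conjTranspose_sub] at h1
      rw [← sub_eq_zero, ← h1]
      abel

/-- Every tangent vector `X` is the velocity of a hermitian element, whose covariant derivative at
`p` is zero. Its membership in the symmetry algebra then says that `S_X` itself kills `S p`, and
`eq_zero_of_kills` applies. -/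
theorem IsHomogeneousKahlerStructure.eq_zero_of_hermitian_mem {k : ℕ} {μ : ℝ} (hμ : 0 < μ)
    {S : TensorField12 k} (hS : IsHomogeneousKahlerStructure μ S) {p : E k} (hp : p ∈ CH k)
    {x : Mat k} (hx : IsUnitaryHerm x) {c : ℂ} (hc : c ≠ 0)
    (hxp : x *ᵥ baseVec k = c • lift p)
    (h : ∀ A ∈ su k, Aᴴ = A → A ∈ (symmetryAlgebra S p).comap (conjL x)) : S p = 0 := by
  apply hS.eq_zero_of_kills hp
  intro X
  obtain ⟨B, hB, hBv⟩ := hS.exists_transvection hμ hp X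
  set D := x⁻¹ * B * x with hDdef
  have hD : D ∈ su k := by
    rw [← hx.conj_mem_su_iff, ← conjL_apply, hx.conjL_inv]
    exact hB.1
  set Y : Mat k := (1 / 2 : ℝ) • (D + Dᴴ) with hY
  have hYsu : Y ∈ su k := (su k).smul_mem _ ((su k).add_mem hD (conjTranspose_mem_su hD))
  have hYh : Yᴴ = Y := by
    rw [hY, Matrix.conjTranspose_smul, star_trivial, Matrix.conjTranspose_add,
      Matrix.conjTranspose_conjTranspose, add_comm]
  have hv : genL p (conjL x Y) = X := by
    have h1 := (generator_conj_eq_zero_iff hx hc hxp ((su k).sub_mem hD hYsu)).2 (by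
      rw [Matrix.conjTranspose_sub, hYh, hY]
      module)
    rw [← conjL_apply, map_sub, hx.conjL_inv, ← genL_apply, map_sub, genL_apply, hBv,
      sub_eq_zero] at h1
    exact h1.symm
  obtain ⟨-, hk⟩ := h Y hYsu hYh
  intro U W
  have h2 := hk U W
  have h3 : ∀ Z, rhoL p (conjL x Y) Z = 0 := fun Z =>
    rho_conj_of_hermitian hp hx hc hxp hYsu hYh Z
  simp only [LinearMap.sub_apply, ContinuousLinearMap.coe_coe, h3, hv, zero_sub, map_neg,
    _root_.neg_apply] at h2
  rw [← neg_inj, h2, neg_add]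

/-- The determinant has modulus one; a root of its inverse of order `k + 2 = n + 1` normalizes it
without affecting `herm`. -/
theorem exists_isSU_smul {k : ℕ} {x : Mat k} (hx : IsUnitaryHerm x) :
    ∃ l : ℂ, l ≠ 0 ∧ IsSU (l • x) := by
  have hdet : conj x.det * x.det = 1 := by
    have h1 := congrArg Matrix.det hx
    rw [Matrix.det_mul, Matrix.det_mul, Matrix.det_conjTranspose] at h1
    have h2 : (hermMatrix k).det ≠ 0 := by
      intro h
      have := congrArg Matrix.det (hermMatrix_mul_self k)
      rw [Matrix.det_mul, h, Matrix.det_one, mul_zero] at this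
      exact zero_ne_one this
    apply mul_right_cancel₀ h2
    rw [one_mul, ← Complex.star_def]
    linear_combination h1
  have hx0 : x.det ≠ 0 := by
    intro h
    rw [h, mul_zero] at hdet
    exact zero_ne_one hdet
  obtain ⟨l, hl⟩ := IsAlgClosed.exists_pow_nat_eq (x.det)⁻¹ (n := k + 2) (by omega)
  have hl0 : l ≠ 0 := by
    rintro rfl
    rw [zero_pow (by omega)] at hl
    exact inv_ne_zero hx0 hl.symm
  have hnorm : ‖l‖ = 1 := by
    have h1 : ‖x.det‖ = 1 := by
      have h2 := congrArg norm hdet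
      rw [norm_mul, RCLike.norm_conj, norm_one] at h2
      nlinarith [norm_nonneg x.det]
    have h3 := congrArg norm hl
    rw [norm_pow, norm_inv, h1, inv_one] at h3
    exact (pow_eq_one_iff_of_nonneg (norm_nonneg l) (by omega)).1 h3
  have hll : conj l * l = 1 := by
    rw [Complex.conj_mul', hnorm]
    simp
  refine ⟨l, hl0, isUnitaryHerm_iff.1 (isUnitaryHerm_smul hx hll), ?_⟩
  rw [Matrix.det_smul, Fintype.card_sum, Fintype.card_fin, Fintype.card_fin, hl,
    inv_mul_cancel₀ hx0]

theorem conjL_smul {k : ℕ} {l : ℂ} (hl : l ≠ 0) {x : Mat k} (hx : IsUnitaryHerm x) :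
    conjL (l • x) = conjL x := by
  ext1 A
  have h1 : (l • x)⁻¹ = l⁻¹ • x⁻¹ := by
    apply Matrix.inv_eq_left_inv
    rw [smul_mul_smul_comm, inv_mul_cancel₀ hl, hx.inv_mul, one_smul]
  rw [conjL_apply, conjL_apply, h1, smul_mul_assoc, smul_mul_assoc, mul_smul_comm, smul_smul,
    mul_inv_cancel₀ hl, one_smul]

theorem MovesBaseTo.isUnitaryHerm {k : ℕ} {x : Mat k} {p : E k} (h : MovesBaseTo x p) :
    IsUnitaryHerm x := isUnitaryHerm_iff.2 h.1.1

theorem MovesBaseTo.exists_ne_zero {k : ℕ} {x : Mat k} {p : E k} (h : MovesBaseTo x p) :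
    ∃ c : ℂ, c ≠ 0 ∧ x *ᵥ baseVec k = c • lift p := by
  obtain ⟨c, hc⟩ := h.2
  refine ⟨c, ?_, hc⟩
  rintro rfl
  have h1 := h.1.1 (baseVec k) (baseVec k)
  rw [hc, zero_smul, herm_baseVec_right] at h1
  simp [herm, lift, basePoint] at h1
  norm_num at h1

/-- Commuting with the Gram matrix preserves its `-1` eigenspace, the base line. -/
theorem IsCompactUnitary.mulVec_baseVec {k : ℕ} {x : Mat k} (hx : IsCompactUnitary x) :
    ∃ c : ℂ, c ≠ 0 ∧ x *ᵥ baseVec k = c • baseVec k := by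
  set u := x *ᵥ baseVec k with hu
  have h1 : hermMatrix k *ᵥ u = -u := by
    rw [hu, Matrix.mulVec_mulVec, ← hx.commute, ← Matrix.mulVec_mulVec, hermMatrix_mulVec_baseVec,
      Matrix.mulVec_neg]
  have h2 : u = u (Sum.inr 1) • baseVec k := by
    rw [hermMatrix_mulVec] at h1
    funext i
    rcases i with i | i
    · have := congrFun h1 (Sum.inl i)
      simp at this
      simp [lift, basePoint, self_eq_neg.1 this]
    · have := congrFun h1 (Sum.inr 0)
      simp at this
      fin_cases i
      · simp [lift, basePoint, this]
      · simp [lift, basePoint]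
  refine ⟨u (Sum.inr 1), fun h => ?_, h2⟩
  rw [h, zero_smul] at h2
  have h3 : baseVec k = 0 := by
    have := congrArg (fun v => xᴴ *ᵥ v) h2
    simpa [hu, Matrix.mulVec_mulVec, hx.unitary] using this
  have := congrFun h3 (Sum.inr 1)
  simp [lift] at this

/-- If `S` does not vanish, its symmetry algebra is, up to the choice of an isometry that moves the
base point to `p`, contained in `𝔰(𝔲(n-1) + 𝔲(1)) + 𝔞 + 𝔫` and contains `𝔫`. -/
theorem IsHomogeneousKahlerStructure.exists_movesBaseTo {k : ℕ} {μ : ℝ} (hμ : 0 < μ)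
    {S : TensorField12 k} (hS : IsHomogeneousKahlerStructure μ S) {p : E k} (hp : p ∈ CH k)
    (hne : S p ≠ 0) :
    ∃ x : Mat k, MovesBaseTo x p ∧
      IsTransitiveSubalgebra ((symmetryAlgebra S p).comap (conjL x)) ∧
      nilPart k ≤ (symmetryAlgebra S p).comap (conjL x) ∧
      (symmetryAlgebra S p).comap (conjL x) ≤
        (compactPart k ⊔ Submodule.span ℝ {A0 k}) ⊔ nilPart k := by
  obtain ⟨x, c, hx, hc, hxp⟩ := exists_isUnitaryHerm_baseVec hp
  have ht := hS.isTransitiveSubalgebra hμ hp hx hc hxp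
  rcases ht.classification with h | ⟨y, hy, h1, h2⟩
  · exact absurd (hS.eq_zero_of_hermitian_mem hμ hp hx hc hxp h) hne
  obtain ⟨d, hd, hyd⟩ := hy.mulVec_baseVec
  have hxy := hx.mul hy.isUnitaryHerm
  obtain ⟨l, hl, hlSU⟩ := exists_isSU_smul hxy
  have hcomap : (symmetryAlgebra S p).comap (conjL (l • (x * y))) =
      conjBy ((symmetryAlgebra S p).comap (conjL x)) y := by
    rw [conjL_smul hl hxy]
    ext A
    rw [mem_conjBy, Submodule.mem_comap, Submodule.mem_comap, ← hy.inv_eq, conjL_apply, conjL_apply,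
      Matrix.mul_inv_rev]
    simp only [mul_assoc]
  refine ⟨l • (x * y), ⟨hlSU, l * (d * c), ?_⟩, ?_⟩
  · rw [Matrix.smul_mulVec, ← Matrix.mulVec_mulVec]
    have hyd' : y *ᵥ lift (basePoint k) = d • lift (basePoint k) := hyd
    have hxp' : x *ᵥ lift (basePoint k) = c • lift p := hxp
    rw [hyd', Matrix.mulVec_smul, hxp', smul_smul, smul_smul, mul_assoc]
  · rw [hcomap]
    exact ⟨ht.conjBy hy, h1, h2⟩

/-! ### Reductive descriptions that realize `S` -/

theorem mem_compact_sup_A0 {k : ℕ} {D : Mat k} :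
    D ∈ compactPart k ⊔ Submodule.span ℝ {A0 k} ↔
      ∃ C ∈ compactPart k, ∃ t : ℝ, D = C + t • A0 k := by
  rw [Submodule.mem_sup]
  constructor
  · rintro ⟨C, hC, Y, hY, rfl⟩
    obtain ⟨t, rfl⟩ := Submodule.mem_span_singleton.1 hY
    exact ⟨C, hC, t, rfl⟩
  · rintro ⟨C, hC, t, rfl⟩
    exact ⟨C, hC, _, Submodule.smul_mem _ t (Submodule.mem_span_singleton_self _), rfl⟩

theorem conjTranspose_of_mem_compactPart {k : ℕ} {C : Mat k} (hC : C ∈ compactPart k) :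
    Cᴴ = -C := by
  obtain ⟨U, c, hU, -, rfl⟩ := hC
  exact compactMat_conjTranspose hU c

theorem lie_A0_of_mem_compactPart {k : ℕ} {C : Mat k} (hC : C ∈ compactPart k) :
    ⁅A0 k, C⁆ = 0 := by
  obtain ⟨U, c, -, -, rfl⟩ := hC
  exact lie_A0_compactMat U c

theorem lie_mem_compactPart {k : ℕ} {C C' : Mat k} (hC : C ∈ compactPart k)
    (hC' : C' ∈ compactPart k) : ⁅C, C'⁆ ∈ compactPart k := by
  obtain ⟨U, c, hU, ht, rfl⟩ := hC
  obtain ⟨U', c', hU', ht', rfl⟩ := hC'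
  refine ⟨U * U' - U' * U, 0, ?_, ?_, ?_⟩
  · rw [Matrix.conjTranspose_sub, Matrix.conjTranspose_mul, Matrix.conjTranspose_mul, hU, hU']
    simp
  · rw [Matrix.trace_sub, Matrix.trace_mul_comm]
    simp
  · rw [Ring.lie_def, compactMat, compactMat, compactMat, Matrix.fromBlocks_multiply,
      Matrix.fromBlocks_multiply]
    ext i j
    rcases i with i | i <;> rcases j with j | j <;> simp
    fin_cases i <;> fin_cases j <;> simp <;> ring

theorem lie_mem_compact_sup_A0 {k : ℕ} {D D' : Mat k}
    (hD : D ∈ compactPart k ⊔ Submodule.span ℝ {A0 k})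
    (hD' : D' ∈ compactPart k ⊔ Submodule.span ℝ {A0 k}) : ⁅D, D'⁆ ∈ compactPart k := by
  obtain ⟨C, hC, t, rfl⟩ := mem_compact_sup_A0.1 hD
  obtain ⟨C', hC', t', rfl⟩ := mem_compact_sup_A0.1 hD'
  have h1 : ⁅C, A0 k⁆ = 0 := by rw [← lie_skew, lie_A0_of_mem_compactPart hC, neg_zero]
  rw [lie_add, add_lie, add_lie, lie_smul, lie_smul, smul_lie, smul_lie, h1,
    lie_A0_of_mem_compactPart hC', lie_self]
  simpa using lie_mem_compactPart hC hC'

theorem compact_sup_A0_sup_nil_le_su (k : ℕ) :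
    (compactPart k ⊔ Submodule.span ℝ {A0 k}) ⊔ nilPart k ≤ su k := by
  refine sup_le (sup_le (compactPart_le_su k) ?_) (nilPart_le_su k)
  rw [Submodule.span_singleton_le_iff_mem]
  exact A0_mem_su k

theorem mem_compactPart_of_skew {k : ℕ} {D : Mat k}
    (hD : D ∈ (compactPart k ⊔ Submodule.span ℝ {A0 k}) ⊔ nilPart k) (h : D + Dᴴ = 0) :
    D ∈ compactPart k := by
  obtain ⟨F, hF, N, ⟨v, b, rfl⟩, rfl⟩ := Submodule.mem_sup.1 hD
  obtain ⟨C, hC, t, rfl⟩ := mem_compact_sup_A0.1 hF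
  have h1 : (2 * t) • A0 k + nilMat v b + (nilMat v b)ᴴ = 0 := by
    rw [← h]
    simp only [Matrix.conjTranspose_add, Matrix.conjTranspose_smul, A0_conjTranspose,
      conjTranspose_of_mem_compactPart hC, star_trivial]
    module
  have hv : v = 0 := by
    funext i
    have := congrFun (congrFun h1 (Sum.inl i)) (Sum.inr 1)
    simpa [nilMat, A0] using this
  have hb : b = 0 := by
    have := congrArg Complex.im (congrFun (congrFun h1 (Sum.inr 0)) (Sum.inr 1))
    simpa [nilMat, A0] using this
  have ht : t = 0 := by
    have := congrArg Complex.re (congrFun (congrFun h1 (Sum.inr 0)) (Sum.inr 0))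
    simpa [nilMat, A0] using this
  have h0 : (nilMat 0 0 : Mat k) = 0 := by rw [nilMat_center_smul, zero_smul]
  rw [hv, hb, ht, h0, zero_smul, add_zero, add_zero]
  exact hC

/-- Expanding `⁅B, C⁆` by `generator_lie`, the terms with the covariant derivative of `C` cancel.
What remains is that the derivative at `p` of each generator from `𝔪` is given by `S`. -/
theorem isCanonicalFor_iff {k : ℕ} {S : TensorField12 k} {d : ReductiveDescription k} {x : Mat k}
    {p : E k} (hp : p ∈ CH k) (hx : MovesBaseTo x p) :
    IsCanonicalFor S d x p ↔ ∀ B ∈ d.m, ∀ C ∈ d.m,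
      rhoL p (conjL x B) (genL p (conjL x C)) =
        S p (genL p (conjL x B)) (genL p (conjL x C)) := by
  have h0 := herm_lift_ne_zero hp
  have key : ∀ B C : Mat k, fderiv ℝ (generator (x * C * x⁻¹)) p (toTangent x p B) +
      tildeConn S p (toTangent x p B) (toTangent x p C) + toTangent x p ⁅B, C⁆ =
      rhoL p (conjL x B) (genL p (conjL x C)) -
        S p (genL p (conjL x B)) (genL p (conjL x C)) := by
    intro B C
    have h1 : toTangent x p ⁅B, C⁆ = rhoL p (conjL x B) (genL p (conjL x C)) -
        rhoL p (conjL x C) (genL p (conjL x B)) := by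
      change generator (conjL x ⁅B, C⁆) p = _
      rw [hx.isUnitaryHerm.conjL_lie, generator_lie h0]
      rfl
    have h2 := fderiv_generator_add_christoffel h0 (conjL x C) (genL p (conjL x B))
    have h3 : ∀ B, toTangent x p B = genL p (conjL x B) := fun _ => rfl
    rw [h1, tildeConn, h3, h3, rhoL_apply p (conjL x C), ← h2]
    rw [conjL_apply x C, genL_apply p (x * C * x⁻¹)]
    abel
  refine forall₂_congr fun B _ => forall₂_congr fun C _ => ?_
  rw [eq_neg_iff_add_eq_zero, key, sub_eq_zero]

/-- The reductive description of a nonzero homogeneous Kähler structure. -/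
theorem IsHomogeneousKahlerStructure.exists_description {k : ℕ} {μ : ℝ} (hμ : 0 < μ)
    {S : TensorField12 k} (hS : IsHomogeneousKahlerStructure μ S) {p : E k} (hp : p ∈ CH k)
    (hne : S p ≠ 0) :
    ∃ (d : ReductiveDescription k) (x : Mat k), MovesBaseTo x p ∧ IsCanonicalFor S d x p := by
  have h0 := herm_lift_ne_zero hp
  obtain ⟨x, hxp, ht, hn, hle⟩ := hS.exists_movesBaseTo hμ hp hne
  obtain ⟨c, hc, hxc⟩ := hxp.exists_ne_zero
  have hx := hxp.isUnitaryHerm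
  set g := (symmetryAlgebra S p).comap (conjL x) with hg
  set q := compactPart k ⊔ Submodule.span ℝ {A0 k} with hq
  -- By `isCanonicalFor_iff`, taking transvections as complement makes `∇ - S` the canonical
  -- connection.
  set m := (transvectionSpace S p).comap (conjL x) with hm
  have hmg : m ≤ g := fun A hA => transvectionSpace_le S p hA
  have hv0 : ∀ D ∈ su k, genL p (conjL x D) = 0 ↔ D + Dᴴ = 0 := fun D hD =>
    generator_conj_eq_zero_iff hx hc hxc hD
  have hvC : ∀ C ∈ compactPart k, genL p (conjL x C) = 0 := by
    intro C hC
    rw [hv0 C (compactPart_le_su k hC), conjTranspose_of_mem_compactPart hC, add_neg_cancel]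
  have hdec : ∀ A ∈ g, ∃ F ∈ q ⊓ g, ∃ N ∈ nilPart k, A = F + N := by
    intro A hA
    obtain ⟨F, hF, N, hN, rfl⟩ := Submodule.mem_sup.1 (hle hA)
    refine ⟨F, ⟨hF, ?_⟩, N, hN, rfl⟩
    have := g.sub_mem hA (hn hN)
    rwa [add_sub_cancel_right] at this
  let f : LieSubalgebra ℝ (Mat k) :=
    { q ⊓ g with
      lie_mem' := by
        rintro A B ⟨hA, hA'⟩ ⟨hB, hB'⟩
        exact ⟨(le_sup_left : compactPart k ≤ q) (lie_mem_compact_sup_A0 hA hB),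
          ht.lie_mem A hA' B hB'⟩ }
  have hf : f.toSubmodule = q ⊓ g := rfl
  let d : ReductiveDescription k :=
    { f := f
      f_le := by rw [hf]; exact inf_le_left
      -- Were all of `f` compact, the hermitian part of any element would come from `𝔫` and have
      -- zero diagonal, so the direction of `A0 k` could not be reached.
      f_proj := by
        intro h
        obtain ⟨D, hD, hDA⟩ := ht.transitive _ (A0_mem_su k)
        obtain ⟨F, hF, N, ⟨v, b, rfl⟩, rfl⟩ := hdec D hD
        have hF' : Fᴴ = -F := conjTranspose_of_mem_compactPart (h hF)
        rw [Matrix.conjTranspose_add, hF', A0_conjTranspose] at hDA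
        have h1 : nilMat v b + (nilMat v b)ᴴ = A0 k + A0 k := by
          rw [← hDA]; abel
        have := congrFun (congrFun h1 (Sum.inr 0)) (Sum.inr 0)
        simp [nilMat, A0] at this
        norm_num at this
      m := m
      disjoint := by
        rw [Submodule.disjoint_def]
        rintro A ⟨hA, hAC⟩ hAm
        have hv := hvC A hAC
        have hz : conjL x A = 0 := by
          apply eq_zero_of_generator_rho hp hAm.1 hv
          intro V
          have := hAm.2 V
          rw [hv, map_zero] at this
          exact this
        rw [conjL_apply] at hz
        have h2 : x⁻¹ * (x * A * x⁻¹) * x = A := by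
          rw [mul_assoc, mul_assoc, hx.inv_mul, mul_one, ← mul_assoc, hx.inv_mul, one_mul]
        rw [← h2, hz, mul_zero, zero_mul]
      sup_eq := by
        rw [hf]
        -- Subtracting the transvection with the same velocity leaves a skew-hermitian element,
        -- which lies in the compact part.
        have hgle : g ≤ (q ⊓ g ⊓ compactPart k) ⊔ m := by
          intro A hA
          obtain ⟨B, hB, hBv⟩ := hS.exists_transvection hμ hp (generator (conjL x A) p)
          have hBm : x⁻¹ * B * x ∈ m := by
            rw [hm, Submodule.mem_comap, hx.conjL_inv]; exact hB
          have hABg : A - x⁻¹ * B * x ∈ g := g.sub_mem hA (hmg hBm)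
          have h1 := (hv0 _ (ht.le_su hABg)).1 (by
            rw [map_sub, hx.conjL_inv, map_sub, genL_apply, genL_apply, hBv, sub_self])
          have h2 := mem_compactPart_of_skew (hle hABg) h1
          rw [← sub_add_cancel A (x⁻¹ * B * x)]
          exact Submodule.add_mem_sup ⟨⟨(le_sup_left : compactPart k ≤ q) h2, hABg⟩, h2⟩ hBm
        apply le_antisymm
        · refine sup_le (inf_le_left.trans le_sup_left) ?_
          intro A hA
          obtain ⟨F, hF, N, hN, rfl⟩ := hdec A (hmg hA)
          exact Submodule.add_mem_sup hF hN
        · exact sup_le (inf_le_right.trans hgle) (hn.trans hgle)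
      -- For `U` with zero velocity at `p` the curvature term of `rho_lie` disappears, so bracketing
      -- with `U` acts on velocities and derivatives through `rho`; as `U` kills `S p`, the relation
      -- defining transvections is preserved.
      invariant := by
        rw [hf]
        rintro U ⟨⟨hUq, hUg⟩, hUC⟩ B hB
        obtain ⟨hU1, hU2⟩ := hUg
        obtain ⟨hB1, hB2⟩ := hB
        have hv := hvC U hUC
        have hU3 : Kills (S p) (rhoL p (conjL x U)) := by
          intro X Y
          have := hU2 X Y
          simpa [hv] using this
        rw [hm, Submodule.mem_comap, hx.conjL_lie]
        refine ⟨lie_mem_su hU1 hB1, fun Z => ?_⟩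
        have e1 : genL p ⁅conjL x U, conjL x B⁆ = rhoL p (conjL x U) (genL p (conjL x B)) := by
          have h1 : genL p ⁅conjL x U, conjL x B⁆ = rhoL p (conjL x U) (genL p (conjL x B)) -
            rhoL p (conjL x B) (genL p (conjL x U)) := generator_lie h0 _ _
          rw [h1, hv, map_zero, sub_zero]
        have e2 : rhoL p ⁅conjL x U, conjL x B⁆ Z =
            rhoL p (conjL x U) (rhoL p (conjL x B) Z) -
              rhoL p (conjL x B) (rhoL p (conjL x U) Z) := by
          have hv' : generator (conjL x U) p = 0 := hv
          have e3 : ∀ V, eta p V 0 = 0 := by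
            intro V
            rw [eta, ← horL_apply p 0, map_zero]
            have := herm_smul_right 0 (hor p V) 0
            rw [zero_smul, map_zero, zero_mul] at this
            rw [this, zero_div]
          have e4 : ∀ V, eta p 0 V = 0 := by
            intro V
            rw [eta, ← horL_apply p 0, map_zero]
            have := herm_smul_left 0 0 (hor p V)
            rw [zero_smul, zero_mul] at this
            rw [this, zero_div]
          have h1 := rho_lie h0 hU1 hB1 Z
          rw [hv', smul_zero, e3, e3, e4, zero_smul, sub_zero, sub_zero, zero_smul, add_zero,
            sub_zero] at h1
          exact h1
        rw [e1, e2, hB2, hB2, hU3]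
        abel }
  refine ⟨d, x, hxp, (isCanonicalFor_iff hp hxp).2 ?_⟩
  intro B hB C _
  exact hB.2 _

namespace ReductiveDescription

variable {k : ℕ} (d : ReductiveDescription k)

theorem m_le : d.m ≤ d.f.toSubmodule ⊔ nilPart k := by
  rw [← d.sup_eq]; exact le_sup_right

end ReductiveDescription

/-! ### The trace of the adjoint action -/

theorem lie_compactMat_nilMat {k : ℕ} {U : Matrix (Fin k) (Fin k) ℂ} (c : ℝ) (v : Fin k → ℂ)
    (b : ℝ) (hU : Uᴴ = -U) :
    ⁅compactMat U c, nilMat v b⁆ = nilMat (U *ᵥ v - (Complex.I * c) • v) 0 := by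
  have hU' : ∀ i j, conj (U i j) = -U j i := fun i j => congrFun (congrFun hU j) i
  rw [Ring.lie_def]
  ext i j
  rcases i with i | i <;> rcases j with j | j <;>
    [skip; fin_cases j; fin_cases i; (fin_cases i <;> fin_cases j)] <;>
    simp [compactMat, nilMat, Matrix.mul_apply, Matrix.mulVec, dotProduct, map_sum, hU']
  · ring
  · simp only [mul_comm]
  · ring

theorem lie_nilMat_nilMat {k : ℕ} (v w : Fin k → ℂ) (b e : ℝ) :
    ⁅nilMat v b, nilMat w e⁆ = nilMat 0 (2 * (star w ⬝ᵥ v).im) := by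
  rw [Ring.lie_def]
  ext i j
  rcases i with i | i <;> rcases j with j | j <;>
    [skip; fin_cases j; fin_cases i; (fin_cases i <;> fin_cases j)] <;>
    simp [nilMat, Matrix.mul_apply, dotProduct]
  apply Complex.ext
  · simp [mul_comm]
  · simp [Finset.mul_sum]
    rw [← Finset.sum_neg_distrib, ← Finset.sum_add_distrib]
    exact Finset.sum_congr rfl fun i _ => by ring

theorem lie_mem_nilPart {k : ℕ} {D N : Mat k}
    (hD : D ∈ (compactPart k ⊔ Submodule.span ℝ {A0 k}) ⊔ nilPart k) (hN : N ∈ nilPart k) :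
    ⁅D, N⁆ ∈ nilPart k := by
  obtain ⟨F, hF, _, ⟨w, e, rfl⟩, rfl⟩ := Submodule.mem_sup.1 hD
  obtain ⟨_, ⟨U, c, hU, -, rfl⟩, t, rfl⟩ := mem_compact_sup_A0.1 hF
  obtain ⟨v, b, rfl⟩ := hN
  rw [add_lie, add_lie, smul_lie, lie_compactMat_nilMat c v b hU, lie_A0_nilMat, lie_nilMat_nilMat]
  exact add_mem (add_mem ⟨_, _, rfl⟩ (Submodule.smul_mem _ _ ⟨_, _, rfl⟩)) ⟨_, _, rfl⟩

/-- Brackets have no component along `A0 k`, because the compact part commutes with it and `𝔫` is an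
ideal. -/
theorem lie_mem_compact_sup_nil {k : ℕ} {D D' : Mat k}
    (hD : D ∈ (compactPart k ⊔ Submodule.span ℝ {A0 k}) ⊔ nilPart k)
    (hD' : D' ∈ (compactPart k ⊔ Submodule.span ℝ {A0 k}) ⊔ nilPart k) :
    ⁅D, D'⁆ ∈ compactPart k ⊔ nilPart k := by
  obtain ⟨F', hF', N', hN', rfl⟩ := Submodule.mem_sup.1 hD'
  obtain ⟨F, hF, N, hN, rfl⟩ := Submodule.mem_sup.1 hD
  have h1 := lie_mem_nilPart hD hN'
  have h2 := lie_mem_nilPart (Submodule.mem_sup_left (T := nilPart k) hF') hN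
  have h3 : ⁅F + N, F' + N'⁆ = ⁅F, F'⁆ + (⁅F + N, N'⁆ - ⁅F', N⁆) := by
    rw [lie_add, add_lie F N F', ← lie_skew N F']
    abel
  rw [h3]
  exact Submodule.add_mem_sup (lie_mem_compact_sup_A0 hF hF') (sub_mem h1 h2)

/-- The coordinates of the `𝔞 + 𝔫`-part. -/
def solvCoord (k : ℕ) : Mat k →ₗ[ℝ] E k where
  toFun A := (fun i => A (Sum.inl i) (Sum.inr 1),
    ⟨(A (Sum.inr 0) (Sum.inr 0)).re, (A (Sum.inr 0) (Sum.inr 1)).im⟩)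
  map_add' A B := by
    refine Prod.ext rfl (Complex.ext ?_ ?_) <;> simp
  map_smul' r A := by
    refine Prod.ext ?_ (Complex.ext ?_ ?_)
    · funext i; simp
    · simp
    · simp

theorem solvCoord_compact {k : ℕ} {C : Mat k} (hC : C ∈ compactPart k) : solvCoord k C = 0 := by
  obtain ⟨U, c, -, -, rfl⟩ := hC
  refine Prod.ext ?_ (Complex.ext ?_ ?_)
  · funext i; simp [solvCoord, compactMat]
  · simp [solvCoord, compactMat]
  · simp [solvCoord, compactMat]

theorem solvCoord_nilMat {k : ℕ} (v : Fin k → ℂ) (b : ℝ) :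
    solvCoord k (nilMat v b) = (v, ⟨0, b⟩) := by
  refine Prod.ext ?_ (Complex.ext ?_ ?_)
  · funext i; simp [solvCoord, nilMat]
  · simp [solvCoord, nilMat]
  · simp [solvCoord, nilMat]

theorem solvCoord_A0 (k : ℕ) : solvCoord k (A0 k) = (0, 1) := by
  refine Prod.ext ?_ (Complex.ext ?_ ?_)
  · funext i; simp [solvCoord, A0]
  · simp [solvCoord, A0]
  · simp [solvCoord, A0]

theorem mem_compact_of_solvCoord {k : ℕ} {D : Mat k}
    (hD : D ∈ (compactPart k ⊔ Submodule.span ℝ {A0 k}) ⊔ nilPart k) (h : solvCoord k D = 0) :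
    D ∈ compactPart k := by
  obtain ⟨F, hF, N, ⟨v, b, rfl⟩, rfl⟩ := Submodule.mem_sup.1 hD
  obtain ⟨C, hC, t, rfl⟩ := mem_compact_sup_A0.1 hF
  rw [map_add, map_add, map_smul, solvCoord_compact hC, solvCoord_A0, solvCoord_nilMat] at h
  have hv : v = 0 := by simpa using congrArg Prod.fst h
  have ht : t = 0 := by simpa using congrArg (fun y : E k => y.2.re) h
  have hb : b = 0 := by simpa using congrArg (fun y : E k => y.2.im) h
  have h0 : (nilMat 0 0 : Mat k) = 0 := by rw [nilMat_center_smul, zero_smul]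
  rw [hv, hb, ht, h0, zero_smul, add_zero, add_zero]
  exact hC

theorem trace_prod_eq {V W : Type*} [AddCommGroup V] [Module ℝ V] [FiniteDimensional ℝ V]
    [AddCommGroup W] [Module ℝ W] [FiniteDimensional ℝ W] (F : V × W →ₗ[ℝ] V × W) :
    LinearMap.trace ℝ (V × W) F =
      LinearMap.trace ℝ V (LinearMap.fst ℝ V W ∘ₗ F ∘ₗ LinearMap.inl ℝ V W) +
        LinearMap.trace ℝ W (LinearMap.snd ℝ V W ∘ₗ F ∘ₗ LinearMap.inr ℝ V W) := by
  have h : F = (F ∘ₗ LinearMap.inl ℝ V W) ∘ₗ LinearMap.fst ℝ V W +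
      (F ∘ₗ LinearMap.inr ℝ V W) ∘ₗ LinearMap.snd ℝ V W := by
    refine LinearMap.ext fun y => ?_
    simp [← map_add]
  conv_lhs => rw [h]
  rw [map_add, LinearMap.trace_comp_comm', LinearMap.trace_comp_comm' (LinearMap.snd ℝ V W)]

theorem trace_complex (F : ℂ →ₗ[ℝ] ℂ) :
    LinearMap.trace ℝ ℂ F = (F 1).re + (F Complex.I).im := by
  rw [LinearMap.trace_eq_matrix_trace ℝ Complex.basisOneI, Matrix.trace, Fin.sum_univ_two]
  simp [LinearMap.toMatrix_apply]

/-- Skew-hermitian operators have zero real trace, so only the dilation by `t` on a space of real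
dimension `2k` counts. -/
theorem trace_of_skewHermitian {k : ℕ} {U : Matrix (Fin k) (Fin k) ℂ} (hU : Uᴴ = -U) (c t : ℝ)
    (F : (Fin k → ℂ) →ₗ[ℝ] (Fin k → ℂ))
    (hF : ∀ v, F v = U *ᵥ v - (Complex.I * c) • v + t • v) :
    LinearMap.trace ℝ _ F = 2 * k * t := by
  let B : (Fin k → ℂ) →ₗ[ℝ] (Fin k → ℂ) →ₗ[ℝ] ℝ :=
    LinearMap.mk₂ ℝ (fun v w => (star w ⬝ᵥ v).re) (by intros; simp) (by intros; simp)
      (by intros; simp) (by intros; simp)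
  have hB : ∀ v w, B v w = (star w ⬝ᵥ v).re := fun _ _ => rfl
  have h1 : LinearMap.trace ℝ _ (F - t • LinearMap.id) = 0 := by
    apply trace_eq_zero_of_skew B
    · intro x y
      rw [hB, hB, ← Complex.conj_re]
      congr 1
      simp [dotProduct, mul_comm]
    · intro x hx
      rw [hB, star_dotProduct_self, Complex.ofReal_re]
      obtain ⟨i, hi⟩ := Function.ne_iff.1 hx
      exact Finset.sum_pos' (fun i _ => Complex.normSq_nonneg _)
        ⟨i, Finset.mem_univ i, Complex.normSq_pos.2 hi⟩
    · intro x
      have e1 : (star x ⬝ᵥ U *ᵥ x).re = 0 := by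
        have : star (star x ⬝ᵥ U *ᵥ x) = -(star x ⬝ᵥ U *ᵥ x) := by
          rw [← Matrix.star_dotProduct, Matrix.star_mulVec, hU, ← Matrix.dotProduct_mulVec]
          simp [Matrix.neg_mulVec]
        have h2 := congrArg Complex.re this
        simp at h2
        linarith
      rw [hB]
      simp only [LinearMap.sub_apply, hF, LinearMap.smul_apply, LinearMap.id_apply, add_sub_cancel_right,
        dotProduct_sub, dotProduct_smul, Complex.sub_re, e1, star_dotProduct_self]
      simp
  rw [map_sub, map_smul, LinearMap.trace_id, sub_eq_zero] at h1
  rw [h1, Module.finrank_pi_fintype]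
  simp [Complex.finrank_real_complex]
  ring

/-! ### The trace `c₁₂` of a homogeneous Kähler structure -/

namespace ReductiveDescription

variable {k : ℕ} (d : ReductiveDescription k)

theorem f_sup_nil_le : d.f.toSubmodule ⊔ nilPart k ≤
    (compactPart k ⊔ Submodule.span ℝ {A0 k}) ⊔ nilPart k :=
  sup_le_sup_right d.f_le _

theorem mem_isotropy_of_solvCoord {D : Mat k} (hD : D ∈ d.f.toSubmodule ⊔ nilPart k)
    (h : solvCoord k D = 0) : D ∈ d.f.toSubmodule ⊓ compactPart k := by
  have hC := mem_compact_of_solvCoord (d.f_sup_nil_le hD) h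
  obtain ⟨F, hF, N, ⟨v, b, rfl⟩, rfl⟩ := Submodule.mem_sup.1 hD
  obtain ⟨C, hC', t, rfl⟩ := mem_compact_sup_A0.1 (d.f_le hF)
  rw [map_add, map_add, map_smul, solvCoord_compact hC', solvCoord_A0, solvCoord_nilMat] at h
  have hv : v = 0 := by simpa using congrArg Prod.fst h
  have hb : b = 0 := by simpa using congrArg (fun y : E k => y.2.im) h
  have h0 : (nilMat v b : Mat k) = 0 := by rw [hv, hb, nilMat_center_smul, zero_smul]
  refine ⟨?_, hC⟩
  rw [h0, add_zero]
  exact hF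

theorem exists_mem_f : ∃ C ∈ compactPart k, C + A0 k ∈ d.f.toSubmodule := by
  obtain ⟨F, hF, hFC⟩ := Set.not_subset.1 d.f_proj
  obtain ⟨C, hC, t, rfl⟩ := mem_compact_sup_A0.1 (d.f_le hF)
  have ht : t ≠ 0 := by
    rintro rfl
    rw [zero_smul, add_zero] at hFC
    exact hFC hC
  refine ⟨t⁻¹ • C, Submodule.smul_mem _ _ hC, ?_⟩
  have := Submodule.smul_mem _ t⁻¹ hF
  rwa [smul_add, inv_smul_smul₀ ht] at this

/-- The linear lift of the coordinates with values in the span of `F` and `𝔫`. -/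
def solvLift (F : Mat k) : E k →ₗ[ℝ] Mat k where
  toFun y := y.2.re • F + nilMat y.1 y.2.im
  map_add' y z := by
    simp only [Prod.fst_add, Prod.snd_add, Complex.add_re, Complex.add_im, nilMat_add]
    module
  map_smul' r y := by
    simp only [Prod.smul_fst, Prod.smul_snd, Complex.smul_re, Complex.smul_im, smul_eq_mul,
      nilMat_smul, RingHom.id_apply]
    module

theorem solvCoord_solvLift {C : Mat k} (hC : C ∈ compactPart k) (y : E k) :
    solvCoord k (solvLift (C + A0 k) y) = y := by
  change solvCoord k (y.2.re • (C + A0 k) + nilMat y.1 y.2.im) = y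
  rw [map_add, map_smul, map_add, solvCoord_compact hC, solvCoord_A0, solvCoord_nilMat]
  refine Prod.ext ?_ (Complex.ext ?_ ?_) <;> simp

/-- The lifted `A0 k` direction contributes nothing, as brackets have no `A0 k` component. The root
`1` contributes `2k` and the root `2` contributes `2`, each times `alpha D`, in total `2(k + 1)`. -/
theorem trace_lie_solvLift {C D : Mat k} (hC : C ∈ compactPart k)
    (hD : D ∈ (compactPart k ⊔ Submodule.span ℝ {A0 k}) ⊔ nilPart k) :
    LinearMap.trace ℝ (E k)
      (solvCoord k ∘ₗ LieAlgebra.ad ℝ (Mat k) D ∘ₗ solvLift (C + A0 k)) =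
      2 * ((k + 1 : ℕ) : ℝ) * alpha D := by
  have hF : C + A0 k ∈ (compactPart k ⊔ Submodule.span ℝ {A0 k}) ⊔ nilPart k :=
    Submodule.mem_sup_left (Submodule.add_mem_sup hC (Submodule.mem_span_singleton_self _))
  have hre : (solvCoord k ⁅D, C + A0 k⁆).2.re = 0 := by
    obtain ⟨C', hC', N, ⟨v, b, rfl⟩, h⟩ := Submodule.mem_sup.1 (lie_mem_compact_sup_nil hD hF)
    rw [← h, map_add, solvCoord_compact hC', solvCoord_nilMat]
    simp
  obtain ⟨F, hF, N, hN, rfl⟩ := Submodule.mem_sup.1 hD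
  obtain ⟨C', hC', t, rfl⟩ := mem_compact_sup_A0.1 hF
  rw [alpha_eq hC' hN]
  obtain ⟨U, c, hU, -, rfl⟩ := hC'
  obtain ⟨w, e, rfl⟩ := hN
  have hnil : ∀ v b, solvCoord k ⁅compactMat U c + t • A0 k + nilMat w e, nilMat v b⁆ =
      (U *ᵥ v - (Complex.I * c) • v + t • v, ⟨0, t * (2 * b) + 2 * (star v ⬝ᵥ w).im⟩) := by
    intro v b
    rw [add_lie, add_lie, smul_lie, lie_compactMat_nilMat c v b hU, lie_A0_nilMat,
      lie_nilMat_nilMat, ← nilMat_smul, ← nilMat_add, ← nilMat_add, solvCoord_nilMat]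
    simp
  rw [trace_prod_eq, trace_of_skewHermitian hU c t, trace_complex]
  · have h1 : solvLift (C + A0 k) (0, 1) = C + A0 k := by
      change (1 : ℝ) • (C + A0 k) + nilMat 0 0 = _
      rw [one_smul, nilMat_center_smul, zero_smul, add_zero]
    have h2 : solvLift (C + A0 k) (0, Complex.I) = nilMat 0 1 := by
      change (Complex.I.re) • (C + A0 k) + nilMat 0 Complex.I.im = _
      simp
    simp only [LinearMap.comp_apply, LinearMap.inr_apply, LinearMap.snd_apply, h1, h2,
      LieAlgebra.ad_apply, hre, hnil]
    simp
    ring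
  · intro v
    have h1 : solvLift (C + A0 k) (v, 0) = nilMat v 0 := by
      change (0 : ℝ) • (C + A0 k) + nilMat v 0 = _
      rw [zero_smul, zero_add]
    simp only [LinearMap.comp_apply, LinearMap.inl_apply, LinearMap.fst_apply, h1,
      LieAlgebra.ad_apply, hnil]

/-- The linear inverse of the coordinates on `𝔪`. -/
theorem exists_lift_m : ∃ β : E k →ₗ[ℝ] Mat k, (∀ y, β y ∈ d.m) ∧
    (∀ y, solvCoord k (β y) = y) ∧ ∀ B ∈ d.m, β (solvCoord k B) = B := by
  obtain ⟨C, hC, hF⟩ := d.exists_mem_f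
  have hinj : Function.Injective ((solvCoord k).domRestrict d.m) := by
    rw [← LinearMap.ker_eq_bot, LinearMap.ker_eq_bot']
    rintro ⟨B, hB⟩ h
    have h1 := d.mem_isotropy_of_solvCoord (d.m_le hB) h
    exact Subtype.ext (Submodule.disjoint_def.1 d.disjoint B h1 hB)
  have hsurj : Function.Surjective ((solvCoord k).domRestrict d.m) := by
    intro y
    have h1 : solvLift (C + A0 k) y ∈ d.f.toSubmodule ⊔ nilPart k :=
      Submodule.add_mem_sup (Submodule.smul_mem _ _ hF) ⟨_, _, rfl⟩
    rw [← d.sup_eq] at h1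
    obtain ⟨H, hH, B, hB, h2⟩ := Submodule.mem_sup.1 h1
    refine ⟨⟨B, hB⟩, ?_⟩
    have h3 := solvCoord_solvLift hC y
    rwa [← h2, map_add, solvCoord_compact hH.2, zero_add] at h3
  let ψ := LinearEquiv.ofBijective _ ⟨hinj, hsurj⟩
  refine ⟨d.m.subtype ∘ₗ ψ.symm.toLinearMap, fun y => (ψ.symm y).2, fun y => ψ.apply_symm_apply y,
    fun B hB => ?_⟩
  exact congrArg Subtype.val (ψ.symm_apply_apply ⟨B, hB⟩)

/-- The lifts through `𝔪` and through `F + 𝔫` differ by isotropy elements. By cyclicity the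
discrepancy is the trace of an endomorphism of the isotropy algebra, which turns out to be `ad` of
the compact part of `D` and so is skew for `ip`. -/
theorem trace_lie_lift_m {β : E k →ₗ[ℝ] Mat k} (hβ : ∀ y, β y ∈ d.m)
    (hβ1 : ∀ y, solvCoord k (β y) = y) (hβ2 : ∀ B ∈ d.m, β (solvCoord k B) = B) {D : Mat k}
    (hD : D ∈ d.m) :
    LinearMap.trace ℝ (E k) (solvCoord k ∘ₗ LieAlgebra.ad ℝ (Mat k) D ∘ₗ β) =
      2 * ((k + 1 : ℕ) : ℝ) * alpha D := by
  obtain ⟨C, hC, hF⟩ := d.exists_mem_f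
  have hDg := d.f_sup_nil_le (d.m_le hD)
  set h := d.f.toSubmodule ⊓ compactPart k with hh
  have hmem : ∀ y, (β - solvLift (C + A0 k)) y ∈ h := by
    intro y
    apply d.mem_isotropy_of_solvCoord
    · exact sub_mem (d.m_le (hβ y)) (Submodule.add_mem_sup (Submodule.smul_mem _ _ hF) ⟨_, _, rfl⟩)
    · rw [LinearMap.sub_apply, map_sub, hβ1, solvCoord_solvLift hC, sub_self]
  let P : E k →ₗ[ℝ] h := LinearMap.codRestrict h (β - solvLift (C + A0 k)) hmem
  have hsplit : solvCoord k ∘ₗ LieAlgebra.ad ℝ (Mat k) D ∘ₗ β =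
      solvCoord k ∘ₗ LieAlgebra.ad ℝ (Mat k) D ∘ₗ solvLift (C + A0 k) +
      (solvCoord k ∘ₗ LieAlgebra.ad ℝ (Mat k) D ∘ₗ h.subtype) ∘ₗ P := by
    refine LinearMap.ext fun y => ?_
    simp [P]
  rw [hsplit, map_add, trace_lie_solvLift hC hDg, LinearMap.trace_comp_comm', add_eq_left]
  apply trace_eq_zero_of_skew (ipOn h) (fun x y => ip_comm _ _)
    (fun x hx => ip_self_pos (by simpa using hx))
  rintro ⟨u, hu⟩
  rw [ipOn_apply]
  change ip (β (solvCoord k ⁅D, u⁆) - solvLift (C + A0 k) (solvCoord k ⁅D, u⁆)) u = 0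
  have h1 : ⁅D, u⁆ ∈ d.m := by
    rw [← lie_skew]
    exact neg_mem (d.invariant u hu D hD)
  rw [hβ2 _ h1]
  obtain ⟨F, hF', N, hN, rfl⟩ := Submodule.mem_sup.1 hDg
  obtain ⟨C', hC', t, rfl⟩ := mem_compact_sup_A0.1 hF'
  have h2 : ⁅A0 k, u⁆ = 0 := lie_A0_of_mem_compactPart hu.2
  have h3 : ⁅N, u⁆ ∈ nilPart k := by
    rw [← lie_skew]
    exact neg_mem (lie_mem_nilPart (Submodule.mem_sup_left (Submodule.mem_sup_left hu.2)) hN)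
  have h4 : ∀ A ∈ nilPart k, solvLift (C + A0 k) (solvCoord k A) = A := by
    rintro _ ⟨v, b, rfl⟩
    rw [solvCoord_nilMat]
    change (0 : ℝ) • (C + A0 k) + nilMat v b = _
    rw [zero_smul, zero_add]
  rw [add_lie, add_lie, smul_lie, h2, smul_zero, add_zero, map_add, solvCoord_compact
    (lie_mem_compactPart hC' hu.2), zero_add, h4 _ h3, add_sub_cancel_right]
  have h5 := ip_lie C' u u
  rw [conjTranspose_of_mem_compactPart hC', neg_lie, map_neg, ip_comm u] at h5
  linarith

end ReductiveDescription

/-! ### Orthonormal bases of the tangent space and the trace formula for `c₁₂`. -/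

theorem finrank_E (k : ℕ) : Module.finrank ℝ (E k) = 2 * (k + 1) := by
  rw [Module.finrank_prod, Module.finrank_pi_fintype]
  simp [Complex.finrank_real_complex]
  ring

namespace IsOrthonormalBasis

variable {k : ℕ} {b : E k →ₗ[ℝ] E k →ₗ[ℝ] ℝ} {e : Fin (2 * (k + 1)) → E k}

theorem exists_basis (he : IsOrthonormalBasis b e) :
    ∃ e' : Module.Basis (Fin (2 * (k + 1))) ℝ (E k), ∀ i, e' i = e i := by
  have hli : LinearIndependent ℝ e := by
    rw [Fintype.linearIndependent_iff]
    intro c hc i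
    have := congrArg (fun x => b x (e i)) hc
    simpa [he _ _] using this
  exact ⟨basisOfLinearIndependentOfCardEqFinrank hli (by rw [finrank_E, Fintype.card_fin]), fun i => by simp⟩

theorem eq_sum (he : IsOrthonormalBasis b e) (x : E k) : x = ∑ i, b x (e i) • e i := by
  obtain ⟨e', he'⟩ := he.exists_basis
  have := eq_sum_of_orthonormal b e' (fun i j => by rw [he', he', he]) x
  simpa only [he'] using this

theorem trace_eq (he : IsOrthonormalBasis b e) (T : E k →ₗ[ℝ] E k) :
    LinearMap.trace ℝ (E k) T = ∑ i, b (T (e i)) (e i) := by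
  obtain ⟨e', he'⟩ := he.exists_basis
  have := trace_eq_sum_of_orthonormal b e' (fun i j => by rw [he', he', he]) T
  simpa only [he'] using this

end IsOrthonormalBasis

/-- By skewness `c₁₂(S)(w)` is minus the trace of `X ↦ S_X w`. This map differs from `S_w`, which is
traceless, by `ad D` transported to the tangent space, and the trace of the latter is
`trace_lie_lift_m`. -/
theorem IsHomogeneousKahlerStructure.c12_eq {k : ℕ} {μ : ℝ} (hμ : 0 < μ) {S : TensorField12 k}
    (hS : IsHomogeneousKahlerStructure μ S) {p : E k} (hp : p ∈ CH k) {d : ReductiveDescription k}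
    {x : Mat k} (hx : MovesBaseTo x p) (hc : IsCanonicalFor S d x p)
    {e : Fin (2 * (k + 1)) → E k} (he : IsOrthonormalBasis (metric μ p) e) {D : Mat k}
    (hD : D ∈ d.m) :
    c12 e (lower μ S p) (toTangent x p D) = 2 * ((k + 1 : ℕ) : ℝ) * alpha D := by
  have h0 := herm_lift_ne_zero hp
  obtain ⟨β, hβ, hβ1, hβ2⟩ := d.exists_lift_m
  obtain ⟨c, hc0, hxc⟩ := hx.exists_ne_zero
  set w := genL p (conjL x D) with hw
  have hle : d.m ≤ (compactPart k ⊔ Submodule.span ℝ {A0 k}) ⊔ nilPart k :=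
    d.m_le.trans d.f_sup_nil_le
  -- The compact part fixes the base point, so velocities depend only on the `𝔞 + 𝔫` coordinates;
  -- this identifies the tangent space with those coordinates through `Φ`.
  have hv : ∀ A ∈ (compactPart k ⊔ Submodule.span ℝ {A0 k}) ⊔ nilPart k,
      genL p (conjL x A) = genL p (conjL x (β (solvCoord k A))) := by
    intro A hA
    have h1 : A - β (solvCoord k A) ∈ compactPart k :=
      mem_compact_of_solvCoord (sub_mem hA (hle (hβ _))) (by rw [map_sub, hβ1, sub_self])
    rw [← sub_eq_zero, ← map_sub, ← map_sub]
    refine (generator_conj_eq_zero_iff hx.isUnitaryHerm hc0 hxc (compactPart_le_su k h1)).2 ?_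
    rw [conjTranspose_of_mem_compactPart h1, add_neg_cancel]
  let φ : E k →ₗ[ℝ] E k := genL p ∘ₗ conjL x ∘ₗ β
  have hinj : Function.Injective φ := by
    rw [← LinearMap.ker_eq_bot, LinearMap.ker_eq_bot']
    intro y hy
    have h1 := (generator_conj_eq_zero_iff hx.isUnitaryHerm hc0 hxc
      (compact_sup_A0_sup_nil_le_su k (hle (hβ y)))).1 hy
    have h2 := solvCoord_compact (mem_compactPart_of_skew (hle (hβ y)) h1)
    rwa [hβ1] at h2
  let Φ := LinearEquiv.ofInjectiveEndo φ hinj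
  have hΦ : ∀ y, Φ y = genL p (conjL x (β y)) := fun _ => rfl
  set L : E k →ₗ[ℝ] E k := solvCoord k ∘ₗ LieAlgebra.ad ℝ (Mat k) D ∘ₗ β with hL
  -- Torsion-freeness of `∇`: for `B` in `𝔪` with velocity `X`, the velocity of `⁅D, B⁆` is `S_w X -
  -- S_X w`.
  have key : ∀ X, S p X w = S p w X - Φ (L (Φ.symm X)) := by
    intro X
    obtain ⟨y, rfl⟩ := Φ.surjective X
    have hcan := (isCanonicalFor_iff hp hx).1 hc
    have hlie : genL p ⁅conjL x D, conjL x (β y)⁆ =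
        rhoL p (conjL x D) (genL p (conjL x (β y))) - rhoL p (conjL x (β y)) w :=
      generator_lie h0 _ _
    have h2 : Φ (L y) = genL p ⁅conjL x D, conjL x (β y)⁆ := by
      rw [hΦ, ← hx.isUnitaryHerm.conjL_lie]
      have h3 : ⁅D, β y⁆ ∈ (compactPart k ⊔ Submodule.span ℝ {A0 k}) ⊔ nilPart k :=
        (sup_le_sup_right le_sup_left (nilPart k) :
          compactPart k ⊔ nilPart k ≤ _) (lie_mem_compact_sup_nil (hle hD) (hle (hβ y)))
      exact (hv _ h3).symm
    rw [Φ.symm_apply_apply, h2, hlie, hΦ, hcan _ (hβ y) _ hD, hcan _ hD _ (hβ y)]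
    abel
  have htr : LinearMap.trace ℝ (E k) (S p w : E k →ₗ[ℝ] E k) = 0 := by
    apply trace_eq_zero_of_skew (metric μ p) (metric_symm μ p) (fun _ h => metric_self_pos hμ hp h)
    intro y
    have := hS.metric_skew hp w y y
    rw [metric_symm μ p y] at this
    change metric μ p (S p w y) y = 0
    linarith
  have h1 : c12 e (lower μ S p) w =
      LinearMap.trace ℝ (E k) (Φ.conj L - (S p w : E k →ₗ[ℝ] E k)) := by
    rw [he.trace_eq]
    refine Finset.sum_congr rfl fun i _ => ?_
    change metric μ p (S p (e i) (e i)) w = metric μ p (Φ (L (Φ.symm (e i))) - S p w (e i)) (e i)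
    rw [hS.metric_skew hp, key, metric_symm μ p, map_sub, map_sub]
    simp
  change c12 e (lower μ S p) w = _
  rw [h1, map_sub, htr, sub_zero, LinearMap.trace_conj', d.trace_lie_lift_m hβ hβ1 hβ2 hD]

/-! ### The orthogonal complement of the kernel of `c₁₂` -/

/-- The complex structure as a linear map. -/
def JL (k : ℕ) : E k →ₗ[ℝ] E k where
  toFun := J
  map_add' X Y := smul_add _ X Y
  map_smul' r X := smul_comm _ r X

theorem J_J {k : ℕ} (X : E k) : J (J X) = -X := by
  simp [J, smul_smul]

/-- The sum of the `𝒦₂`- and the `𝒦₄`-tensor given by half of the functional `θ`. -/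
def vectorTensor {k : ℕ} (b : E k →ₗ[ℝ] E k →ₗ[ℝ] ℝ) (θ : E k →ₗ[ℝ] ℝ) : Tensor3 k :=
  LinearMap.mk₂ ℝ
    (fun X Y => b X Y • θ - θ Y • b X + b X (JL k Y) • (θ ∘ₗ JL k) - θ (JL k Y) • (b X ∘ₗ JL k))
    (by intro X X' Y; simp only [map_add, LinearMap.add_apply, LinearMap.add_comp]; module)
    (by
      intro r X Y
      simp only [map_smul, LinearMap.smul_apply, LinearMap.smul_comp, smul_eq_mul]
      module)
    (by intro X Y Y'; simp only [map_add]; module)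
    (by intro r X Y; simp only [map_smul, smul_eq_mul]; module)

theorem vectorTensor_apply {k : ℕ} (b : E k →ₗ[ℝ] E k →ₗ[ℝ] ℝ) (θ : E k →ₗ[ℝ] ℝ) (X Y Z : E k) :
    vectorTensor b θ X Y Z =
      b X Y * θ Z - b X Z * θ Y + b X (J Y) * θ (J Z) - b X (J Z) * θ (J Y) := by
  change b X Y * θ Z - θ Y * b X Z + b X (J Y) * θ (J Z) - θ (J Y) * b X (J Z) = _
  ring

theorem vectorTensor_mem_KTensor {k : ℕ} (b : E k →ₗ[ℝ] E k →ₗ[ℝ] ℝ) (θ : E k →ₗ[ℝ] ℝ) :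
    vectorTensor b θ ∈ KTensor k := by
  intro X Y Z
  simp only [vectorTensor_apply, J_J, map_neg]
  constructor <;> ring

/-- The tensor `2 b(J Y, Z) θ(J X)`. -/
def kahlerTensor {k : ℕ} (b : E k →ₗ[ℝ] E k →ₗ[ℝ] ℝ) (θ : E k →ₗ[ℝ] ℝ) : Tensor3 k :=
  LinearMap.mk₂ ℝ (fun X Y => (2 * θ (JL k X)) • b (JL k Y))
    (by intro X X' Y; simp only [map_add]; module)
    (by intro r X Y; simp only [map_smul, smul_eq_mul]; module)
    (by intro X Y Y'; simp only [map_add]; module)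
    (by intro r X Y; simp only [map_smul]; module)

theorem kahlerTensor_apply {k : ℕ} (b : E k →ₗ[ℝ] E k →ₗ[ℝ] ℝ) (θ : E k →ₗ[ℝ] ℝ) (X Y Z : E k) :
    kahlerTensor b θ X Y Z = 2 * b (J Y) Z * θ (J X) := by
  change 2 * θ (J X) * b (J Y) Z = _
  ring

theorem sub_mem_KTensor {k : ℕ} {T T' : Tensor3 k} (h : T ∈ KTensor k) (h' : T' ∈ KTensor k) :
    T - T' ∈ KTensor k := by
  intro X Y Z
  obtain ⟨h1, h2⟩ := h X Y Z
  obtain ⟨h3, h4⟩ := h' X Y Z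
  simp only [LinearMap.sub_apply, h2, h4]
  exact ⟨by rw [h1, h3]; ring, trivial⟩

theorem c12_sub {k : ℕ} (e : Fin (2 * (k + 1)) → E k) (T T' : Tensor3 k) (Z : E k) :
    c12 e (T - T') Z = c12 e T Z - c12 e T' Z := by
  simp [c12]

theorem tensorInner_comm {k : ℕ} (e : Fin (2 * (k + 1)) → E k) (T T' : Tensor3 k) :
    tensorInner e T T' = tensorInner e T' T := by
  simp only [tensorInner, mul_comm]

theorem tensorInner_sub_left {k : ℕ} (e : Fin (2 * (k + 1)) → E k) (T T' T'' : Tensor3 k) :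
    tensorInner e (T - T') T'' = tensorInner e T T'' - tensorInner e T' T'' := by
  simp [tensorInner, sub_mul]

/-- A scalar product for which the complex structure is an isometry. -/
structure IsHermitianProduct {k : ℕ} (b : E k →ₗ[ℝ] E k →ₗ[ℝ] ℝ) : Prop where
  symm : ∀ X Y, b X Y = b Y X
  pos : ∀ X, X ≠ 0 → 0 < b X X
  J_J : ∀ X Y, b (J X) (J Y) = b X Y

theorem isHermitianProduct_metric {k : ℕ} {μ : ℝ} (hμ : 0 < μ) {p : E k} (hp : p ∈ CH k) :
    IsHermitianProduct (metric μ p) :=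
  ⟨metric_symm μ p, fun _ h => metric_self_pos hμ hp h, metric_J_J μ p⟩

theorem IsOrthonormalBasis.c12_eq_c12 {k : ℕ} {b : E k →ₗ[ℝ] E k →ₗ[ℝ] ℝ}
    (hs : ∀ X Y, b X Y = b Y X) {e e' : Fin (2 * (k + 1)) → E k} (he : IsOrthonormalBasis b e)
    (he' : IsOrthonormalBasis b e') (T : Tensor3 k) (Z : E k) : c12 e T Z = c12 e' T Z := by
  have h1 : ∀ i, T (e i) (e i) Z = ∑ j, b (e i) (e' j) * T (e' j) (e i) Z := by
    intro i
    conv_lhs => rw [show T (e i) = T (∑ j, b (e i) (e' j) • e' j) from by rw [← he'.eq_sum]]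
    simp
  have h2 : ∀ j, T (e' j) (e' j) Z = ∑ i, b (e' j) (e i) * T (e' j) (e i) Z := by
    intro j
    conv_lhs => rw [show T (e' j) (e' j) = T (e' j) (∑ i, b (e' j) (e i) • e i) from by
      rw [← he.eq_sum]]
    simp
  simp only [c12, h1, h2]
  rw [Finset.sum_comm]
  simp only [hs]

namespace IsHermitianProduct

variable {k : ℕ} {b : E k →ₗ[ℝ] E k →ₗ[ℝ] ℝ}

theorem exists_isOrthonormalBasis (hb : IsHermitianProduct b) : ∃ e, IsOrthonormalBasis b e := by
  obtain ⟨e, he⟩ := exists_orthonormalBasis_of_posDef b hb.symm hb.pos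
  refine ⟨fun i => e (Fin.cast (finrank_E k).symm i), fun i j => ?_⟩
  rw [he]
  simp

theorem J_left (hb : IsHermitianProduct b) (X Y : E k) : b (J X) Y = -b X (J Y) := by
  have := hb.J_J X (J Y)
  rw [CHn.J_J, map_neg] at this
  linarith

theorem J_self (hb : IsHermitianProduct b) (X : E k) : b X (J X) = 0 := by
  have := hb.J_left X X
  rw [hb.symm] at this
  linarith

theorem isOrthonormalBasis_J (hb : IsHermitianProduct b) {e : Fin (2 * (k + 1)) → E k}
    (he : IsOrthonormalBasis b e) : IsOrthonormalBasis b fun i => J (e i) := fun i j => by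
  rw [hb.J_J, he]

theorem kahlerTensor_mem_KTensor (hb : IsHermitianProduct b) (θ : E k →ₗ[ℝ] ℝ) :
    kahlerTensor b θ ∈ KTensor k := by
  intro X Y Z
  simp only [kahlerTensor_apply, hb.J_J]
  refine ⟨?_, trivial⟩
  rw [hb.J_left Z Y, hb.symm Z]
  ring

/-- With the same form `θ / 2` in both classes, the terms carrying `ε = ∓1` cancel and the remaining
ones double. -/
theorem vectorTensor_mem_K24 (hb : IsHermitianProduct b) (θ : E k →ₗ[ℝ] ℝ) :
    vectorTensor b θ ∈ K24 b := by
  set θ' : E k →ₗ[ℝ] ℝ := (1 / 2 : ℝ) • θ with hθ'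
  have hm := hb.kahlerTensor_mem_KTensor θ'
  have hv := vectorTensor_mem_KTensor b θ'
  have hneg : -kahlerTensor b θ' ∈ KTensor k := by
    intro X Y Z
    obtain ⟨h1, h2⟩ := hm X Y Z
    simp only [LinearMap.neg_apply, h2, h1]
    exact ⟨trivial, trivial⟩
  refine ⟨vectorTensor b θ' - kahlerTensor b θ', ⟨sub_mem_KTensor hv hm, θ', fun X Y Z => ?_⟩,
    vectorTensor b θ' - -kahlerTensor b θ', ⟨sub_mem_KTensor hv hneg, θ', fun X Y Z => ?_⟩, ?_⟩
  · simp only [LinearMap.sub_apply, vectorTensor_apply, kahlerTensor_apply]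
  · simp only [LinearMap.sub_apply, LinearMap.neg_apply, vectorTensor_apply, kahlerTensor_apply]
    ring
  · refine LinearMap.ext fun X => LinearMap.ext fun Y => LinearMap.ext fun Z => ?_
    simp only [LinearMap.add_apply, LinearMap.sub_apply, LinearMap.neg_apply, vectorTensor_apply,
      hθ', LinearMap.smul_apply, smul_eq_mul]
    ring

/-- The first term counts the real dimension `2n`, the third vanishes as `X` is orthogonal to `J X`,
and the second and fourth cancel because `J² = -1`. -/
theorem c12_vectorTensor (hb : IsHermitianProduct b) (θ : E k →ₗ[ℝ] ℝ)
    {e : Fin (2 * (k + 1)) → E k} (he : IsOrthonormalBasis b e) (Z : E k) :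
    c12 e (vectorTensor b θ) Z = 2 * ((k + 1 : ℕ) : ℝ) * θ Z := by
  have h1 : ∀ W, θ W = ∑ i, b (e i) W * θ (e i) := by
    intro W
    conv_lhs => rw [he.eq_sum W]
    simp [hb.symm W]
  have h2 : ∑ i, b (e i) (J Z) * θ (J (e i)) = -θ Z := by
    have h3 := h1 (J (J Z))
    have h4 := congrArg (θ ∘ₗ JL k) (he.eq_sum (J Z))
    rw [map_sum] at h4
    have h5 : (θ ∘ₗ JL k) (J Z) = -θ Z := by
      change θ (J (J Z)) = _
      rw [CHn.J_J, map_neg]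
    rw [← h5, h4]
    refine Finset.sum_congr rfl fun i _ => ?_
    rw [map_smul, hb.symm]
    rfl
  have h3 : ∑ i : Fin (2 * (k + 1)), b (e i) (e i) * θ Z = 2 * ((k + 1 : ℕ) : ℝ) * θ Z := by
    simp [he _ _]
  simp only [c12, vectorTensor_apply, Finset.sum_add_distrib, Finset.sum_sub_distrib, h2, h3,
    ← h1, hb.J_self, zero_mul, Finset.sum_const_zero]
  ring

/-- Contracting `T` with `b` in two slots always yields `c₁₂`: skewness in the last two slots pairs
the terms, and invariance under `J` moves the two terms with `J` to the basis `J e`. It follows that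
`vectorTensor b θ` is orthogonal to the kernel. -/
theorem tensorInner_vectorTensor (hb : IsHermitianProduct b) (θ : E k →ₗ[ℝ] ℝ) {T : Tensor3 k}
    (hT : T ∈ KTensor k) {e : Fin (2 * (k + 1)) → E k} (he : IsOrthonormalBasis b e) :
    tensorInner e T (vectorTensor b θ) = 2 * ∑ l, c12 e T (e l) * θ (e l) +
      2 * ∑ l, c12 (fun i => J (e i)) T (J (e l)) * θ (J (e l)) := by
  have hsum : ∀ W Y Z, ∑ i, b (e i) W * T (e i) Y Z = T W Y Z := by
    intro W Y Z
    conv_rhs => rw [he.eq_sum W]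
    simp [hb.symm W]
  have hJ : ∀ W Y Z, T W Y Z = T W (J Y) (J Z) := fun W Y Z => (hT W Y Z).2.symm
  have hsk : ∀ W Y Z, T W Y Z = -T W Z Y := fun W Y Z => (hT W Y Z).1
  have e1 : ∑ j, ∑ l, (∑ i, b (e i) (e j) * T (e i) (e j) (e l)) * θ (e l) =
      ∑ l, c12 e T (e l) * θ (e l) := by
    rw [Finset.sum_comm]
    simp only [hsum, c12, Finset.sum_mul]
  have e2 : ∑ j, ∑ l, (∑ i, b (e i) (e l) * T (e i) (e j) (e l)) * θ (e j) =
      -∑ l, c12 e T (e l) * θ (e l) := by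
    simp only [hsum, c12, Finset.sum_mul, ← Finset.sum_neg_distrib]
    refine Finset.sum_congr rfl fun j _ => Finset.sum_congr rfl fun l _ => ?_
    rw [hsk]
    ring
  have e3 : ∑ j, ∑ l, (∑ i, b (e i) (J (e j)) * T (e i) (e j) (e l)) * θ (J (e l)) =
      ∑ l, c12 (fun i => J (e i)) T (J (e l)) * θ (J (e l)) := by
    rw [Finset.sum_comm]
    simp only [hsum, c12, Finset.sum_mul, ← hJ]
  have e4 : ∑ j, ∑ l, (∑ i, b (e i) (J (e l)) * T (e i) (e j) (e l)) * θ (J (e j)) =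
      -∑ l, c12 (fun i => J (e i)) T (J (e l)) * θ (J (e l)) := by
    simp only [hsum, c12, Finset.sum_mul, ← Finset.sum_neg_distrib, ← hJ]
    refine Finset.sum_congr rfl fun j _ => Finset.sum_congr rfl fun l _ => ?_
    rw [hsk]
    ring
  have h : tensorInner e T (vectorTensor b θ) =
      ∑ j, ∑ l, (∑ i, b (e i) (e j) * T (e i) (e j) (e l)) * θ (e l) -
      ∑ j, ∑ l, (∑ i, b (e i) (e l) * T (e i) (e j) (e l)) * θ (e j) +
      ∑ j, ∑ l, (∑ i, b (e i) (J (e j)) * T (e i) (e j) (e l)) * θ (J (e l)) -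
      ∑ j, ∑ l, (∑ i, b (e i) (J (e l)) * T (e i) (e j) (e l)) * θ (J (e j)) := by
    rw [tensorInner, Finset.sum_comm]
    simp only [← Finset.sum_sub_distrib, ← Finset.sum_add_distrib]
    refine Finset.sum_congr rfl fun j _ => ?_
    rw [Finset.sum_comm]
    refine Finset.sum_congr rfl fun l _ => ?_
    simp only [Finset.sum_mul, ← Finset.sum_sub_distrib, ← Finset.sum_add_distrib]
    refine Finset.sum_congr rfl fun i _ => ?_
    rw [vectorTensor_apply]
    ring
  rw [h, e1, e2, e3, e4]
  ring

theorem vectorTensor_mem_kerC12Perp (hb : IsHermitianProduct b) (θ : E k →ₗ[ℝ] ℝ) :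
    vectorTensor b θ ∈ kerC12Perp b := by
  refine ⟨vectorTensor_mem_KTensor b θ, fun T hT e he => ?_⟩
  rw [tensorInner_comm, hb.tensorInner_vectorTensor θ hT.1 he]
  simp [hT.2 _ he, hT.2 _ (hb.isOrthonormalBasis_J he)]

/-- The component of `T` in the orthogonal complement of the kernel of `c₁₂`. -/
theorem exists_sub_vectorTensor_mem_kerC12 (hb : IsHermitianProduct b) {T : Tensor3 k}
    (hT : T ∈ KTensor k) : ∃ θ, T - vectorTensor b θ ∈ kerC12 b := by
  obtain ⟨e, he⟩ := hb.exists_isOrthonormalBasis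
  have hn : (2 * ((k + 1 : ℕ) : ℝ)) ≠ 0 := by positivity
  -- The form is `c₁₂(T) / 2n`, as dictated by `c12_vectorTensor`.
  refine ⟨(2 * ((k + 1 : ℕ) : ℝ))⁻¹ • ∑ i, T (e i) (e i),
    sub_mem_KTensor hT (vectorTensor_mem_KTensor b _), fun e' he' Z => ?_⟩
  rw [he'.c12_eq_c12 hb.symm he, c12_sub, hb.c12_vectorTensor _ he, LinearMap.smul_apply,
    smul_eq_mul, mul_inv_cancel_left₀ hn]
  simp [c12]

theorem eq_zero_of_tensorInner_self {T : Tensor3 k} {e : Fin (2 * (k + 1)) → E k}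
    (he : IsOrthonormalBasis b e) (h : tensorInner e T T = 0) : T = 0 := by
  obtain ⟨e', he'⟩ := he.exists_basis
  have h1 : ∀ i j l, T (e i) (e j) (e l) = 0 := by
    intro i j l
    have n3 : ∀ i j l, 0 ≤ T (e i) (e j) (e l) * T (e i) (e j) (e l) := fun _ _ _ =>
      mul_self_nonneg _
    have a1 := (Finset.sum_eq_zero_iff_of_nonneg fun i _ => Finset.sum_nonneg fun j _ =>
      Finset.sum_nonneg fun l _ => n3 i j l).1 h i (Finset.mem_univ _)
    have a2 := (Finset.sum_eq_zero_iff_of_nonneg fun j _ =>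
      Finset.sum_nonneg fun l _ => n3 i j l).1 a1 j (Finset.mem_univ _)
    exact mul_self_eq_zero.1 ((Finset.sum_eq_zero_iff_of_nonneg fun l _ => n3 i j l).1 a2 l
      (Finset.mem_univ _))
  refine e'.ext fun i => e'.ext fun j => e'.ext fun l => ?_
  rw [he', he', he', h1]
  rfl

/-- Removing a suitable `vectorTensor` leaves a tensor that lies both in the kernel and in its
complement, hence is orthogonal to itself. -/
theorem kerC12Perp_subset_K24 (hb : IsHermitianProduct b) : kerC12Perp b ⊆ K24 b := by
  intro T hT
  obtain ⟨θ, hθ⟩ := hb.exists_sub_vectorTensor_mem_kerC12 hT.1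
  obtain ⟨e, he⟩ := hb.exists_isOrthonormalBasis
  have h : T - vectorTensor b θ = 0 := by
    apply eq_zero_of_tensorInner_self he
    rw [tensorInner_sub_left, hT.2 _ hθ e he, (hb.vectorTensor_mem_kerC12Perp θ).2 _ hθ e he,
      sub_self]
  rw [sub_eq_zero.1 h]
  exact hb.vectorTensor_mem_K24 θ

end IsHermitianProduct

theorem IsHomogeneousKahlerStructure.lower_mem_KTensor {k : ℕ} {μ : ℝ} {S : TensorField12 k}
    (hS : IsHomogeneousKahlerStructure μ S) {p : E k} (hp : p ∈ CH k) :
    lower μ S p ∈ KTensor k := by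
  intro X Y Z
  change metric μ p (S p X Y) Z = -metric μ p (S p X Z) Y ∧
    metric μ p (S p X (J Y)) (J Z) = metric μ p (S p X Y) Z
  constructor
  · rw [hS.metric_skew hp, metric_symm μ p Y]
  · rw [hS.apply_J hp, metric_J_J]

theorem ReductiveDescription.exists_alpha_ne_zero {k : ℕ} (d : ReductiveDescription k) :
    ∃ D ∈ d.m, alpha D ≠ 0 := by
  obtain ⟨β, hβ, hβ1, -⟩ := d.exists_lift_m
  refine ⟨β (0, 1), hβ _, ?_⟩
  have : alpha (β (0, 1)) = 1 := congrArg (fun y : E k => y.2.re) (hβ1 (0, 1))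
  rw [this]
  exact one_ne_zero

end CHn

end

/-! ### Proof of the corollary. -/

theorem mainTheorem7 (k : ℕ) (μ : ℝ) (hμ : 0 < μ) (S : CHn.TensorField12 k)
    (hS : CHn.IsHomogeneousKahlerStructure μ S) (hne : ∃ q ∈ CHn.CH k, S q ≠ 0)
    (p : CHn.E k) (hp : p ∈ CHn.CH k) :
    (∃ (d : CHn.ReductiveDescription k) (x : CHn.Mat k),
      CHn.MovesBaseTo x p ∧ CHn.IsCanonicalFor S d x p) ∧
    (∀ (d : CHn.ReductiveDescription k) (x : CHn.Mat k),
      CHn.MovesBaseTo x p → CHn.IsCanonicalFor S d x p →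
      ∀ e, CHn.IsOrthonormalBasis (CHn.metric μ p) e → ∀ D ∈ d.m,
        CHn.c12 e (CHn.lower μ S p) (CHn.toTangent x p D) =
          2 * ((k + 1 : ℕ) : ℝ) * CHn.alpha D) ∧
    (∃ T ∈ CHn.kerC12Perp (CHn.metric μ p), T ≠ 0 ∧
      CHn.lower μ S p - T ∈ CHn.kerC12 (CHn.metric μ p)) ∧
    CHn.kerC12Perp (CHn.metric μ p) ⊆ CHn.K24 (CHn.metric μ p) := by
  have hSp : S p ≠ 0 := by
    obtain ⟨q, hq, h⟩ := hne
    exact fun h0 => h (hS.eq_zero_of_eq_zero hp hq h0)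
  have hb := CHn.isHermitianProduct_metric hμ hp
  obtain ⟨d, x, hx, hc⟩ := hS.exists_description hμ hp hSp
  refine ⟨⟨d, x, hx, hc⟩, fun d x hx hc e he D hD => hS.c12_eq hμ hp hx hc he hD, ?_,
    hb.kerC12Perp_subset_K24⟩
  obtain ⟨θ, hθ⟩ := hb.exists_sub_vectorTensor_mem_kerC12 (hS.lower_mem_KTensor hp)
  -- If this component were zero, `c₁₂` would vanish on the structure, against the trace formula at
  -- a `D` with `alpha D ≠ 0`.
  refine ⟨_, hb.vectorTensor_mem_kerC12Perp θ, fun h => ?_, hθ⟩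
  obtain ⟨e, he⟩ := hb.exists_isOrthonormalBasis
  obtain ⟨D, hD, hα⟩ := d.exists_alpha_ne_zero
  have h1 := hθ.2 e he (CHn.toTangent x p D)
  rw [h, sub_zero, hS.c12_eq hμ hp hx hc he hD] at h1
  exact mul_ne_zero (by positivity) hα h1
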